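/- Let $C$ be a field of characteristic $2$, let $E$ be the elliptic curve $x^3=z^2+z$ over $C$, with the chord-tangent addition $\oplus$ whose neutral element is $(0,0)$, let $K_E=C(x,z)$ be its function field and $L=K_E(t)=C(x,z,t)$. A higher derivation on a ring $R$ is a ring homomorphism $\theta:R\to R[[T]]$, $\theta(r)=\sum_{n\ge 0}\theta^{(n)}(r)T^n$, with $\theta^{(0)}=\mathrm{id}$; it is an iterative derivation if $\theta^{(i)}\circ\theta^{(j)}=\binom{i+j}{i}\theta^{(i+j)}$ for all $i,j\ge 0$. Consider the higher derivations $\theta$ on $L$ with $\theta(c)=c$ for $c\in C$ and $\theta(t)=t+T$. Put $\xi_m=\theta^{(m)}(x)$, $$f(T)=\sum_{m\ge 0} f_mT^m=\theta(x)+\frac{x}{1+z}+\left(\frac{\theta(z)-\frac{z}{1+z}}{\theta(x)-\frac{x}{1+z}}\right)^2\in L[[T]],$$ and let $\tilde f_m\in L$ be $0$ for odd $m$ and the coefficient of $T^{m/2}$ in $\bigl(\theta(z)-\frac{z}{1+z}\bigr)\big/\bigl(\theta(x)-\frac{x}{1+z}\bigr)$ for even $m$, so that $f_m=\xi_m+\tilde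 f_m^{\,2}$ for all $m>0$. Let $D=K_E$ with the trivial derivation, let $LD$ be the field of fractions of $L\otimes_C D$ with the higher derivation induced by that of $L$ and the trivial one of $D$, and let $\rho:LD\to LD$ be the $D(t)$-homomorphism that sends the generic point $\eta_L=(x,z)$ of $E$ over $L$ to $\eta_L\oplus\eta_D$, where $\eta_D$ is the generic point of $E$ over $D$. We say that $\theta$ commutes with $\rho$ if $\theta\circ\rho=\rho[[T]]\circ\theta$ on $LD$. For $\ell\ge 0$ let $(*_\ell)$ be the condition $$\xi_{2^\ell}\in \sum_{m=1}^{2^\ell-1}\theta^{(2^\ell)}(\xi_m)t^m+\left(\sum_{m=0}^{2^\ell-1}\theta^{(m)}(\tilde f_{2^\ell})t^m\right)^2+C\bigl(t^{2^{\ell+1}}\bigr).$$ (1) $\theta$ is an iterative derivation commuting with $\rho$ if and only if for all $\ell\ge 0$ one has $\xi_{m+2^\ell}=\theta^{(2^\ell)}(\xi_m)$ for all $0<m<2^\ell$, and $(*_\ell)$ holds. (2) Such derivations can be constructed recursively. At stage $\ell$, if the conditions of (1) hold at all stages $j<\ell$, then the two sums $\sum_{m=1}^{2^\ell-1}\theta^{(2^\ell)}(\xi_m)t^m+\bigl(\sum_{m=0}^{2^\ell-1}\theta^{(m)}(\tilde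 f_{2^\ell})t^m\bigr)^2$ (taken together) and the elements $\theta^{(2^\ell)}(\xi_m)$, $0<m<2^\ell$, depend only on the $\xi_k$ with $k<2^\ell$. Moreover all choices are possible: for every sequence $(c_\ell)_{\ell\ge 0}$ with $c_\ell\in C(t^{2^{\ell+1}})$ there is exactly one such $\theta$ that is an iterative derivation, commutes with $\rho$ and satisfies $$\xi_{2^\ell}=\sum_{m=1}^{2^\ell-1}\theta^{(2^\ell)}(\xi_m)t^m+\left(\sum_{m=0}^{2^\ell-1}\theta^{(m)}(\tilde f_{2^\ell})t^m\right)^2+c_\ell\qquad\text{for all }\ell\ge 0.$$ -/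

import Mathlib

open WeierstrassCurve TensorProduct
noncomputable section
namespace StrongFormula
universe u v w

/-- The curve `z ^ 2 + z = x ^ 3`, in the Weierstrass coordinates `X = x`, `Y = z`. -/
def curve (R : Type u) [CommRing R] : WeierstrassCurve.Affine R :=
  { a₁ := 0, a₂ := 0, a₃ := 1, a₄ := 0, a₆ := 0 }

section Lift
variable {R : Type u} [CommRing R]

/-- The affine coordinate ring `R[x, z] / (z ^ 2 + z - x ^ 3)`. -/
abbrev CR (R : Type u) [CommRing R] : Type u := (curve R).CoordinateRing

/-- The coordinate `x`. -/
def crX : CR R := algebraMap (Polynomial R) _ Polynomial.X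
/-- The coordinate `z`. -/
def crZ : CR R := AdjoinRoot.root _

lemma cr_rel : (crZ : CR R) ^ 2 + crZ = crX ^ 3 := by
  have h : AdjoinRoot.mk (curve R).polynomial (Polynomial.X ^ 2 + Polynomial.X) =
      AdjoinRoot.mk (curve R).polynomial (Polynomial.C (Polynomial.X ^ 3)) := by
    refine AdjoinRoot.mk_eq_mk.mpr ⟨1, ?_⟩
    rw [WeierstrassCurve.Affine.polynomial]
    simp [curve]
  rw [map_add, map_pow, AdjoinRoot.mk_X, AdjoinRoot.mk_C, map_pow] at h
  exact h

variable {S : Type v} [CommRing S] [Algebra S R] {F : Type w} [CommRing F] [Algebra S F]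

/-- The homomorphism on the coordinate ring that extends `f` and sends the coordinates to the
point `(x, z)`. -/
def crLift (f : R →ₐ[S] F) (x z : F) (h : z ^ 2 + z = x ^ 3) : CR R →ₐ[S] F :=
  AdjoinRoot.liftAlgHom _ (Polynomial.aevalTower f x) z (by
    rw [WeierstrassCurve.Affine.polynomial]
    simp [curve, h, -map_pow, Polynomial.aevalTower])

@[simp] lemma crLift_X (f : R →ₐ[S] F) (x z : F) (h : z ^ 2 + z = x ^ 3) :
    crLift f x z h crX = x := by
  simp [crLift, crX, AdjoinRoot.algebraMap_eq, Polynomial.aevalTower]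

@[simp] lemma crLift_Z (f : R →ₐ[S] F) (x z : F) (h : z ^ 2 + z = x ^ 3) :
    crLift f x z h crZ = z := by
  simp [crLift, crZ]

lemma crLift_poly (f : R →ₐ[S] F) (x z : F) (h : z ^ 2 + z = x ^ 3) (p : Polynomial R) :
    crLift f x z h (algebraMap _ _ p) = p.eval₂ (f : R →+* F) x := by
  simp [crLift, AdjoinRoot.algebraMap_eq, Polynomial.aevalTower]

lemma crLift_base (f : R →ₐ[S] F) (x z : F) (h : z ^ 2 + z = x ^ 3) (r : R) :
    crLift f x z h (algebraMap R _ r) = f r := by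
  rw [IsScalarTower.algebraMap_apply R (Polynomial R) (CR R), crLift_poly]
  simp

lemma cr_hom_ext {f g : CR R →ₐ[S] F} (hb : ∀ r, f (algebraMap R _ r) = g (algebraMap R _ r))
    (hX : f crX = g crX) (hZ : f crZ = g crZ) : f = g := by
  have hp : ∀ p : Polynomial R, f (algebraMap _ _ p) = g (algebraMap _ _ p) := by
    intro p
    induction p using Polynomial.induction_on' with
    | add p q hp hq => rw [map_add, map_add, map_add, hp, hq]
    | monomial n a =>
      rw [← Polynomial.C_mul_X_pow_eq_monomial, map_mul, map_mul, map_mul, map_pow, map_pow, map_pow]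
      exact congrArg₂ (· * ·) (hb a) (congrArg (· ^ n) hX)
  refine AlgHom.ext fun a => ?_
  obtain ⟨p, q, rfl⟩ := WeierstrassCurve.Affine.CoordinateRing.exists_smul_basis_eq a
  rw [Algebra.smul_def, Algebra.smul_def, map_add, map_mul, map_mul, map_add, map_mul, map_mul,
    map_one, map_one, hp, hp]
  exact congrArg (fun u => g _ * 1 + g _ * u) hZ

lemma crLift_injective [IsDomain R] [IsDomain F] (f : R →ₐ[S] F) (x z : F) (h : z ^ 2 + z = x ^ 3)
    (hx : ∀ p : Polynomial R, p.eval₂ (f : R →+* F) x = 0 → p = 0) :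
    Function.Injective (crLift f x z h) := by
  have : Module.Finite (Polynomial R) (CR R) :=
    Module.Finite.of_basis (WeierstrassCurve.Affine.CoordinateRing.basis (curve R))
  have hk : RingHom.ker (crLift f x z h) = ⊥ := by
    apply Ideal.eq_bot_of_comap_eq_bot (R := Polynomial R)
    rw [eq_bot_iff]
    intro p hp
    rw [Ideal.mem_comap, RingHom.mem_ker, crLift_poly] at hp
    exact hx p hp
  exact (RingHom.injective_iff_ker_eq_bot _).mpr hk
end Lift

/-- The function field `k(x, z)` of the curve over `k`. -/
def FF (k : Type u) [Field k] : Type u := (curve k).FunctionField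

section Inst
variable (k : Type u) [Field k]
instance : Field (FF k) := inferInstanceAs (Field (FractionRing (CR k)))
instance : Algebra (CR k) (FF k) := inferInstanceAs (Algebra (CR k) (FractionRing (CR k)))
instance : IsFractionRing (CR k) (FF k) :=
  inferInstanceAs (IsFractionRing (CR k) (FractionRing (CR k)))
instance (S : Type v) [CommRing S] [Algebra S k] : Algebra S (FF k) :=
  inferInstanceAs (Algebra S (FractionRing (CR k)))
instance (S : Type v) [CommRing S] [Algebra S k] : IsScalarTower S (CR k) (FF k) :=
  inferInstanceAs (IsScalarTower S (CR k) (FractionRing (CR k)))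
instance (S : Type v) [CommRing S] [Algebra S k] (T : Type w) [CommRing T] [Algebra T k]
    [Algebra S T] [IsScalarTower S T k] : IsScalarTower S T (FF k) :=
  inferInstanceAs (IsScalarTower S T (FractionRing (CR k)))
end Inst

section Lift2
variable {k : Type u} [Field k]

/-- The generic coordinate `x`. -/
def ffX : FF k := algebraMap (CR k) _ crX
/-- The generic coordinate `z`. -/
def ffZ : FF k := algebraMap (CR k) _ crZ

lemma ff_rel : (ffZ : FF k) ^ 2 + ffZ = ffX ^ 3 := by
  simp only [ffX, ffZ, ← map_pow, ← map_add, cr_rel]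

variable {S : Type v} [CommRing S] [Algebra S k] {F : Type w} [Field F] [Algebra S F]

/-- The homomorphism on the function field that extends `f` and sends the coordinates to the
point `(x, z)`, where `x` is transcendental over `k`. -/
def ffLift (f : k →ₐ[S] F) (x z : F) (h : z ^ 2 + z = x ^ 3)
    (hx : ∀ p : Polynomial k, p.eval₂ (f : k →+* F) x = 0 → p = 0) : FF k →ₐ[S] F :=
  IsFractionRing.liftAlgHom (crLift_injective f x z h hx)

section
variable (f : k →ₐ[S] F) (x z : F) (h : z ^ 2 + z = x ^ 3)
    (hx : ∀ p : Polynomial k, p.eval₂ (f : k →+* F) x = 0 → p = 0)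

lemma ffLift_cr (a : CR k) : ffLift f x z h hx (algebraMap _ _ a) = crLift f x z h a := by
  simp [ffLift]
@[simp] lemma ffLift_X : ffLift f x z h hx ffX = x := by simp [ffX, ffLift_cr]
@[simp] lemma ffLift_Z : ffLift f x z h hx ffZ = z := by simp [ffZ, ffLift_cr]
lemma ffLift_base (r : k) : ffLift f x z h hx (algebraMap k _ r) = f r := by
  rw [IsScalarTower.algebraMap_apply k (CR k) (FF k), ffLift_cr, crLift_base]
end

lemma ffX_transcendental (p : Polynomial k)
    (hp : p.eval₂ (algebraMap k (FF k)) ffX = 0) : p = 0 := by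
  have h1 : p.eval₂ (algebraMap k (FF k)) ffX
      = algebraMap (CR k) (FF k) (algebraMap (Polynomial k) _ p) := by
    have : (algebraMap k (FF k)) = (algebraMap (CR k) (FF k)).comp (algebraMap k (CR k)) :=
      IsScalarTower.algebraMap_eq _ _ _
    rw [ffX, crX, this, ← Polynomial.hom_eval₂, IsScalarTower.algebraMap_eq k (Polynomial k) (CR k),
       ← Polynomial.hom_eval₂]
    congr 2
    exact Polynomial.eval₂_C_X
  rw [h1] at hp
  have h2 := (IsFractionRing.injective (CR k) (FF k)) (hp.trans (map_zero _).symm)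
  exact (FaithfulSMul.algebraMap_injective (Polynomial k) (CR k)) (h2.trans (map_zero _).symm)

lemma ff_subfield_eq_top (K : Subfield (FF k)) (hk : ∀ a, algebraMap k (FF k) a ∈ K)
    (hX : ffX ∈ K) (hZ : ffZ ∈ K) : K = ⊤ := by
  have hp : ∀ p : Polynomial k, algebraMap (CR k) (FF k) (algebraMap _ _ p) ∈ K := by
    intro p
    induction p using Polynomial.induction_on' with
    | add p q hp hq => rw [map_add, map_add]; exact K.add_mem hp hq
    | monomial n a =>
      rw [← Polynomial.C_mul_X_pow_eq_monomial, map_mul, map_mul, map_pow, map_pow]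
      refine K.mul_mem ?_ (K.pow_mem hX n)
      exact hk a
  have hc : ∀ a : CR k, algebraMap (CR k) (FF k) a ∈ K := by
    intro a
    obtain ⟨p, q, rfl⟩ := WeierstrassCurve.Affine.CoordinateRing.exists_smul_basis_eq a
    rw [Algebra.smul_def, Algebra.smul_def, map_add, map_mul, map_mul, map_one, mul_one]
    exact K.add_mem (hp p) (K.mul_mem (hp q) hZ)
  rw [eq_top_iff]
  intro a _
  obtain ⟨b, c, _, rfl⟩ := IsFractionRing.div_surjective (A := CR k) a
  exact K.div_mem (hc b) (hc c)
end Lift2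


section Fields
variable (C : Type u) [Field C]

/-- The function field `K_E = C(x, z)`; with the trivial derivation it is the field `D`. -/
abbrev K_E : Type u := FF C
/-- The field `L = K_E(t) = C(x, z, t)`, as the function field of the curve over `C(t)`. -/
abbrev L : Type u := FF (RatFunc C)
/-- The compositum `LD`, as the function field of the curve over `D(t)`. It is the field of
fractions of `L ⊗[C] D`, see `isFractionRing_tensor`. -/
abbrev LD : Type u := FF (RatFunc (K_E C))

/-- The inclusion `C[t] → D[t]`. -/
def polyIncl : Polynomial C →ₐ[C] Polynomial (K_E C) :=
  Polynomial.mapAlgHom (Algebra.ofId C (K_E C))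

lemma polyIncl_injective : Function.Injective (polyIncl C) :=
  Polynomial.map_injective _ (FaithfulSMul.algebraMap_injective C (K_E C))

/-- The inclusion `C(t) → D(t)`. -/
def ratIncl : RatFunc C →ₐ[C] RatFunc (K_E C) :=
  RatFunc.mapAlgHom (polyIncl C)
    (nonZeroDivisors_le_comap_nonZeroDivisors_of_injective _ (polyIncl_injective C))

lemma ratIncl_algebraMap (p : Polynomial C) :
    ratIncl C (algebraMap _ _ p) = algebraMap _ _ (polyIncl C p) := by
  have := RatFunc.map_apply_div (φ := polyIncl C)
    (nonZeroDivisors_le_comap_nonZeroDivisors_of_injective _ (polyIncl_injective C)) p 1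
  simp only [map_one, div_one] at this
  exact this

lemma ratIncl_X : ratIncl C RatFunc.X = RatFunc.X := by
  rw [← RatFunc.algebraMap_X, ratIncl_algebraMap, ← RatFunc.algebraMap_X]
  simp [polyIncl]

/-- The embedding of `L` in `LD`: it is the inclusion on `C(t)` and fixes the coordinates. -/
def LtoLD : L C →ₐ[C] LD C :=
  ffLift ((IsScalarTower.toAlgHom C (RatFunc (K_E C)) (LD C)).comp (ratIncl C)) ffX ffZ ff_rel (by
    intro p hp
    have h : (p.map (ratIncl C : RatFunc C →+* RatFunc (K_E C))).eval₂
        (algebraMap (RatFunc (K_E C)) (LD C)) ffX = 0 := by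
      rw [Polynomial.eval₂_map]; exact hp
    have h2 := ffX_transcendental _ h
    exact (Polynomial.map_eq_zero_iff (RingHom.injective _)).mp h2)

/-- The embedding of `D` in `LD` as constant rational functions of `t`. -/
def DtoLD : K_E C →ₐ[C] LD C := IsScalarTower.toAlgHom C (K_E C) (LD C)

/-- The map `L ⊗[C] D → LD` given by multiplication. -/
def tensorToLD : L C ⊗[C] K_E C →ₐ[C] LD C :=
  Algebra.TensorProduct.productMap (LtoLD C) (DtoLD C)

variable {C}

/-- The element `t` of `L`. -/
def tL : L C := algebraMap (RatFunc C) (L C) RatFunc.X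
/-- The element `t` of `LD`. -/
def tLD : LD C := algebraMap (RatFunc (K_E C)) (LD C) RatFunc.X

lemma LtoLD_t : LtoLD C tL = tLD := by
  rw [LtoLD, tL, ffLift_base, AlgHom.comp_apply, ratIncl_X]; rfl


/-- The inclusion of `k[t, x, z]` in `k(t, x, z)`. -/
def smallToL (k : Type u) [Field k] (S : Type v) [CommRing S] [Algebra S k] :
    CR (Polynomial k) →ₐ[S] FF (RatFunc k) :=
  crLift (IsScalarTower.toAlgHom S (Polynomial k) (FF (RatFunc k))) ffX ffZ ff_rel

section Small
variable (k : Type u) [Field k] (S : Type v) [CommRing S] [Algebra S k]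

lemma smallToL_injective : Function.Injective (smallToL k S) := by
  refine crLift_injective _ _ _ _ ?_
  intro p hp
  have h : (p.map (algebraMap (Polynomial k) (RatFunc k))).eval₂
      (algebraMap (RatFunc k) (FF (RatFunc k))) ffX = 0 := by
    rw [Polynomial.eval₂_map, ← IsScalarTower.algebraMap_eq]; exact hp
  exact (Polynomial.map_eq_zero_iff (RatFunc.algebraMap_injective k)).mp
    (ffX_transcendental _ h)

lemma smallToL_div_surjective (l : FF (RatFunc k)) :
    ∃ a b : CR (Polynomial k), b ≠ 0 ∧ l = smallToL k S a / smallToL k S b := by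
  let K : Subfield (FF (RatFunc k)) := Subfield.closure (Set.range (smallToL k S))
  have hK : K = ⊤ := by
    apply ff_subfield_eq_top
    · intro a
      induction a using RatFunc.induction_on with
      | f p q hq =>
        rw [map_div₀]
        refine K.div_mem (Subfield.subset_closure ⟨algebraMap _ _ p, ?_⟩)
          (Subfield.subset_closure ⟨algebraMap _ _ q, ?_⟩)
        · rw [smallToL, crLift_base]; exact (IsScalarTower.algebraMap_apply _ _ _ _)
        · rw [smallToL, crLift_base]; exact (IsScalarTower.algebraMap_apply _ _ _ _)
    · exact Subfield.subset_closure ⟨crX, by simp [smallToL]⟩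
    · exact Subfield.subset_closure ⟨crZ, by simp [smallToL]⟩
  have hl : l ∈ K := hK ▸ Subfield.mem_top l
  rw [Subfield.mem_closure_iff] at hl
  have hr : Subring.closure (Set.range (smallToL k S)) = (smallToL k S).toRingHom.range := by
    have : (Set.range (smallToL k S)) = ((smallToL k S).toRingHom.range : Set _) := rfl
    rw [this, Subring.closure_eq]
  rw [hr] at hl
  obtain ⟨_, ⟨a, rfl⟩, _, ⟨b, rfl⟩, h⟩ := hl
  by_cases hb : b = 0
  · refine ⟨0, 1, one_ne_zero, ?_⟩
    rw [← h, hb]; simp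
  · exact ⟨a, b, hb, h.symm⟩

end Small

lemma tensorToLD_injective_aux (r : L C ⊗[C] K_E C) : ∃ (b : CR (Polynomial C)) (_ : b ≠ 0)
    (s : CR (Polynomial C) ⊗[C] K_E C),
    (smallToL C C b ⊗ₜ[C] (1 : K_E C)) * r =
      Algebra.TensorProduct.map (smallToL C C) (AlgHom.id C (K_E C)) s := by
  induction r using TensorProduct.induction_on with
  | zero => exact ⟨1, one_ne_zero, 0, by simp⟩
  | tmul l d =>
    obtain ⟨a, b, hb, rfl⟩ := smallToL_div_surjective C C l
    refine ⟨b, hb, a ⊗ₜ d, ?_⟩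
    have : smallToL C C b ≠ 0 := (map_ne_zero_iff _ (smallToL_injective C C)).mpr hb
    rw [Algebra.TensorProduct.tmul_mul_tmul, one_mul, mul_div_cancel₀ _ this]
    simp
  | add x y hx hy =>
    obtain ⟨b, hb, s, h⟩ := hx
    obtain ⟨b', hb', s', h'⟩ := hy
    refine ⟨b * b', mul_ne_zero hb hb', (b' ⊗ₜ 1) * s + (b ⊗ₜ 1) * s', ?_⟩
    rw [map_add, map_mul _ _ s, map_mul (Algebra.TensorProduct.map (smallToL C C) (AlgHom.id C (K_E C))) _ s',
      ← h, ← h']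
    simp only [Algebra.TensorProduct.map_tmul, map_one, ← mul_assoc,
      Algebra.TensorProduct.tmul_mul_tmul, map_mul, mul_one, mul_add]
    rw [mul_comm (smallToL C C b') (smallToL C C b)]

/-- The `k`-basis of `k[t, x, z]` formed by the monomials of degree at most one in `z`. -/
def smallBasis (k : Type u) [Field k] : Module.Basis (ℕ × ℕ × Fin 2) k (CR (Polynomial k)) :=
  (Polynomial.basisMonomials k).smulTower ((Polynomial.basisMonomials (Polynomial k)).smulTower
    (WeierstrassCurve.Affine.CoordinateRing.basis (curve (Polynomial k))))

lemma smallBasis_apply (k : Type u) [Field k] (i : ℕ × ℕ × Fin 2) : smallBasis k i =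
    algebraMap (Polynomial k) _ Polynomial.X ^ i.1 * (crX ^ i.2.1 * crZ ^ (i.2.2 : ℕ)) := by
  obtain ⟨a, b, c⟩ := i
  have h1 : ∀ c : Fin 2, (WeierstrassCurve.Affine.CoordinateRing.basis (curve (Polynomial k))) c
      = crZ ^ (c : ℕ) := by
    intro c; fin_cases c
    · simp
    · simp; rfl
  simp only [smallBasis, Module.Basis.smulTower_apply, h1, Polynomial.coe_basisMonomials,
    Algebra.smul_def, Polynomial.monomial_one_right_eq_X_pow, map_pow]
  rfl

/-- The base change map `D ⊗[C] C[t, x, z] → D[t, x, z]`. -/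
def baseMap (C : Type u) [Field C] :
    K_E C ⊗[C] CR (Polynomial C) →ₐ[K_E C] CR (Polynomial (K_E C)) :=
  Algebra.TensorProduct.lift (Algebra.ofId _ _)
    (crLift ((IsScalarTower.toAlgHom C (Polynomial (K_E C)) (CR (Polynomial (K_E C)))).comp
      (polyIncl C)) crX crZ cr_rel) (fun _ _ => Commute.all _ _)

lemma baseMap_injective : Function.Injective (baseMap C) := by
  have h : (baseMap C).toLinearMap = ((Algebra.TensorProduct.basis (K_E C) (smallBasis C)).equiv
      (smallBasis (K_E C)) (Equiv.refl _)).toLinearMap := by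
    apply (Algebra.TensorProduct.basis (K_E C) (smallBasis C)).ext
    intro i
    rw [LinearEquiv.coe_coe, Module.Basis.equiv_apply, Algebra.TensorProduct.basis_apply,
      AlgHom.toLinearMap_apply, baseMap, Algebra.TensorProduct.lift_tmul, map_one, one_mul,
      smallBasis_apply, smallBasis_apply]
    simp only [map_mul, map_pow, crLift_X, crLift_Z, crLift_base, Equiv.refl_apply]
    simp [polyIncl]
  have h2 := ((Algebra.TensorProduct.basis (K_E C) (smallBasis C)).equiv
      (smallBasis (K_E C)) (Equiv.refl _)).injective
  intro x y hxy
  apply h2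
  have hx := LinearMap.congr_fun h x
  have hy := LinearMap.congr_fun h y
  exact hx.symm.trans (hxy.trans hy)

lemma tensorToLD_small (s : CR (Polynomial C) ⊗[C] K_E C) :
    tensorToLD C (Algebra.TensorProduct.map (smallToL C C) (AlgHom.id C (K_E C)) s) =
      smallToL (K_E C) (K_E C) (baseMap C (Algebra.TensorProduct.comm C _ _ s)) := by
  have : (tensorToLD C).comp (Algebra.TensorProduct.map (smallToL C C) (AlgHom.id C (K_E C))) =
    (((smallToL (K_E C) (K_E C)).restrictScalars C).comp ((baseMap C).restrictScalars C)).comp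
      (Algebra.TensorProduct.comm C _ _).toAlgHom := by
    apply Algebra.TensorProduct.ext
    · apply cr_hom_ext
      · intro p
        simp only [AlgHom.comp_apply, Algebra.TensorProduct.includeLeft_apply]
        simp [tensorToLD, smallToL, crLift_base, baseMap, LtoLD]
        rw [IsScalarTower.algebraMap_apply (Polynomial C) (RatFunc C) (FF (RatFunc C)), ffLift_base,
          AlgHom.comp_apply, ratIncl_algebraMap]
        exact (IsScalarTower.algebraMap_apply _ _ _ _).symm
      · simp [tensorToLD, smallToL, baseMap, LtoLD]
      · simp [tensorToLD, smallToL, baseMap, LtoLD]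
    · refine AlgHom.ext fun d => ?_
      simp [tensorToLD, DtoLD, baseMap, Algebra.ofId_apply]
  exact DFunLike.congr_fun this s

lemma tensorToLD_injective : Function.Injective (tensorToLD C) := by
  rw [injective_iff_map_eq_zero]
  intro r hr
  obtain ⟨b, hb, s, hs⟩ := tensorToLD_injective_aux r
  have h1 : tensorToLD C (Algebra.TensorProduct.map (smallToL C C) (AlgHom.id C (K_E C)) s) = 0 := by
    rw [← hs, map_mul, hr, mul_zero]
  rw [tensorToLD_small] at h1
  have h2 := baseMap_injective (((smallToL_injective (K_E C) (K_E C)) (h1.trans (map_zero _).symm)).trans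
    (map_zero _).symm)
  have h3 : s = 0 := (Algebra.TensorProduct.comm C _ _).injective (h2.trans (map_zero _).symm)
  rw [h3, map_zero] at hs
  have hb' : smallToL C C b ≠ 0 := (map_ne_zero_iff _ (smallToL_injective C C)).mpr hb
  have : ((smallToL C C b)⁻¹ ⊗ₜ[C] (1 : K_E C)) * (smallToL C C b ⊗ₜ[C] (1 : K_E C)) = 1 := by
    rw [Algebra.TensorProduct.tmul_mul_tmul, inv_mul_cancel₀ hb', mul_one]; rfl
  rw [← one_mul r, ← this, mul_assoc, hs, mul_zero]


variable (C) in
/-- `LD` as an algebra over `L ⊗[C] D`. -/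
@[reducible] def tensorAlgebra : Algebra (L C ⊗[C] K_E C) (LD C) := (tensorToLD C).toAlgebra

lemma tensorToLD_generates (K : Subfield (LD C)) (h : ∀ r, tensorToLD C r ∈ K) : K = ⊤ := by
  have hL : ∀ l, LtoLD C l ∈ K := fun l => by simpa [tensorToLD] using h (l ⊗ₜ 1)
  have hD : ∀ d, DtoLD C d ∈ K := fun d => by simpa [tensorToLD] using h (1 ⊗ₜ d)
  apply ff_subfield_eq_top
  · have ht : algebraMap (RatFunc (K_E C)) (LD C) RatFunc.X ∈ K := by
      have := hL tL
      rwa [LtoLD_t] at this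
    have hp : ∀ p : Polynomial (K_E C), algebraMap (RatFunc (K_E C)) (LD C) (algebraMap _ _ p) ∈ K := by
      intro p
      induction p using Polynomial.induction_on' with
      | add p q hp hq => rw [map_add, map_add]; exact K.add_mem hp hq
      | monomial n a =>
        rw [← Polynomial.C_mul_X_pow_eq_monomial, map_mul, map_mul, map_pow, map_pow,
          RatFunc.algebraMap_X]
        exact K.mul_mem (hD a) (K.pow_mem ht n)
    intro a
    induction a using RatFunc.induction_on with
    | f p q hq =>
      rw [map_div₀]
      exact K.div_mem (hp p) (hp q)
  · simpa [LtoLD] using hL ffX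
  · simpa [LtoLD] using hL ffZ

variable (C) in
lemma isFractionRing_tensor :
    letI := tensorAlgebra C; IsFractionRing (L C ⊗[C] K_E C) (LD C) := by
  let := tensorAlgebra C
  have : FaithfulSMul (L C ⊗[C] K_E C) (LD C) :=
    (faithfulSMul_iff_algebraMap_injective _ _).mpr tensorToLD_injective
  refine IsFractionRing.of_field _ _ fun z => ?_
  have hz : z ∈ Subfield.closure (Set.range (tensorToLD C)) := by
    rw [tensorToLD_generates _ (fun r => Subfield.subset_closure (Set.mem_range_self r))]
    exact Subfield.mem_top z
  rw [Subfield.mem_closure_iff] at hz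
  have hr : Subring.closure (Set.range (tensorToLD C)) = (tensorToLD C).toRingHom.range := by
    have : (Set.range (tensorToLD C)) = ((tensorToLD C).toRingHom.range : Set _) := rfl
    rw [this, Subring.closure_eq]
  rw [hr] at hz
  obtain ⟨_, ⟨a, rfl⟩, _, ⟨b, rfl⟩, h⟩ := hz
  exact ⟨a, b, h.symm⟩

section Points
variable (C) (F : Type u) [Field F] [Algebra C F]

/-- The group of `F`-valued points of the curve: the affine points `(x, z)` and the point at
infinity, with the point at infinity as the zero of Mathlib's chord-tangent law. -/
abbrev Pt := ((curve C).baseChange F).toAffine.Point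

variable {F}

lemma pt_equation {x z : F} (h : z ^ 2 + z = x ^ 3) :
    ((curve C).baseChange F).toAffine.Equation x z := by
  rw [WeierstrassCurve.Affine.equation_iff]
  simp [curve, WeierstrassCurve.baseChange, h]

lemma rel_of_nonsingular {x z : F} (h : ((curve C).baseChange F).toAffine.Nonsingular x z) :
    z ^ 2 + z = x ^ 3 := by
  have := (WeierstrassCurve.Affine.equation_iff ..).mp h.1
  simpa [curve, WeierstrassCurve.baseChange] using this

/-- The coordinate `x` of an affine point; the value at infinity is irrelevant. -/
def Pt.x : Pt C F → F
  | .zero => 0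
  | .some x _ _ => x

/-- The coordinate `z` of an affine point; the value at infinity is irrelevant. -/
def Pt.z : Pt C F → F
  | .zero => 0
  | .some _ z _ => z

lemma Pt.rel (P : Pt C F) : P.z C ^ 2 + P.z C = P.x C ^ 3 := by
  cases P with
  | zero => simp [Pt.x, Pt.z]
  | some x z h => exact rel_of_nonsingular C h

variable [CharP C 2]

lemma pt_nonsingular {x z : F} (h : z ^ 2 + z = x ^ 3) :
    ((curve C).baseChange F).toAffine.Nonsingular x z := by
  rw [WeierstrassCurve.Affine.nonsingular_iff]
  refine ⟨pt_equation C h, Or.inr ?_⟩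
  have : CharP F 2 := charP_of_injective_algebraMap (algebraMap C F).injective 2
  have h2 : (2 : F) = 0 := by exact_mod_cast CharP.cast_eq_zero F 2
  simp [curve, WeierstrassCurve.baseChange]
  intro h3
  have : (1 : F) = 0 := by linear_combination h3 - z * h2
  exact one_ne_zero this

/-- The affine point `(x, z)`. -/
def pt (x z : F) (h : z ^ 2 + z = x ^ 3) : Pt C F := .some x z (pt_nonsingular C h)

variable (F) in
/-- The point `(0, 0)`, a flex of the curve. -/
def origin : Pt C F := pt C 0 0 (by simp)

open scoped Classical in
/-- The addition on the curve whose neutral element is `(0, 0)`. -/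
def oplus (P Q : Pt C F) : Pt C F := P + Q - origin C F

variable {C}
open scoped Classical in
/-- The generic point of the curve over `L`, viewed in `E(LD)`. -/
def etaL : Pt C (LD C) :=
  WeierstrassCurve.Affine.Point.map (W' := curve C) (LtoLD C) (pt C ffX ffZ ff_rel)

open scoped Classical in
/-- The generic point of the curve over `D`, viewed in `E(LD)`. -/
def etaD : Pt C (LD C) :=
  WeierstrassCurve.Affine.Point.map (W' := curve C) (DtoLD C) (pt C ffX ffZ ff_rel)

open scoped Classical in
lemma etaSum_transcendental (p : Polynomial (RatFunc (K_E C)))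
    (hp : p.eval₂ (algebraMap _ (LD C)) (Pt.x C (oplus C etaL etaD)) = 0) : p = 0 := by
  by_contra hp0
  let K := algebraicClosure (RatFunc (K_E C)) (LD C)
  have hx : Pt.x C (oplus C etaL etaD) ∈ K := by
    rw [mem_algebraicClosure_iff]
    exact ⟨p, hp0, hp⟩
  let i : K →ₐ[C] LD C := K.val.restrictScalars C
  let mapi := WeierstrassCurve.Affine.Point.map (W' := curve C) i
  have hrange : ∀ P : Pt C (LD C), P.x C ∈ K → P ∈ mapi.range := by
    intro P hP
    cases P with
    | zero => exact mapi.range.zero_mem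
    | some x z h =>
      have hr := rel_of_nonsingular C h
      have hz : z ∈ K := by
        rw [mem_algebraicClosure_iff]
        have hzK : IsIntegral K z := by
          refine ⟨Polynomial.X ^ 2 + Polynomial.X - Polynomial.C ((⟨x, hP⟩ : K) ^ 3), ?_, ?_⟩
          · monicity!
          · have hx3 : algebraMap K (LD C) ((⟨x, hP⟩ : K) ^ 3) = x ^ 3 := rfl
            rw [Polynomial.eval₂_sub, Polynomial.eval₂_add, Polynomial.eval₂_pow, Polynomial.eval₂_X,
              Polynomial.eval₂_C, hx3, hr, sub_self]
        exact (isIntegral_trans (R := RatFunc (K_E C)) z hzK).isAlgebraic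
      exact ⟨pt C (⟨x, hP⟩ : K) ⟨z, hz⟩ (Subtype.ext hr), rfl⟩
  have hS := hrange _ hx
  have hD : etaD ∈ mapi.range := by
    apply hrange
    have : Pt.x C (etaD (C := C)) = algebraMap (RatFunc (K_E C)) (LD C) (algebraMap _ _ ffX) :=
      IsScalarTower.algebraMap_apply _ _ _ _
    rw [this]
    exact K.algebraMap_mem _
  have hO : origin C (LD C) ∈ mapi.range := hrange _ K.zero_mem
  have hL : etaL ∈ mapi.range := by
    have : etaL (C := C) = oplus C etaL etaD - etaD + origin C (LD C) := by
      rw [oplus]; abel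
    rw [this]
    exact mapi.range.add_mem (mapi.range.sub_mem hS hD) hO
  obtain ⟨P, hP⟩ := hL
  have hX : (ffX : LD C) ∈ K := by
    have h1 : Pt.x C (etaL (C := C)) = ffX := by
      change LtoLD C ffX = ffX
      simp [LtoLD]
    rw [← h1, ← hP]
    cases P with
    | zero => exact K.zero_mem
    | some x z h => exact x.2
  rw [mem_algebraicClosure_iff] at hX
  obtain ⟨q, hq, hq0⟩ := hX
  exact hq (ffX_transcendental q hq0)

variable (C) in
/-- The endomorphism `ρ` of `LD` over `D(t)` which sends the generic point `η_L` to
`η_L ⊕ η_D`: it is the comorphism of `(p₁, p₂) ↦ (p₁ ⊕ p₂, p₂)`. -/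
def rho : LD C →ₐ[RatFunc (K_E C)] LD C :=
  ffLift (Algebra.ofId (RatFunc (K_E C)) (LD C)) (Pt.x C (oplus C etaL etaD))
    (Pt.z C (oplus C etaL etaD)) (Pt.rel C _) etaSum_transcendental

end Points

section HD
open PowerSeries

/-- A higher derivation: a ring homomorphism `θ : R → R⟦T⟧` with `θ(r)` equal to `r` at `T = 0`. -/
structure HigherDerivation (R : Type u) [CommRing R] where
  toRingHom : R →+* R⟦X⟧
  constantCoeff_apply : ∀ r, constantCoeff (toRingHom r) = r

namespace HigherDerivation
variable {R : Type u} [CommRing R]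

/-- The map `θ^(n)`: the coefficient of `T ^ n` in `θ`. -/
def coeff (θ : HigherDerivation R) (n : ℕ) (r : R) : R := PowerSeries.coeff n (θ.toRingHom r)

/-- Iterative derivations: `θ^(i) ∘ θ^(j) = binom (i + j) i • θ^(i + j)`. -/
def IsIterative (θ : HigherDerivation R) : Prop :=
  ∀ (i j : ℕ) (r : R), θ.coeff i (θ.coeff j r) = ((i + j).choose i : R) * θ.coeff (i + j) r

/-- `f` is a homomorphism of rings with higher derivation: `θ' ∘ f = f⟦T⟧ ∘ θ`. -/
def IsHom {S : Type u} [CommRing S] (θ : HigherDerivation R) (θ' : HigherDerivation S)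
    (f : R →+* S) : Prop :=
  ∀ r, θ'.toRingHom (f r) = PowerSeries.map f (θ.toRingHom r)
end HigherDerivation

/-- `θ` extends the iterative derivation with respect to `t` on `C(t)`, which is the homomorphism
of `C`-algebras with `θ(t) = t + T`. -/
def ExtendsDt (θ : HigherDerivation (L C)) : Prop :=
  (∀ c : C, θ.toRingHom (algebraMap C (L C) c) = PowerSeries.C (algebraMap C (L C) c)) ∧
  θ.toRingHom tL = PowerSeries.C tL + PowerSeries.X

variable (C) in
/-- The higher derivations on `L` that extend the iterative derivation with respect to `t` on
`C(t)`. -/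
def HDL : Type u := { θ : HigherDerivation (L C) // ExtendsDt θ }

namespace HDL
variable (θ : HDL C)

/-- `θ` as a homomorphism of `C`-algebras. -/
def toAlgHom : L C →ₐ[C] (L C)⟦X⟧ :=
  { θ.1.toRingHom with
    commutes' := fun c => (θ.2.1 c).trans (PowerSeries.algebraMap_apply).symm }

/-- The extension of `θ` to `L ⊗[C] D`, with the trivial derivation on `D`, composed with the map
from `L ⊗[C] D` to `LD`: `θ^(k)(l ⊗ d) = θ^(k)(l) ⊗ d`. -/
def onTensor : L C ⊗[C] K_E C →ₐ[C] (LD C)⟦X⟧ :=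
  Algebra.TensorProduct.productMap ((PowerSeries.mapAlgHom (LtoLD C)).comp θ.toAlgHom)
    ((IsScalarTower.toAlgHom C (LD C) (LD C)⟦X⟧).comp (DtoLD C))

lemma onTensor_tmul (l : L C) (d : K_E C) : θ.onTensor (l ⊗ₜ d) =
    PowerSeries.map (LtoLD C).toRingHom (θ.1.toRingHom l) * PowerSeries.C (DtoLD C d) := by
  rw [onTensor, Algebra.TensorProduct.productMap_apply_tmul, AlgHom.comp_apply, AlgHom.comp_apply]
  rfl

lemma constantCoeff_onTensor (r : L C ⊗[C] K_E C) :
    constantCoeff (θ.onTensor r) = tensorToLD C r := by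
  induction r using TensorProduct.induction_on with
  | zero => rw [map_zero, map_zero, map_zero]
  | add x y hx hy => rw [map_add, map_add, hx, hy, map_add]
  | tmul l d =>
    rw [onTensor_tmul, map_mul, constantCoeff_C, tensorToLD,
      Algebra.TensorProduct.productMap_apply_tmul, ← coeff_zero_eq_constantCoeff_apply, coeff_map,
      coeff_zero_eq_constantCoeff_apply, θ.1.constantCoeff_apply]
    rfl

lemma isUnit_onTensor (r : nonZeroDivisors (L C ⊗[C] K_E C)) :
    IsUnit (θ.onTensor.toRingHom r) := by
  rw [PowerSeries.isUnit_iff_constantCoeff]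
  change IsUnit (constantCoeff (θ.onTensor r))
  rw [constantCoeff_onTensor]
  exact ((map_ne_zero_iff _ tensorToLD_injective).mpr (nonZeroDivisors.coe_ne_zero r)).isUnit

/-- The extension to the field of fractions: `θ(r / s) = θ(r) θ(s)⁻¹`. -/
def onLDHom : LD C →+* (LD C)⟦X⟧ :=
  letI := tensorAlgebra C
  haveI := isFractionRing_tensor C
  IsLocalization.lift (M := nonZeroDivisors (L C ⊗[C] K_E C)) (g := θ.onTensor.toRingHom)
    θ.isUnit_onTensor

lemma onLDHom_tensor (r : L C ⊗[C] K_E C) : θ.onLDHom (tensorToLD C r) = θ.onTensor r := by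
  let := tensorAlgebra C
  have := isFractionRing_tensor C
  exact IsLocalization.lift_eq (M := nonZeroDivisors (L C ⊗[C] K_E C)) θ.isUnit_onTensor r

lemma onLDHom_L (l : L C) : θ.onLDHom (LtoLD C l) =
    PowerSeries.map (LtoLD C).toRingHom (θ.1.toRingHom l) := by
  have h : tensorToLD C (l ⊗ₜ 1) = LtoLD C l := by simp [tensorToLD]
  rw [← h, onLDHom_tensor, onTensor_tmul, map_one, map_one, mul_one]

lemma onLDHom_D (d : K_E C) : θ.onLDHom (DtoLD C d) = PowerSeries.C (DtoLD C d) := by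
  have h : tensorToLD C (1 ⊗ₜ d) = DtoLD C d := by simp [tensorToLD]
  rw [← h, onLDHom_tensor, onTensor_tmul, map_one, map_one, one_mul, h]

/-- The higher derivation on `LD` that extends `θ` on `L` and the trivial one on `D`. -/
def onLD : HigherDerivation (LD C) where
  toRingHom := θ.onLDHom
  constantCoeff_apply := by
    let K : Subfield (LD C) := RingHom.eqLocusField (constantCoeff.comp θ.onLDHom) (RingHom.id _)
    have hK : K = ⊤ := tensorToLD_generates K fun r => by
      change constantCoeff (θ.onLDHom (tensorToLD C r)) = tensorToLD C r
      rw [onLDHom_tensor, constantCoeff_onTensor]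
    intro a
    have : a ∈ K := hK ▸ Subfield.mem_top a
    exact this

/-- `ξ_m = θ^(m)(x)`. -/
def xi (m : ℕ) : L C := θ.1.coeff m ffX

/-- The series `(θ(z) - z / (1 + z)) / (θ(x) - x / (1 + z))`. Its denominator has a nonzero
constant coefficient, see `slope_denominator`. -/
def slope : (L C)⟦X⟧ :=
  (θ.1.toRingHom ffZ - PowerSeries.C (ffZ / (1 + ffZ))) *
    (θ.1.toRingHom ffX - PowerSeries.C (ffX / (1 + ffZ)))⁻¹

/-- The series `f(T)`, which is the coordinate `x` of `η_L ⊖ θ(η_L)`. -/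
def f : (L C)⟦X⟧ := θ.1.toRingHom ffX + PowerSeries.C (ffX / (1 + ffZ)) + θ.slope ^ 2

/-- The element `f̃_m`: it is `0` for odd `m`, and `f_m = ξ_m + f̃_m ^ 2` for all `m > 0`, see
`coeff_f`. -/
def fTilde (m : ℕ) : L C := if Even m then PowerSeries.coeff (m / 2) θ.slope else 0

lemma coeff_f [CharP C 2] (m : ℕ) (hm : 0 < m) :
    PowerSeries.coeff m θ.f = θ.xi m + θ.fTilde m ^ 2 := by
  have hc : CharP (L C) 2 := charP_of_injective_algebraMap (algebraMap C (L C)).injective 2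
  have hs : PowerSeries.coeff m (θ.slope ^ 2) = θ.fTilde m ^ 2 := by
    have h : θ.slope ^ 2 = PowerSeries.map (frobenius (L C) 2)
        (PowerSeries.expand 2 two_ne_zero θ.slope) :=
      (MvPowerSeries.map_frobenius_expand (f := θ.slope) 2 two_ne_zero).symm
    rw [h, PowerSeries.coeff_map, PowerSeries.coeff_expand, fTilde, frobenius_def]
    simp only [even_iff_two_dvd]
  rw [f, map_add, map_add, hs, PowerSeries.coeff_C, if_neg hm.ne', add_zero]
  rfl

lemma ffZ_ne : (ffZ : L C) ≠ 0 ∧ (1 + ffZ : L C) ≠ 0 ∧ (ffX : L C) ≠ 0 := by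
  have hx : (ffX : L C) ≠ 0 := fun h =>
    Polynomial.X_ne_zero (ffX_transcendental (k := RatFunc C) Polynomial.X (by simpa using h))
  have h := ff_rel (k := RatFunc C)
  have h2 : (ffZ : L C) * (1 + ffZ) ≠ 0 := by
    rw [show (ffZ : L C) * (1 + ffZ) = ffX ^ 3 by rw [← h]; ring]
    exact pow_ne_zero 3 hx
  exact ⟨left_ne_zero_of_mul h2, right_ne_zero_of_mul h2, hx⟩

lemma slope_denominator :
    constantCoeff (θ.1.toRingHom ffX - PowerSeries.C (ffX / (1 + ffZ) : L C)) ≠ 0 := by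
  obtain ⟨h1, h2, h3⟩ := ffZ_ne (C := C)
  rw [map_sub, θ.1.constantCoeff_apply, constantCoeff_C]
  have : (ffX : L C) - ffX / (1 + ffZ) = ffX * ffZ / (1 + ffZ) := by field_simp; ring
  rw [this]
  exact div_ne_zero (mul_ne_zero h3 h1) h2

/-- `θ` commutes with `ρ`: `ρ` is a homomorphism of rings with higher derivation on `LD`. -/
def CommutesWithRho [CharP C 2] : Prop := θ.onLD.IsHom θ.onLD (rho C).toRingHom

/-- The subfield `C(t ^ (2 ^ (ℓ + 1)))` of `L`. -/
def constField (C : Type u) [Field C] (l : ℕ) : IntermediateField C (L C) :=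
  IntermediateField.adjoin C {tL ^ (2 ^ (l + 1))}

/-- `∑_{m = 1}^{2^ℓ - 1} θ^(2^ℓ)(ξ_m) t^m + (∑_{m = 0}^{2^ℓ - 1} θ^(m)(f̃_{2^ℓ}) t^m)^2`. -/
def mainTerm (l : ℕ) : L C :=
  ∑ m ∈ Finset.Ico 1 (2 ^ l), θ.1.coeff (2 ^ l) (θ.xi m) * tL ^ m
    + (∑ m ∈ Finset.range (2 ^ l), θ.1.coeff m (θ.fTilde (2 ^ l)) * tL ^ m) ^ 2

/-- The two conditions on the `ξ_m` at the stage `ℓ`: `ξ_{m + 2^ℓ} = θ^(2^ℓ)(ξ_m)` for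
`0 < m < 2^ℓ`, and `ξ_{2^ℓ}` lies in the coset `mainTerm ℓ + C(t ^ (2 ^ (ℓ + 1)))`. -/
def Stage (l : ℕ) : Prop :=
  (∀ m, 0 < m → m < 2 ^ l → θ.xi (m + 2 ^ l) = θ.1.coeff (2 ^ l) (θ.xi m)) ∧
    ∃ c ∈ constField C l, θ.xi (2 ^ l) = θ.mainTerm l + c

end HDL
end HD
end Fields
end StrongFormula
end

/-!
Write `F = C(t)`, and let `s_k` be the coefficients of the slope series, so that
`f_m = ξ_m + s_{m/2} ^ 2` for even `m > 0` and `f_m = ξ_m` for odd `m`.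

A higher derivation `θ` on `L` that extends the one of `C(t)` is the same thing as a sequence
`ξ_1, ξ_2, …` of elements of `L`: once the series `θ(x)` is prescribed, `θ(z)` is the root with
constant term `z` of an Artin–Schreier equation (`exists_xi_eq`, `eq_of_xi_eq`). So the `ξ_m` can
be chosen recursively (`exists_recursive`).

Commutation with `ρ` means that the point `η_L ⊖ θ(η_L)`, whose coordinate `x` is `f`, is fixed
by `ρ`. The exchange of `η_L` and `η_D` shows that the elements of `L` fixed by `ρ` are those
of `F` (`rho_LtoLD_eq_iff`). As the coordinate `z` of the point is determined by `f`, commutation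
with `ρ` is equivalent to `f_m ∈ F` for all `m` (`commutesWithRho_iff`).

The heart of the argument is that iterativity and `f_m ∈ F` in orders below `q = 2 ^ ℓ`, together
with the stage `ℓ`, imply the same in orders below `2 q` (`GoodBelow.succ`).

* Since `ξ_m` is the sum of an element of `F` and a square for `0 < m < q`, it inherits
  iterativity in the range below `2 q`. An identity of generating functions
  (`coeff_sum_mul_tL_pow`) computes `θ^(j)` of the right-hand side of the stage `ℓ`, with the result
  `θ^(j)(ξ_q) = θ^(q)(ξ_j)` for `0 < j < q` and `θ^(q)(ξ_q) = 0`. This is iterativity at `x` in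
  orders at most `q`, and in characteristic two iterativity in orders below `2 q` follows
  (`iterativeAt_two_pow_succ`).
* For the `f_m` one needs that the `s_k` satisfy the iteration rule modulo `F`
  (`GoodBelow.slope_defect_mem_baseField`). Replace `θ` by a higher derivation which agrees with it
  below `q` and commutes with `ρ`. Because `ρ(x) = x + u + s ^ 2` with a constant `u`, the defect of
  iterativity at `x` is invariant under `ρ` in orders below `2 q`, so it lies in `F`; up to elements
  of `F` it is the square of the defect at `s_k`, and an element of `L` whose square lies in `F`
  lies in `F`.

Conversely, an iterative `θ` that commutes with `ρ` satisfies all stages, where the element of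
`C(t ^ (2 q))` is `∑_{m < 2 q} θ^(m)(f_q) t ^ m` (`sum_coeff_mul_tL_pow_mem_constField`). Finally
`θ^(q)(ξ_m) = θ^(q)(f_m) + θ^(q)(f̃_m ^ 2)` depends only on lower terms when `f_m ∈ F`
(`GoodBelow.coeff_xi_eq`), which gives the recursive construction.
-/

noncomputable section
namespace StrongFormula
universe u v w

/-! ### Homomorphisms out of function fields -/

lemma ratFunc_mem_of_adjoin {k : Type u} [Field k] {M : Type v} [Field M] (i : RatFunc k →+* M)
    (K : Subfield M) (hk : ∀ a : k, i (algebraMap k _ a) ∈ K) (ht : i RatFunc.X ∈ K)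
    (a : RatFunc k) : i a ∈ K := by
  have hp : ∀ p : Polynomial k, i (algebraMap _ _ p) ∈ K := by
    intro p
    induction p using Polynomial.induction_on' with
    | add p q hp hq => rw [map_add, map_add]; exact K.add_mem hp hq
    | monomial n a =>
      rw [← Polynomial.C_mul_X_pow_eq_monomial, map_mul, map_mul, map_pow, map_pow,
        RatFunc.algebraMap_X]
      exact K.mul_mem (hk a) (K.pow_mem ht n)
  induction a using RatFunc.induction_on with
  | f p q hq =>
    rw [map_div₀]
    exact K.div_mem (hp p) (hp q)

lemma ff_subfield_eq_top_of_adjoin {k : Type u} [Field k] (K : Subfield (FF (RatFunc k)))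
    (hk : ∀ a : k, algebraMap (RatFunc k) (FF (RatFunc k)) (algebraMap k _ a) ∈ K)
    (ht : algebraMap (RatFunc k) (FF (RatFunc k)) RatFunc.X ∈ K)
    (hX : ffX ∈ K) (hZ : ffZ ∈ K) : K = ⊤ :=
  ff_subfield_eq_top K (ratFunc_mem_of_adjoin _ K hk ht) hX hZ

/-- The coordinate `z` is a root of the Artin–Schreier equation `Z ^ 2 + Z = x ^ 3`, and two roots
of it differ by a root `d` of `d * (d + 1) = 0`. -/
lemma map_ffZ_eq {k : Type u} [Field k] {S : Type v} [CommRing S]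
    (Φ Ψ : FF k →+* S) (hx : Φ ffX = Ψ ffX)
    (hz : IsUnit (Φ ffZ + Ψ ffZ + 1)) : Φ ffZ = Ψ ffZ := by
  have h1 : Φ ffZ ^ 2 + Φ ffZ = Φ ffX ^ 3 := by rw [← map_pow, ← map_pow, ← map_add, ff_rel]
  have h2 : Ψ ffZ ^ 2 + Ψ ffZ = Ψ ffX ^ 3 := by rw [← map_pow, ← map_pow, ← map_add, ff_rel]
  rw [← sub_eq_zero]
  refine hz.mul_left_eq_zero.mp ?_
  rw [hx] at h1
  linear_combination h1 - h2

lemma ff_ringHom_ext {k : Type u} [Field k] {S : Type v} [CommRing S]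
    (Φ Ψ : FF k →+* S) (hk : ∀ a, Φ (algebraMap k _ a) = Ψ (algebraMap k _ a))
    (hx : Φ ffX = Ψ ffX) (hz : IsUnit (Φ ffZ + Ψ ffZ + 1)) : Φ = Ψ := by
  cases subsingleton_or_nontrivial S with
  | inl h => exact RingHom.ext fun a => Subsingleton.elim _ _
  | inr h =>
    have : Φ.eqLocusField Ψ = ⊤ := ff_subfield_eq_top _ hk hx (map_ffZ_eq Φ Ψ hx hz)
    exact RingHom.ext fun a => (this ▸ Subfield.mem_top a : a ∈ Φ.eqLocusField Ψ)

section PowerSeriesLemmas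
open PowerSeries
variable {R : Type u} [CommRing R]

/-- The substitution of `T + U` for the variable: the coefficient of `U ^ i` in the coefficient
of `T ^ j` of the image of `F` is `binom (i + j) i • F_{i + j}`. It is multiplicative by
Vandermonde's identity. -/
def shift : R⟦X⟧ →+* R⟦X⟧⟦X⟧ where
  toFun F := mk fun j => mk fun i => ((i + j).choose i : R) * coeff (i + j) F
  map_zero' := by ext; simp
  map_one' := by
    ext j i
    rw [coeff_mk, coeff_mk, coeff_one, coeff_one]
    rcases Nat.eq_zero_or_pos j with rfl | hj
    · rcases Nat.eq_zero_or_pos i with rfl | hi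
      · simp
      · rw [if_neg (by lia), if_pos rfl, coeff_one, if_neg hi.ne', mul_zero]
    · rw [if_neg (by lia), if_neg hj.ne', mul_zero, map_zero]
  map_add' F G := by ext j i; simp [mul_add]
  map_mul' F G := by
    ext j i
    rw [coeff_mk, coeff_mk, coeff_mul, coeff_mul, map_sum]
    simp_rw [coeff_mul, coeff_mk]
    rw [Finset.sum_comm, Finset.mul_sum]
    have h : ∀ p ∈ Finset.HasAntidiagonal.antidiagonal (i + j), ((i + j).choose i : R) * (coeff p.1 F * coeff p.2 G)
        = ∑ r ∈ Finset.HasAntidiagonal.antidiagonal i,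
          (p.1.choose r.1 : R) * (p.2.choose r.2) * (coeff p.1 F * coeff p.2 G) := by
      intro p hp
      rw [← Finset.HasAntidiagonal.mem_antidiagonal.mp hp, Nat.add_choose_eq, Nat.cast_sum, Finset.sum_mul]
      simp
    rw [Finset.sum_congr rfl h, Finset.sum_comm]
    refine Finset.sum_congr rfl fun r hr => ?_
    rw [Finset.HasAntidiagonal.mem_antidiagonal] at hr
    symm
    refine Finset.sum_of_injOn (fun s => (r.1 + s.1, r.2 + s.2)) ?_ ?_ ?_ ?_
    · rintro ⟨a, b⟩ - ⟨c, d⟩ - h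
      simpa using h
    · rintro ⟨a, b⟩ hs
      simp at hs ⊢
      lia
    · rintro ⟨a, b⟩ hp hn
      rw [Finset.HasAntidiagonal.mem_antidiagonal] at hp
      by_cases h1 : a < r.1
      · simp [Nat.choose_eq_zero_of_lt h1]
      by_cases h2 : b < r.2
      · simp [Nat.choose_eq_zero_of_lt h2]
      refine absurd ⟨(a - r.1, b - r.2), ?_, ?_⟩ hn
      · simp; simp at hp; lia
      · simp; lia
    · rintro ⟨a, b⟩ -
      simp only
      ring

lemma coeff_coeff_shift (F : R⟦X⟧) (i j : ℕ) :
    coeff i (coeff j (shift F)) = ((i + j).choose i : R) * coeff (i + j) F := by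
  simp [shift]

/-- The ideal of the series without monomials `T ^ j * U ^ i` with `i < M` and `j < N`. -/
def rectIdeal (R : Type u) [CommRing R] (M N : ℕ) : Ideal R⟦X⟧⟦X⟧ where
  carrier := {F | ∀ i < M, ∀ j < N, coeff i (coeff j F) = 0}
  zero_mem' := by simp
  add_mem' := by
    intro F G hF hG i hi j hj
    rw [map_add, map_add, hF i hi j hj, hG i hi j hj, add_zero]
  smul_mem' := by
    intro F G hG i hi j hj
    rw [smul_eq_mul, coeff_mul, map_sum]
    refine Finset.sum_eq_zero fun p hp => ?_
    rw [coeff_mul]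
    refine Finset.sum_eq_zero fun r hr => ?_
    rw [Finset.HasAntidiagonal.mem_antidiagonal] at hp hr
    rw [hG _ (by lia) _ (by lia), mul_zero]

lemma mem_rectIdeal {M N : ℕ} {F : R⟦X⟧⟦X⟧} :
    F ∈ rectIdeal R M N ↔ ∀ i < M, ∀ j < N, coeff i (coeff j F) = 0 := Iff.rfl

lemma coeff_sq_of_charP_two [CharP R 2] (F : R⟦X⟧) (m : ℕ) :
    coeff m (F ^ 2) = if Even m then coeff (m / 2) F ^ 2 else 0 := by
  have h : F ^ 2 = PowerSeries.map (frobenius R 2) (PowerSeries.expand 2 two_ne_zero F) :=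
    (MvPowerSeries.map_frobenius_expand (f := F) 2 two_ne_zero).symm
  rw [h, PowerSeries.coeff_map, PowerSeries.coeff_expand, frobenius_def]
  simp only [even_iff_two_dvd]
  split_ifs <;> simp

/-- The coefficients of the root without constant term of the Artin–Schreier equation
`W ^ 2 + W = H`, for a series `H` without constant term in characteristic two. -/
def artinSchreierCoeff (H : R⟦X⟧) (m : ℕ) : R :=
  coeff m H + if h : Even m ∧ 0 < m then artinSchreierCoeff H (m / 2) ^ 2 else 0
termination_by m
decreasing_by lia

lemma exists_artinSchreier_root [CharP R 2] (H : R⟦X⟧) (h0 : constantCoeff H = 0) :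
    ∃ W : R⟦X⟧, constantCoeff W = 0 ∧ W ^ 2 + W = H := by
  have hz : artinSchreierCoeff H 0 = 0 := by
    rw [artinSchreierCoeff]; simp [h0]
  refine ⟨mk (artinSchreierCoeff H), by simp [hz], ?_⟩
  ext m
  rw [map_add, coeff_sq_of_charP_two, coeff_mk, coeff_mk]
  conv_lhs => arg 2; rw [artinSchreierCoeff]
  have h2 : (2 : R) = 0 := by exact_mod_cast CharP.cast_eq_zero R 2
  rcases Nat.eq_zero_or_pos m with rfl | hm
  · simp [hz]
  · by_cases he : Even m
    · rw [if_pos he, dif_pos ⟨he, hm⟩]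
      linear_combination (artinSchreierCoeff H (m / 2)) ^ 2 * h2
    · rw [if_neg he, dif_neg (fun h => he h.1)]; ring

end PowerSeriesLemmas

/-! ### Binomial coefficients modulo two -/
section Choose
variable {R : Type u} [CommRing R] [CharP R 2]

lemma cast_choose_add_two_pow (l n k : ℕ) : ((n + 2 ^ l).choose k : R) =
    n.choose k + if 2 ^ l ≤ k then (n.choose (k - 2 ^ l) : R) else 0 := by
  have h : ((Polynomial.X + 1 : Polynomial R) ^ (n + 2 ^ l)).coeff k =
      ((Polynomial.X + 1 : Polynomial R) ^ n * (Polynomial.X ^ 2 ^ l + 1)).coeff k := by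
    rw [pow_add, add_pow_char_pow, one_pow]
  rw [Polynomial.coeff_X_add_one_pow, mul_add, mul_one, Polynomial.coeff_add,
    Polynomial.coeff_mul_X_pow', Polynomial.coeff_X_add_one_pow] at h
  rw [h, add_comm]
  simp only [Polynomial.coeff_X_add_one_pow]

lemma cast_choose_two_mul (n k : ℕ) : ((2 * n).choose k : R) =
    if Even k then (n.choose (k / 2) : R) else 0 := by
  have h : ((Polynomial.X + 1 : Polynomial R) ^ (2 * n)).coeff k =
      (Polynomial.expand R 2 ((Polynomial.X + 1) ^ n)).coeff k := by
    rw [pow_mul, add_pow_char, one_pow]; simp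
  rw [Polynomial.coeff_X_add_one_pow, Polynomial.coeff_expand two_pos] at h
  rw [h]
  simp only [even_iff_two_dvd, Polynomial.coeff_X_add_one_pow]

lemma cast_choose_of_lt_two_pow {l i j : ℕ} (hi : i < 2 ^ l) (hj : j < 2 ^ l)
    (h : 2 ^ l ≤ i + j) : ((i + j).choose i : R) = 0 := by
  have := cast_choose_add_two_pow (R := R) l (i + j - 2 ^ l) i
  rw [Nat.sub_add_cancel h, if_neg (by omega),
    Nat.choose_eq_zero_of_lt (n := i + j - 2 ^ l) (by omega), Nat.cast_zero, add_zero] at this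
  exact this

lemma cast_choose_sq (n k : ℕ) : (n.choose k : R) ^ 2 = n.choose k := by
  have := map_natCast (frobenius R 2) (n.choose k)
  rwa [frobenius_def] at this

lemma add_eq_zero_iff_eq_of_charP_two {a b : R} : a + b = 0 ↔ a = b := by
  rw [← CharTwo.sub_eq_add, sub_eq_zero]

end Choose

/-! ### Higher derivations -/
namespace HigherDerivation
open PowerSeries
section
variable {R : Type u} [CommRing R] (θ : HigherDerivation R)

lemma coeff_zero (a : R) : θ.coeff 0 a = a := by
  rw [coeff, coeff_zero_eq_constantCoeff_apply, θ.constantCoeff_apply]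

lemma coeff_add (n : ℕ) (a b : R) : θ.coeff n (a + b) = θ.coeff n a + θ.coeff n b := by
  simp [coeff]

lemma coeff_map_zero (n : ℕ) : θ.coeff n 0 = 0 := by
  simp [coeff]

lemma coeff_sum {ι : Type*} (n : ℕ) (s : Finset ι) (g : ι → R) :
    θ.coeff n (∑ i ∈ s, g i) = ∑ i ∈ s, θ.coeff n (g i) := by
  simp [coeff]

lemma coeff_natCast_mul (n k : ℕ) (a : R) : θ.coeff n ((k : R) * a) = k * θ.coeff n a := by
  simp only [coeff, map_mul, map_natCast]
  rw [← map_natCast (PowerSeries.C (R := R)) k, coeff_C_mul]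

lemma coeff_sq [CharP R 2] (n : ℕ) (a : R) :
    θ.coeff n (a ^ 2) = if Even n then θ.coeff (n / 2) a ^ 2 else 0 := by
  rw [coeff, map_pow, coeff_sq_of_charP_two]; rfl

/-- The identity `θ^(i) (θ^(j) r) = binom (i + j) i • θ^(i + j) r` for all `i < M` and
`j < N`. -/
def IterativeAt (M N : ℕ) (r : R) : Prop :=
  ∀ i < M, ∀ j < N, θ.coeff i (θ.coeff j r) = ((i + j).choose i : R) * θ.coeff (i + j) r

/-- The homomorphism `a ↦ θ_U (θ_T a)` to the power series in `T` over the power series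
in `U`. -/
def twice : R →+* R⟦X⟧⟦X⟧ := (PowerSeries.map θ.toRingHom).comp θ.toRingHom

lemma coeff_coeff_twice (a : R) (i j : ℕ) :
    PowerSeries.coeff i (PowerSeries.coeff j (θ.twice a)) = θ.coeff i (θ.coeff j a) := by
  simp [twice, coeff]

/-- Iterativity is tested by comparing the homomorphisms `θ_U ∘ θ_T` and `θ_{T + U}` modulo an
ideal; this makes it accessible to extensionality of homomorphisms. -/
lemma iterativeAt_iff {M N : ℕ} {r : R} : θ.IterativeAt M N r ↔
    Ideal.Quotient.mk (rectIdeal R M N) (θ.twice r) =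
      Ideal.Quotient.mk (rectIdeal R M N) (shift (θ.toRingHom r)) := by
  rw [Ideal.Quotient.mk_eq_mk_iff_sub_mem, mem_rectIdeal]
  refine forall₂_congr fun i hi => forall₂_congr fun j hj => ?_
  rw [map_sub, map_sub, sub_eq_zero, coeff_coeff_twice, coeff_coeff_shift]
  rfl

/-- In characteristic two `θ^(2n)(a ^ 2) = θ^(n)(a) ^ 2`, and the odd orders vanish, so that
squaring doubles the range of iterativity. -/
lemma IterativeAt.sq [CharP R 2] {θ : HigherDerivation R} {M N : ℕ} {a : R}
    (h : θ.IterativeAt M N a) : θ.IterativeAt (2 * M) (2 * N) (a ^ 2) := by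
  intro i hi j hj
  rw [coeff_sq, coeff_sq]
  by_cases hj' : Even j
  · by_cases hi' : Even i
    · obtain ⟨i, rfl⟩ := hi'.exists_two_nsmul
      obtain ⟨j, rfl⟩ := hj'.exists_two_nsmul
      simp only [smul_eq_mul] at *
      rw [if_pos hj', coeff_sq, if_pos hi', ← mul_add, if_pos (even_two_mul _),
        cast_choose_two_mul, if_pos hi']
      simp only [Nat.mul_div_cancel_left _ two_pos]
      rw [h i (by lia) j (by lia), mul_pow, cast_choose_sq]
    · have : ¬ Even (i + j) := by rw [Nat.even_add]; tauto
      rw [if_pos hj', coeff_sq, if_neg hi', if_neg this, mul_zero]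
  · rw [if_neg hj', coeff_map_zero]
    by_cases hi' : Even i
    · have : ¬ Even (i + j) := by rw [Nat.even_add]; tauto
      rw [if_neg this, mul_zero]
    · have : Even (i + j) := by rw [Nat.even_add]; tauto
      obtain ⟨k, hk⟩ := this.exists_two_nsmul
      rw [hk, smul_eq_mul, cast_choose_two_mul, if_neg hi', zero_mul]

lemma IterativeAt.add {θ : HigherDerivation R} {M N : ℕ} {a b : R}
    (ha : θ.IterativeAt M N a) (hb : θ.IterativeAt M N b) : θ.IterativeAt M N (a + b) := by
  intro i hi j hj
  simp only [coeff_add, ha i hi j hj, hb i hi j hj, mul_add]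

end

section
variable {F : Type u} [Field F] (θ : HigherDerivation F)

/-- The elements of a field at which a higher derivation is iterative in a given range form a
subfield. -/
def iterativeSubfield (M N : ℕ) : Subfield F where
  carrier := {a | θ.IterativeAt M N a}
  zero_mem' := by intro i _ j _; simp [coeff]
  one_mem' := by simp only [Set.mem_ofPred_eq, iterativeAt_iff, map_one]
  add_mem' := fun ha hb => ha.add hb
  mul_mem' := by
    intro a b ha hb
    simp only [Set.mem_ofPred_eq, iterativeAt_iff, map_mul] at *
    rw [ha, hb]
  neg_mem' := by
    intro a ha
    simp only [Set.mem_ofPred_eq, iterativeAt_iff, map_neg] at *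
    rw [ha]
  inv_mem' := by
    intro a ha
    simp only [Set.mem_ofPred_eq, iterativeAt_iff] at *
    exact eq_on_inv₀ ((Ideal.Quotient.mk (rectIdeal F M N)).comp θ.twice)
      (((Ideal.Quotient.mk (rectIdeal F M N)).comp shift).comp θ.toRingHom) ha

/-- A constant is iterative in every range. -/
lemma iterativeAt_of_eq_C {a : F} (h : θ.toRingHom a = PowerSeries.C a) (M N : ℕ) :
    θ.IterativeAt M N a := by
  intro i _ j _
  have h' : ∀ j, θ.coeff j a = if j = 0 then a else 0 := fun j => by
    rw [coeff, h, PowerSeries.coeff_C]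
  rw [h', h']
  split_ifs <;> simp_all [coeff_map_zero]

lemma iterativeAt_of_eq_C_add_X {a : F} (h : θ.toRingHom a = PowerSeries.C a + PowerSeries.X)
    (M N : ℕ) : θ.IterativeAt M N a := by
  intro i _ j _
  have h' : ∀ j, θ.coeff j a = if j = 0 then a else if j = 1 then 1 else 0 := fun j => by
    rw [coeff, h, map_add, PowerSeries.coeff_C, PowerSeries.coeff_X]
    split_ifs <;> simp_all
  have h1 : ∀ i, θ.coeff i 1 = if i = 0 then 1 else 0 := fun i => by
    rw [coeff, map_one, PowerSeries.coeff_one]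
  rw [h' j, h' (i + j)]
  rcases j with _ | _ | j
  · simp [h']
  · rw [if_neg (by lia), if_pos rfl, h1]
    rcases i with _ | i <;> simp
  · simp only [add_eq_zero, one_ne_zero, and_false, if_false]
    rw [if_neg (by lia), if_neg (by lia)]
    simp [coeff_map_zero]
end
end HigherDerivation

/-! ### Higher derivations on `C(x, z, t)` as sequences of values at `x` -/

section
variable {C : Type u} [Field C]

instance [CharP C 2] : CharP (L C) 2 :=
  charP_of_injective_algebraMap (algebraMap C (L C)).injective 2

instance [CharP C 2] : CharP (LD C) 2 :=
  charP_of_injective_algebraMap (algebraMap C (LD C)).injective 2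

variable (C) in
/-- The subfield `C(t)` of `L`. -/
def baseField : Subfield (L C) := (algebraMap (RatFunc C) (L C)).fieldRange

lemma algebraMap_mem_baseField (r : RatFunc C) : algebraMap _ _ r ∈ baseField C := ⟨r, rfl⟩

lemma tL_mem_baseField : tL ∈ baseField C := ⟨RatFunc.X, rfl⟩

lemma constField_le_baseField (l : ℕ) {c : L C} (hc : c ∈ HDL.constField C l) :
    c ∈ baseField C := by
  have h : HDL.constField C l ≤
      ((Algebra.ofId (RatFunc C) (L C)).restrictScalars C).fieldRange :=
    IntermediateField.adjoin_le_iff.mpr (by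
      rintro _ rfl
      exact ⟨RatFunc.X ^ 2 ^ (l + 1), by simp [tL]⟩)
  obtain ⟨r, hr⟩ := h hc
  exact ⟨r, hr⟩

open PowerSeries in
variable (C) in
/-- The homomorphism `p(t) ↦ p(t + T)` on polynomials. -/
def polyTaylor : Polynomial C →+* (RatFunc C)⟦X⟧ :=
  Polynomial.eval₂RingHom ((PowerSeries.C).comp (algebraMap C (RatFunc C)))
    (PowerSeries.C RatFunc.X + PowerSeries.X)

lemma constantCoeff_polyTaylor (p : Polynomial C) :
    PowerSeries.constantCoeff (polyTaylor C p) = algebraMap _ (RatFunc C) p := by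
  have : PowerSeries.constantCoeff.comp (polyTaylor C) = algebraMap _ (RatFunc C) := by
    apply Polynomial.ringHom_ext
    · intro a; simp [polyTaylor, RatFunc.algebraMap_eq_C]
    · simp [polyTaylor]
  exact DFunLike.congr_fun this p

lemma isUnit_polyTaylor (p : nonZeroDivisors (Polynomial C)) : IsUnit (polyTaylor C p) := by
  rw [PowerSeries.isUnit_iff_constantCoeff, constantCoeff_polyTaylor]
  exact (RatFunc.algebraMap_ne_zero (nonZeroDivisors.coe_ne_zero p)).isUnit

open PowerSeries in
variable (C) in
/-- The Taylor expansion `r(t) ↦ r(t + T)` of rational functions, which is the iterative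
derivation with respect to `t` on `C(t)`. -/
def ratTaylor : RatFunc C →+* (RatFunc C)⟦X⟧ :=
  IsLocalization.lift (M := nonZeroDivisors (Polynomial C)) isUnit_polyTaylor

lemma ratTaylor_algebraMap (p : Polynomial C) :
    ratTaylor C (algebraMap _ _ p) = polyTaylor C p :=
  IsLocalization.lift_eq (M := nonZeroDivisors (Polynomial C)) isUnit_polyTaylor p

lemma ratTaylor_X : ratTaylor C RatFunc.X = PowerSeries.C RatFunc.X + PowerSeries.X := by
  rw [← RatFunc.algebraMap_X, ratTaylor_algebraMap]
  simp [polyTaylor]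

lemma ratTaylor_const (c : C) :
    ratTaylor C (algebraMap C _ c) = PowerSeries.C (algebraMap C _ c) := by
  rw [IsScalarTower.algebraMap_apply C (Polynomial C) (RatFunc C), ratTaylor_algebraMap]
  simp [polyTaylor, RatFunc.algebraMap_eq_C]

lemma constantCoeff_ratTaylor (r : RatFunc C) :
    PowerSeries.constantCoeff (ratTaylor C r) = r := by
  have := ratFunc_mem_of_adjoin (RingHom.id (RatFunc C))
    ((PowerSeries.constantCoeff.comp (ratTaylor C)).eqLocusField (RingHom.id _))
    (fun a => by
      rw [RingHom.id_apply, RingHom.mem_eqLocusField, RingHom.comp_apply, ratTaylor_const]; simp)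
    (by simp [ratTaylor_X]) r
  simpa using this

namespace HDL
open PowerSeries
variable (θ θ' : HDL C)

lemma toRingHom_base (r : RatFunc C) : θ.1.toRingHom (algebraMap _ _ r) =
    PowerSeries.map (algebraMap (RatFunc C) (L C)) (ratTaylor C r) := by
  have := ratFunc_mem_of_adjoin (RingHom.id (RatFunc C))
    ((θ.1.toRingHom.comp (algebraMap (RatFunc C) (L C))).eqLocusField
      ((PowerSeries.map (algebraMap (RatFunc C) (L C))).comp (ratTaylor C)))
    (fun a => by
      have := θ.2.1 a
      rw [IsScalarTower.algebraMap_apply C (RatFunc C) (L C)] at this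
      rw [RingHom.id_apply, RingHom.mem_eqLocusField, RingHom.comp_apply, RingHom.comp_apply, this,
        ratTaylor_const, PowerSeries.map_C])
    (by
      have := θ.2.2
      rw [tL] at this
      simp [ratTaylor_X, this]) r
  simpa using this

lemma coeff_mem_baseField (n : ℕ) {a : L C} (ha : a ∈ baseField C) :
    θ.1.coeff n a ∈ baseField C := by
  obtain ⟨r, rfl⟩ := ha
  rw [HigherDerivation.coeff, toRingHom_base, PowerSeries.coeff_map]
  exact algebraMap_mem_baseField _

lemma coeff_eq_of_mem_baseField (n : ℕ) {a : L C} (ha : a ∈ baseField C) :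
    θ.1.coeff n a = θ'.1.coeff n a := by
  obtain ⟨r, rfl⟩ := ha
  rw [HigherDerivation.coeff, HigherDerivation.coeff, toRingHom_base, toRingHom_base]

/-- Every higher derivation in question is iterative on `C(t)`. -/
lemma iterativeAt_of_mem_baseField (M N : ℕ) {a : L C} (ha : a ∈ baseField C) :
    θ.1.IterativeAt M N a := by
  obtain ⟨r, rfl⟩ := ha
  refine ratFunc_mem_of_adjoin (algebraMap (RatFunc C) (L C)) (θ.1.iterativeSubfield M N)
    (fun c => ?_) ?_ r
  · rw [← IsScalarTower.algebraMap_apply C (RatFunc C) (L C)]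
    exact θ.1.iterativeAt_of_eq_C (θ.2.1 c) M N
  · exact θ.1.iterativeAt_of_eq_C_add_X θ.2.2 M N

variable {θ θ'}

lemma isUnit_add_add_one [CharP C 2] {F G : (L C)⟦X⟧} (h : constantCoeff F = constantCoeff G) :
    IsUnit (F + G + 1) := by
  rw [PowerSeries.isUnit_iff_constantCoeff]
  simp [h, CharTwo.add_self_eq_zero]

/-- The values at `x` determine `θ`, also up to a given order. -/
lemma coeff_eq_of_xi_eq [CharP C 2] {N : ℕ} (h : ∀ m < N, θ.xi m = θ'.xi m) {m : ℕ} (hm : m < N)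
    (a : L C) : θ.1.coeff m a = θ'.1.coeff m a := by
  let q := Ideal.Quotient.mk (Ideal.span {(PowerSeries.X : (L C)⟦X⟧) ^ N})
  have hq : ∀ F G, q F = q G ↔ ∀ m < N, PowerSeries.coeff m F = PowerSeries.coeff m G := by
    intro F G
    simp only [q]
    rw [Ideal.Quotient.mk_eq_mk_iff_sub_mem, Ideal.mem_span_singleton, PowerSeries.X_pow_dvd_iff]
    simp only [map_sub, sub_eq_zero]
  have key : q.comp θ.1.toRingHom = q.comp θ'.1.toRingHom := by
    apply ff_ringHom_ext
    · intro r
      simp only [RingHom.comp_apply, toRingHom_base]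
    · exact (hq _ _).mpr h
    · simp only [RingHom.comp_apply]
      rw [← map_one q, ← map_add, ← map_add]
      exact (isUnit_add_add_one
        (by rw [θ.1.constantCoeff_apply, θ'.1.constantCoeff_apply])).map q
  exact (hq _ _).mp (DFunLike.congr_fun key a) m hm

lemma eq_of_xi_eq [CharP C 2] (h : ∀ m, θ.xi m = θ'.xi m) : θ = θ' := by
  obtain ⟨⟨f, hf⟩, h1⟩ := θ
  obtain ⟨⟨g, hg⟩, h2⟩ := θ'
  have : f = g := RingHom.ext fun a => PowerSeries.ext fun n =>
    coeff_eq_of_xi_eq (N := n + 1) (fun m _ => h m) n.lt_succ_self a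
  subst this
  rfl

lemma coeff_slope_eq_of_xi_eq [CharP C 2] {N : ℕ} (h : ∀ m < N, θ.xi m = θ'.xi m) {m : ℕ}
    (hm : m < N) : PowerSeries.coeff m θ.slope = PowerSeries.coeff m θ'.slope := by
  have hd : ∀ a, (PowerSeries.X : (L C)⟦X⟧) ^ N ∣ θ.1.toRingHom a - θ'.1.toRingHom a := fun a =>
    PowerSeries.X_pow_dvd_iff.mpr fun m hm => by
      rw [map_sub, sub_eq_zero]; exact coeff_eq_of_xi_eq h hm a
  suffices h : (PowerSeries.X : (L C)⟦X⟧) ^ N ∣ θ.slope - θ'.slope by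
    have := PowerSeries.X_pow_dvd_iff.mp h m hm
    rwa [map_sub, sub_eq_zero] at this
  have h1 := PowerSeries.mul_inv_cancel _ θ.slope_denominator
  have h2 := PowerSeries.mul_inv_cancel _ θ'.slope_denominator
  obtain ⟨u, hu⟩ := hd ffX
  obtain ⟨v, hv⟩ := hd ffZ
  rw [slope, slope]
  set A := θ.1.toRingHom ffX - PowerSeries.C (ffX / (1 + ffZ) : L C)
  set B := θ'.1.toRingHom ffX - PowerSeries.C (ffX / (1 + ffZ) : L C)
  set P := θ.1.toRingHom ffZ - PowerSeries.C (ffZ / (1 + ffZ) : L C)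
  set Q := θ'.1.toRingHom ffZ - PowerSeries.C (ffZ / (1 + ffZ) : L C)
  have hA : A - B = PowerSeries.X ^ N * u := by rw [← hu]; simp [A, B]
  have hP : P - Q = PowerSeries.X ^ N * v := by rw [← hv]; simp [P, Q]
  refine ⟨(v * B - Q * u) * A⁻¹ * B⁻¹, ?_⟩
  linear_combination (P * A⁻¹) * -h2 + Q * B⁻¹ * h1 + A⁻¹ * B⁻¹ * B * hP - A⁻¹ * B⁻¹ * Q * hA

lemma fTilde_eq_of_xi_eq [CharP C 2] {N : ℕ} (h : ∀ m < N, θ.xi m = θ'.xi m) {m : ℕ}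
    (hm : m < 2 * N) : θ.fTilde m = θ'.fTilde m := by
  rw [fTilde, fTilde, coeff_slope_eq_of_xi_eq h (by lia)]

lemma fTilde_two_mul (m : ℕ) : θ.fTilde (2 * m) = PowerSeries.coeff m θ.slope := by
  simp [fTilde]

lemma xi_zero : θ.xi 0 = ffX := θ.1.coeff_zero _

lemma xi_eq [CharP C 2] {m : ℕ} (hm : 0 < m) :
    θ.xi m = PowerSeries.coeff m θ.f + θ.fTilde m ^ 2 := by
  rw [θ.coeff_f m hm, add_assoc, CharTwo.add_self_eq_zero, add_zero]

section Existence
variable {x z : (L C)⟦X⟧} (h : z ^ 2 + z = x ^ 3)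

/-- The homomorphism to power series which is the Taylor expansion on `C(t)` and sends the
coordinates to the point `(x, z)`, on the coordinate ring. -/
def crHom : CR (RatFunc C) →ₐ[C] (L C)⟦X⟧ :=
  crLift ({ (PowerSeries.map (algebraMap (RatFunc C) (L C))).comp (ratTaylor C) with
    commutes' := fun c => by
      change PowerSeries.map (algebraMap (RatFunc C) (L C)) (ratTaylor C (algebraMap C _ c)) = _
      rw [ratTaylor_const, PowerSeries.map_C, ← IsScalarTower.algebraMap_apply,
        PowerSeries.algebraMap_apply] } : RatFunc C →ₐ[C] (L C)⟦X⟧) x z h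

lemma constantCoeff_crHom (hx : constantCoeff x = ffX) (hz : constantCoeff z = ffZ)
    (a : CR (RatFunc C)) : constantCoeff (crHom h a) = algebraMap _ (L C) a := by
  let c : (L C)⟦X⟧ →ₐ[C] L C := { (constantCoeff : (L C)⟦X⟧ →+* L C) with
    commutes' := fun c => PowerSeries.constantCoeff_C (algebraMap C (L C) c) }
  have : c.comp (crHom h) = IsScalarTower.toAlgHom C (CR (RatFunc C)) (L C) := by
    apply cr_hom_ext
    · intro r
      rw [AlgHom.comp_apply, crHom, crLift_base]
      change constantCoeff (PowerSeries.map (algebraMap (RatFunc C) (L C)) (ratTaylor C r)) = _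
      rw [← coeff_zero_eq_constantCoeff_apply, PowerSeries.coeff_map,
        coeff_zero_eq_constantCoeff_apply, constantCoeff_ratTaylor]
      exact IsScalarTower.algebraMap_apply (RatFunc C) (CR (RatFunc C)) (L C) r
    · rw [AlgHom.comp_apply, crHom, crLift_X]; exact hx
    · rw [AlgHom.comp_apply, crHom, crLift_Z]; exact hz
  exact DFunLike.congr_fun this a

lemma isUnit_crHom (hx : constantCoeff x = ffX) (hz : constantCoeff z = ffZ)
    (a : nonZeroDivisors (CR (RatFunc C))) : IsUnit ((crHom h).toRingHom a) := by
  rw [PowerSeries.isUnit_iff_constantCoeff]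
  change IsUnit (constantCoeff (crHom h a))
  rw [constantCoeff_crHom h hx hz]
  exact (IsFractionRing.to_map_ne_zero_of_mem_nonZeroDivisors a.2).isUnit

/-- The higher derivation that sends the coordinates to a given point over `L⟦T⟧` which reduces
to the generic point. -/
def ofPoint (hx : constantCoeff x = ffX) (hz : constantCoeff z = ffZ) : HDL C := by
  let Θ : L C →+* (L C)⟦X⟧ :=
    IsLocalization.lift (M := nonZeroDivisors (CR (RatFunc C))) (isUnit_crHom h hx hz)
  have hΘ : ∀ a, Θ (algebraMap (CR (RatFunc C)) _ a) = crHom h a := fun a =>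
    IsLocalization.lift_eq (M := nonZeroDivisors (CR (RatFunc C))) (isUnit_crHom h hx hz) a
  have hb : ∀ r : RatFunc C, Θ (algebraMap _ _ r) =
      PowerSeries.map (algebraMap (RatFunc C) (L C)) (ratTaylor C r) := by
    intro r
    rw [IsScalarTower.algebraMap_apply (RatFunc C) (CR (RatFunc C)) (L C), hΘ, crHom, crLift_base]
    rfl
  refine ⟨⟨Θ, ?_⟩, ?_, ?_⟩
  · have : constantCoeff.comp Θ = RingHom.id (L C) := by
      apply IsLocalization.ringHom_ext (nonZeroDivisors (CR (RatFunc C)))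
      refine RingHom.ext fun a => ?_
      simp only [RingHom.comp_apply, hΘ, RingHom.id_apply, constantCoeff_crHom h hx hz]
    exact fun r => DFunLike.congr_fun this r
  · intro c
    change Θ _ = _
    rw [IsScalarTower.algebraMap_apply C (RatFunc C) (L C), hb, ratTaylor_const, PowerSeries.map_C]
  · change Θ _ = _
    rw [tL, hb, ratTaylor_X, map_add, PowerSeries.map_C, PowerSeries.map_X]

lemma ofPoint_apply_ffX (hx : constantCoeff x = ffX) (hz : constantCoeff z = ffZ) :
    (ofPoint h hx hz).1.toRingHom ffX = x := by
  change IsLocalization.lift (M := nonZeroDivisors (CR (RatFunc C))) (isUnit_crHom h hx hz) _ = _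
  rw [ffX]
  refine (IsLocalization.lift_eq (M := nonZeroDivisors (CR (RatFunc C))) _ _).trans ?_
  exact crLift_X _ _ _ _

end Existence

/-- The values of `θ` at `x` can be prescribed arbitrarily, because the Artin–Schreier equation
for the value at `z` is solvable. -/
lemma exists_xi_eq [CharP C 2] (ξ : ℕ → L C) : ∃ θ : HDL C, ∀ m, 0 < m → θ.xi m = ξ m := by
  let x : (L C)⟦X⟧ := PowerSeries.mk fun n => if n = 0 then ffX else ξ n
  have hx : constantCoeff x = ffX := by simp [x]
  obtain ⟨W, hW0, hW⟩ := exists_artinSchreier_root (x ^ 3 - PowerSeries.C ((ffX : L C) ^ 3))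
    (by simp [hx])
  have h2 : (2 : (L C)⟦X⟧) = 0 := by
    have := CharP.cast_eq_zero (L C) 2
    rw [← map_ofNat (PowerSeries.C (R := L C)) 2]
    simpa using this
  have h : (PowerSeries.C ffZ + W) ^ 2 + (PowerSeries.C ffZ + W) = x ^ 3 := by
    have h1 := congrArg (PowerSeries.C (R := L C)) (ff_rel (k := RatFunc C))
    rw [map_add, map_pow] at h1
    linear_combination hW + h1 + (PowerSeries.C ffZ * W) * h2
  refine ⟨ofPoint h hx (by simp [hW0]), fun m hm => ?_⟩
  rw [xi, HigherDerivation.coeff, ofPoint_apply_ffX]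
  simp [x, hm.ne']

/-- Higher derivations can be constructed recursively: the value of `θ^(n)` at `x` may be any
function of a higher derivation that has the same values as `θ` in lower order. -/
lemma exists_recursive [CharP C 2] (G : ℕ → HDL C → L C) : ∃ θ : HDL C, ∀ n, 0 < n →
    ∃ θ' : HDL C, (∀ m < n, θ'.xi m = θ.xi m) ∧ θ.xi n = G n θ' := by
  choose of hof using exists_xi_eq (C := C)
  let a : ℕ → ℕ → L C := fun n => Nat.rec (fun _ => ffX)
    (fun n ξ => Function.update ξ (n + 1) (G (n + 1) (of ξ))) n
  have ha : ∀ n k, k ≤ n → a n k = a k k := by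
    intro n
    induction n with
    | zero => intro k hk; rw [Nat.le_zero.mp hk]
    | succ n ih =>
      intro k hk
      rcases hk.eq_or_lt with rfl | hk
      · rfl
      · rw [← ih k (by lia)]
        exact Function.update_of_ne (by lia) _ _
  -- The sequence `a n` holds the first `n` values, and the diagonal is the sequence that is sought.
  refine ⟨of fun n => a n n, fun n hn => ?_⟩
  obtain ⟨n, rfl⟩ : ∃ k, n = k + 1 := ⟨n - 1, by lia⟩
  refine ⟨of (a n), fun m hm => ?_, ?_⟩
  · rcases Nat.eq_zero_or_pos m with rfl | hm0
    · rw [xi_zero, xi_zero]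
    · rw [hof _ m hm0, hof _ m hm0, ha n m (by lia)]
  · rw [hof _ _ hn]
    exact Function.update_self _ _ _

end HDL
end

/-! ### The invariants of `ρ` in `L` -/

section
variable {C : Type u} [Field C]

lemma ffX_transcendental_of_algebra {k : Type u} [Field k] [Algebra C k] (p : Polynomial C)
    (hp : p.eval₂ (algebraMap C (FF k)) ffX = 0) : p = 0 := by
  have h : (p.map (algebraMap C k)).eval₂ (algebraMap k (FF k)) ffX = 0 := by
    rw [Polynomial.eval₂_map, ← IsScalarTower.algebraMap_eq]; exact hp
  exact (Polynomial.map_eq_zero_iff (algebraMap C k).injective).mp (ffX_transcendental _ h)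

variable (C) in
/-- The inclusion of `D = C(x, z)` in `L = C(x, z, t)`. -/
def DtoL : K_E C →ₐ[C] L C :=
  ffLift (Algebra.ofId C (L C)) ffX ffZ ff_rel ffX_transcendental_of_algebra

lemma DtoL_ffX : DtoL C ffX = ffX := ffLift_X _ _ _ _ _
lemma DtoL_ffZ : DtoL C ffZ = ffZ := ffLift_Z _ _ _ _ _

/-- Some higher derivation on `L` restricts to the trivial derivation on `D`. -/
lemma exists_trivial [CharP C 2] :
    ∃ θ : HDL C, ∀ d, θ.1.toRingHom (DtoL C d) = PowerSeries.C (DtoL C d) := by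
  obtain ⟨θ, hθ⟩ := HDL.exists_xi_eq (C := C) 0
  have hX : θ.1.toRingHom ffX = PowerSeries.C ffX := by
    ext n
    rcases Nat.eq_zero_or_pos n with rfl | hn
    · simp [θ.1.constantCoeff_apply]
    · rw [PowerSeries.coeff_C, if_neg hn.ne']
      exact hθ n hn
  refine ⟨θ, fun d => ?_⟩
  have : θ.1.toRingHom.comp (DtoL C : K_E C →+* L C) =
      (PowerSeries.C).comp (DtoL C : K_E C →+* L C) := by
    apply ff_ringHom_ext
    · intro c
      simp only [RingHom.comp_apply, RingHom.coe_coe, AlgHom.commutes]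
      exact θ.2.1 c
    · simp only [RingHom.comp_apply, RingHom.coe_coe, DtoL_ffX, hX]
    · simp only [RingHom.comp_apply, RingHom.coe_coe, DtoL_ffZ]
      apply HDL.isUnit_add_add_one
      rw [θ.1.constantCoeff_apply, PowerSeries.constantCoeff_C]
  exact DFunLike.congr_fun this d

/-- The element `t` is transcendental over `D`. A relation `p(t) = 0` with constant coefficients
for the trivial derivation of `D` gives `p(t + T) = 0`. -/
lemma tL_transcendental [CharP C 2] (p : Polynomial (K_E C))
    (hp : p.eval₂ (DtoL C : K_E C →+* L C) tL = 0) : p = 0 := by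
  obtain ⟨θ, hθ⟩ := exists_trivial (C := C)
  have h1 : θ.1.toRingHom (p.eval₂ (DtoL C : K_E C →+* L C) tL) = 0 := by rw [hp, map_zero]
  have h2 : (((p.map (DtoL C : K_E C →+* L C)).comp (Polynomial.X + Polynomial.C tL) :
      Polynomial (L C)) : PowerSeries (L C)) = 0 := by
    rw [← h1, Polynomial.hom_eval₂, θ.2.2, Polynomial.comp,
      ← Polynomial.coeToPowerSeries.ringHom_apply, Polynomial.hom_eval₂, Polynomial.eval₂_map,
      map_add]
    simp only [Polynomial.coeToPowerSeries.ringHom_apply, Polynomial.coe_X, Polynomial.coe_C]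
    rw [add_comm]
    congr 1
    refine RingHom.ext fun d => ?_
    simp only [RingHom.comp_apply, Polynomial.coeToPowerSeries.ringHom_apply, Polynomial.coe_C]
    exact (hθ d).symm
  rw [Polynomial.coe_eq_zero_iff, Polynomial.comp_X_add_C_eq_zero_iff,
    Polynomial.map_eq_zero_iff (RingHom.injective _)] at h2
  exact h2

variable (C) in
/-- The identification of `D(t)` with `L`, as a homomorphism. -/
def ratDtoL [CharP C 2] : RatFunc (K_E C) →ₐ[C] L C :=
  IsFractionRing.liftAlgHom (g := Polynomial.aevalTower (DtoL C) tL) (by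
    rw [injective_iff_map_eq_zero]
    intro p hp
    exact tL_transcendental p hp)

lemma ratDtoL_algebraMap [CharP C 2] (p : Polynomial (K_E C)) :
    ratDtoL C (algebraMap _ _ p) = Polynomial.aevalTower (DtoL C) tL p := by
  simp [ratDtoL]

lemma ratDtoL_X [CharP C 2] : ratDtoL C RatFunc.X = tL := by
  rw [← RatFunc.algebraMap_X, ratDtoL_algebraMap]; simp

lemma ratDtoL_const [CharP C 2] (d : K_E C) : ratDtoL C (algebraMap _ _ d) = DtoL C d := by
  rw [IsScalarTower.algebraMap_apply (K_E C) (Polynomial (K_E C)) (RatFunc (K_E C)),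
    ratDtoL_algebraMap]
  simp [Polynomial.algebraMap_eq]

variable (C) in
/-- The contraction `L ⊗ D → L` with a linear form on `D`. -/
def contract (φ : K_E C →ₗ[C] C) : L C ⊗[C] K_E C →ₗ[C] L C :=
  (TensorProduct.rid C (L C)).toLinearMap ∘ₗ LinearMap.lTensor (L C) φ

lemma contract_tmul (φ : K_E C →ₗ[C] C) (l : L C) (d : K_E C) :
    contract C φ (l ⊗ₜ d) = algebraMap C (L C) (φ d) * l := by
  simp [contract, Algebra.smul_def]

/-- The powers of `x` are linearly independent over `C`, so that they are separated by linear
forms. -/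
lemma exists_dual_ffX_pow (i : ℕ) :
    ∃ φ : K_E C →ₗ[C] C, ∀ j, φ (ffX ^ j) = if j = i then 1 else 0 := by
  have hv : LinearIndependent C (fun j : ℕ => (ffX : K_E C) ^ j) := by
    have h := (Polynomial.basisMonomials C).linearIndependent.map'
      (Polynomial.aeval (ffX : K_E C)).toLinearMap
      (LinearMap.ker_eq_bot'.mpr fun p hp => ffX_transcendental p hp)
    have h2 : (Polynomial.aeval (ffX : K_E C)).toLinearMap ∘ Polynomial.basisMonomials C =
        fun j : ℕ => (ffX : K_E C) ^ j := by
      ext j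
      simp [Polynomial.aeval_monomial]
    rwa [h2] at h
  obtain ⟨φ, hφ⟩ := LinearMap.exists_extend (Finsupp.lapply i ∘ₗ hv.repr)
  refine ⟨φ, fun j => ?_⟩
  have h1 := LinearMap.congr_fun hφ ⟨(ffX : K_E C) ^ j, Submodule.subset_span ⟨j, rfl⟩⟩
  refine h1.trans ?_
  rw [LinearMap.comp_apply, hv.repr_eq_single j _ rfl]
  simp [Finsupp.single_apply]

lemma tensorToLD_tmul (l : L C) (d : K_E C) :
    tensorToLD C (l ⊗ₜ d) = LtoLD C l * DtoLD C d := by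
  rw [tensorToLD, Algebra.TensorProduct.productMap_apply_tmul]

/-- The coordinate `x` of `η_D` is transcendental over `L`. -/
lemma DtoLD_ffX_transcendental (p : Polynomial (L C))
    (hp : p.eval₂ (LtoLD C : L C →+* LD C) (DtoLD C ffX) = 0) : p = 0 := by
  have h1 : tensorToLD C (∑ i ∈ p.support, p.coeff i ⊗ₜ[C] ((ffX : K_E C) ^ i)) = 0 := by
    rw [← hp, Polynomial.eval₂_eq_sum, Polynomial.sum, map_sum]
    refine Finset.sum_congr rfl fun i _ => ?_
    rw [tensorToLD_tmul, map_pow, RingHom.coe_coe]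
  have h2 := tensorToLD_injective (h1.trans (map_zero _).symm)
  ext i
  obtain ⟨φ, hφ⟩ := exists_dual_ffX_pow (C := C) i
  have h3 := congrArg (contract C φ) h2
  rw [map_sum, map_zero] at h3
  have h4 : ∀ j, contract C φ (p.coeff j ⊗ₜ[C] ((ffX : K_E C) ^ j)) = if j = i then p.coeff j else 0 := by
    intro j
    rw [contract_tmul, hφ]
    split_ifs <;> simp
  simp_rw [h4] at h3
  rw [Polynomial.coeff_zero, ← h3]
  simp

lemma LtoLD_ffX : LtoLD C ffX = ffX := by simp [LtoLD]
lemma LtoLD_ffZ : LtoLD C ffZ = ffZ := by simp [LtoLD]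

lemma DtoLD_eq (d : K_E C) : DtoLD C d = algebraMap (RatFunc (K_E C)) _ (algebraMap _ _ d) :=
  IsScalarTower.algebraMap_apply _ _ _ _

lemma LtoLD_base (r : RatFunc C) :
    LtoLD C (algebraMap _ _ r) = algebraMap _ _ (ratIncl C r) := by
  rw [LtoLD, ffLift_base]; rfl

/-- The intersection of `L` and `D(t)` is `C(t)`, by linear disjointness of `L` and `D`. -/
lemma mem_baseField_of_LtoLD_eq {a : L C} {r : RatFunc (K_E C)}
    (h : LtoLD C a = algebraMap _ _ r) : a ∈ baseField C := by
  induction r using RatFunc.induction_on with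
  | f p q hq =>
    have hp : ∀ p : Polynomial (K_E C), ∀ b : L C, tensorToLD C (∑ i ∈ p.support,
        (b * tL ^ i) ⊗ₜ p.coeff i) = LtoLD C b * algebraMap (RatFunc (K_E C)) _ (algebraMap _ _ p) := by
      intro p b
      have : algebraMap (RatFunc (K_E C)) (LD C) (algebraMap _ _ p) =
          p.eval₂ (DtoLD C : K_E C →+* LD C) tLD := by
        have h1 : ((algebraMap (RatFunc (K_E C)) (LD C)).comp
            (algebraMap (Polynomial (K_E C)) (RatFunc (K_E C)))) =
            Polynomial.eval₂RingHom (DtoLD C : K_E C →+* LD C) tLD := by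
          apply Polynomial.ringHom_ext
          · intro d
            simp [DtoLD_eq, RatFunc.algebraMap_eq_C]
          · simp [tLD]
        exact DFunLike.congr_fun h1 p
      rw [this, Polynomial.eval₂_eq_sum, Polynomial.sum, map_sum, Finset.mul_sum]
      refine Finset.sum_congr rfl fun i _ => ?_
      simp only [tensorToLD_tmul, map_mul, map_pow,
        LtoLD_t, RingHom.coe_coe]
      ring
    have hq0 : algebraMap (RatFunc (K_E C)) (LD C) (algebraMap _ _ q) ≠ 0 :=
      (map_ne_zero _).mpr (RatFunc.algebraMap_ne_zero hq)
    have h1 : (∑ i ∈ q.support, (a * tL ^ i) ⊗ₜ[C] q.coeff i) =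
        ∑ i ∈ p.support, (1 * tL ^ i) ⊗ₜ[C] p.coeff i := by
      apply tensorToLD_injective
      rw [hp, hp, h, map_div₀, div_mul_cancel₀ _ hq0, map_one, one_mul]
    -- The relation `a q = p` holds in `L ⊗ D`. A linear form that does not vanish at the leading
    -- coefficient of `q` turns it into a relation over `C(t)`.
    obtain ⟨φ, hφ⟩ : ∃ φ : K_E C →ₗ[C] C, φ q.leadingCoeff ≠ 0 :=
      Module.Projective.exists_dual_ne_zero C (by simpa using hq)
    have h2 := congrArg (contract C φ) h1
    simp only [map_sum, contract_tmul] at h2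
    have hs : ∀ p : Polynomial (K_E C), ∀ b : L C,
        ∑ i ∈ p.support, algebraMap C (L C) (φ (p.coeff i)) * (b * tL ^ i) =
        b * algebraMap (RatFunc C) _ (algebraMap _ _
          (∑ i ∈ p.support, Polynomial.C (φ (p.coeff i)) * Polynomial.X ^ i)) := by
      intro p b
      rw [map_sum, map_sum, Finset.mul_sum]
      refine Finset.sum_congr rfl fun i _ => ?_
      rw [map_mul, map_mul, map_pow, map_pow, RatFunc.algebraMap_X,
        IsScalarTower.algebraMap_apply C (RatFunc C) (L C),
        IsScalarTower.algebraMap_apply C (Polynomial C) (RatFunc C), Polynomial.algebraMap_eq]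
      change _ * (b * tL ^ i) = b * (_ * tL ^ i)
      ring
    rw [hs, hs, one_mul] at h2
    set Q := ∑ i ∈ q.support, Polynomial.C (φ (q.coeff i)) * Polynomial.X ^ i
    have hQ : Q ≠ 0 := by
      intro h0
      apply hφ
      have := congrArg (fun P => Polynomial.coeff P q.natDegree) h0
      simpa [Q, Polynomial.finsetSum_coeff, Polynomial.coeff_X_pow, hq] using this
    have hQ0 : algebraMap (RatFunc C) (L C) (algebraMap _ _ Q) ≠ 0 :=
      (map_ne_zero _).mpr (RatFunc.algebraMap_ne_zero hQ)
    rw [eq_div_of_mul_eq hQ0 h2]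
    exact (baseField C).div_mem (algebraMap_mem_baseField _) (algebraMap_mem_baseField _)

section Swap
variable [CharP C 2]

variable (C) in
/-- The exchange of the generic points `η_L` and `η_D`. -/
def swap : LD C →ₐ[C] LD C :=
  ffLift ((LtoLD C).comp (ratDtoL C)) (DtoLD C ffX) (DtoLD C ffZ)
    (by rw [← map_pow, ← map_pow, ← map_add, ff_rel]) (by
    intro p hp
    have h : (p.map (ratDtoL C : RatFunc (K_E C) →+* L C)).eval₂
        (LtoLD C : L C →+* LD C) (DtoLD C ffX) = 0 := by
      rw [Polynomial.eval₂_map]; exact hp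
    exact (Polynomial.map_eq_zero_iff (RingHom.injective _)).mp (DtoLD_ffX_transcendental _ h))

lemma swap_base (r : RatFunc (K_E C)) :
    swap C (algebraMap _ _ r) = LtoLD C (ratDtoL C r) := by
  rw [swap, ffLift_base]; rfl

lemma swap_DtoLD_ffX : swap C (DtoLD C ffX) = LtoLD C ffX := by
  rw [DtoLD_eq, swap_base, ratDtoL_const, DtoL_ffX]

lemma swap_DtoLD_ffZ : swap C (DtoLD C ffZ) = LtoLD C ffZ := by
  rw [DtoLD_eq, swap_base, ratDtoL_const, DtoL_ffZ]

lemma swap_LtoLD_ffX : swap C (LtoLD C ffX) = DtoLD C ffX := by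
  rw [LtoLD_ffX, swap, ffLift_X]

lemma swap_LtoLD_ffZ : swap C (LtoLD C ffZ) = DtoLD C ffZ := by
  rw [LtoLD_ffZ, swap, ffLift_Z]

lemma swap_tLD : swap C tLD = tLD := by
  rw [tLD, swap_base, ratDtoL_X, LtoLD_t]; rfl

end Swap

section PointLemmas
variable {F G : Type u} [Field F] [Algebra C F] [Field G] [Algebra C G]

open scoped Classical in
/-- The homomorphism of the groups of points that is induced by a homomorphism of fields. -/
abbrev mapPt (f : F →ₐ[C] G) : Pt C F →+ Pt C G := WeierstrassCurve.Affine.Point.map (W' := curve C) f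

lemma x_mapPt (f : F →ₐ[C] G) (P : Pt C F) : Pt.x C (mapPt f P) = f (Pt.x C P) := by
  cases P with
  | zero => exact (map_zero f).symm
  | some x z h => rfl

lemma z_mapPt (f : F →ₐ[C] G) (P : Pt C F) : Pt.z C (mapPt f P) = f (Pt.z C P) := by
  cases P with
  | zero => exact (map_zero f).symm
  | some x z h => rfl

variable [CharP C 2]

lemma mapPt_pt (f : F →ₐ[C] G) {x z : F} (h : z ^ 2 + z = x ^ 3) :
    mapPt f (pt C x z h) = pt C (f x) (f z) (by rw [← map_pow, ← map_pow, ← map_add, h]) := rfl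

lemma pt_congr {x z x' z' : F} {h : z ^ 2 + z = x ^ 3} {h' : z' ^ 2 + z' = x' ^ 3} :
    pt C x z h = pt C x' z' h' ↔ x = x' ∧ z = z' := by
  simp [pt]

lemma mapPt_origin (f : F →ₐ[C] G) : mapPt f (origin C F) = origin C G := by
  rw [origin, mapPt_pt, origin, pt_congr]; simp

open scoped Classical in
lemma mapPt_oplus (f : F →ₐ[C] G) (P Q : Pt C F) :
    mapPt f (oplus C P Q) = oplus C (mapPt f P) (mapPt f Q) := by
  rw [oplus, map_sub, map_add, mapPt_origin]; rfl

lemma oplus_comm (P Q : Pt C F) : oplus C P Q = oplus C Q P := by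
  classical
  rw [oplus, oplus, add_comm P]

lemma etaL_eq : etaL (C := C) = mapPt (LtoLD C) (pt C ffX ffZ ff_rel) := rfl
lemma etaD_eq : etaD (C := C) = mapPt (DtoLD C) (pt C ffX ffZ ff_rel) := rfl

lemma mapPt_swap_oplus : mapPt (swap C) (oplus C etaL etaD) = oplus C etaL etaD := by
  have h1 : mapPt (swap C) etaL = etaD := by
    rw [etaL_eq, etaD_eq, mapPt_pt, mapPt_pt, mapPt_pt, pt_congr]
    exact ⟨swap_LtoLD_ffX, swap_LtoLD_ffZ⟩
  have h2 : mapPt (swap C) etaD = etaL := by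
    rw [etaL_eq, etaD_eq, mapPt_pt, mapPt_pt, mapPt_pt, pt_congr]
    exact ⟨swap_DtoLD_ffX, swap_DtoLD_ffZ⟩
  rw [mapPt_oplus, h1, h2, oplus_comm]

lemma rho_ffX : rho C ffX = Pt.x C (oplus C etaL etaD) :=
  ffLift_X _ _ _ _ _
lemma rho_ffZ : rho C ffZ = Pt.z C (oplus C etaL etaD) :=
  ffLift_Z _ _ _ _ _
lemma rho_base (r : RatFunc (K_E C)) : rho C (algebraMap _ _ r) = algebraMap _ _ r :=
  (rho C).commutes r
lemma rho_DtoLD (d : K_E C) : rho C (DtoLD C d) = DtoLD C d := by rw [DtoLD_eq, rho_base]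
lemma rho_tLD : rho C tLD = tLD := rho_base _

/-- The point `η_L ⊕ η_D` is symmetric, so that `ρ` maps `L` to elements fixed by the exchange. -/
lemma swap_rho_LtoLD (a : L C) : swap C (rho C (LtoLD C a)) = rho C (LtoLD C a) := by
  let K := (((swap C : LD C →+* LD C).comp (rho C : LD C →+* LD C)).comp
    (LtoLD C : L C →+* LD C)).eqLocusField ((rho C : LD C →+* LD C).comp (LtoLD C : L C →+* LD C))
  have hK : K = ⊤ := by
    apply ff_subfield_eq_top_of_adjoin
    · intro c
      change swap C (rho C (LtoLD C (algebraMap _ _ (algebraMap C (RatFunc C) c)))) =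
        rho C (LtoLD C (algebraMap _ _ (algebraMap C (RatFunc C) c)))
      rw [← IsScalarTower.algebraMap_apply C (RatFunc C) (L C), AlgHom.commutes,
        IsScalarTower.algebraMap_apply C (RatFunc (K_E C)) (LD C), rho_base,
        ← IsScalarTower.algebraMap_apply, AlgHom.commutes]
    · change swap C (rho C (LtoLD C tL)) = rho C (LtoLD C tL)
      rw [LtoLD_t, rho_tLD, swap_tLD]
    · change swap C (rho C (LtoLD C ffX)) = rho C (LtoLD C ffX)
      rw [LtoLD_ffX, rho_ffX, ← x_mapPt, mapPt_swap_oplus]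
    · change swap C (rho C (LtoLD C ffZ)) = rho C (LtoLD C ffZ)
      rw [LtoLD_ffZ, rho_ffZ, ← z_mapPt, mapPt_swap_oplus]
  have ha : a ∈ K := by rw [hK]; exact Subfield.mem_top a
  exact ha

/-- The exchange maps `L = C(t)(η_L)` to `C(t)(η_D)`, which lies in `D(t)`. -/
lemma swap_LtoLD_mem (a : L C) :
    ∃ r : RatFunc (K_E C), swap C (LtoLD C a) = algebraMap _ _ r := by
  let K := ((algebraMap (RatFunc (K_E C)) (LD C)).fieldRange).comap
    ((swap C : LD C →+* LD C).comp (LtoLD C : L C →+* LD C))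
  have hK : K = ⊤ := by
    apply ff_subfield_eq_top_of_adjoin
    · intro c
      refine ⟨algebraMap C _ c, ?_⟩
      change algebraMap (RatFunc (K_E C)) (LD C) (algebraMap C (RatFunc (K_E C)) c) =
        swap C (LtoLD C (algebraMap _ _ (algebraMap C (RatFunc C) c)))
      rw [← IsScalarTower.algebraMap_apply C (RatFunc C) (L C), AlgHom.commutes, AlgHom.commutes,
        ← IsScalarTower.algebraMap_apply]
    · refine ⟨RatFunc.X, ?_⟩
      change algebraMap (RatFunc (K_E C)) (LD C) RatFunc.X = swap C (LtoLD C tL)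
      rw [LtoLD_t, swap_tLD]; rfl
    · have h := swap_LtoLD_ffX.trans (DtoLD_eq (C := C) ffX)
      exact ⟨algebraMap (K_E C) (RatFunc (K_E C)) ffX, h.symm⟩
    · have h := swap_LtoLD_ffZ.trans (DtoLD_eq (C := C) ffZ)
      exact ⟨algebraMap (K_E C) (RatFunc (K_E C)) ffZ, h.symm⟩
  have ha : a ∈ K := by rw [hK]; exact Subfield.mem_top a
  obtain ⟨r, hr⟩ := ha
  exact ⟨r, hr.symm⟩

/-- The elements of `L` that are fixed by `ρ` are those of `C(t)`: such an element is also fixed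
by the exchange of `η_L` and `η_D`, so it lies in `D(t)`. -/
lemma rho_LtoLD_eq_iff {a : L C} : rho C (LtoLD C a) = LtoLD C a ↔ a ∈ baseField C := by
  constructor
  · intro h
    obtain ⟨r, hr⟩ := swap_LtoLD_mem a
    have := swap_rho_LtoLD a
    rw [h, hr] at this
    exact mem_baseField_of_LtoLD_eq this.symm
  · rintro ⟨r, rfl⟩
    rw [LtoLD_base, rho_base]

/-- Since `ρ` is injective, an element is fixed by `ρ` if its square is. -/
lemma mem_baseField_of_sq_mem {a : L C} (h : a ^ 2 ∈ baseField C) : a ∈ baseField C := by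
  rw [← rho_LtoLD_eq_iff] at h ⊢
  rw [map_pow, map_pow] at h
  exact frobenius_inj (LD C) 2 h

end PointLemmas
end

/-! ### Commutation with `ρ` -/

section
variable {C : Type u} [Field C] [CharP C 2]

section Formulas
variable {F : Type u} [Field F] [Algebra C F]

lemma two_eq_zero_of_algebra (C : Type u) [Field C] [CharP C 2] {F : Type u} [Field F]
    [Algebra C F] : (2 : F) = 0 := by
  have : CharP F 2 := charP_of_injective_algebraMap (algebraMap C F).injective 2
  exact_mod_cast CharP.cast_eq_zero F 2

open scoped Classical in
/-- The addition of two points on a chord of slope `s`. -/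
lemma exists_pt_add_pt {x z X Z s : F} (h : z ^ 2 + z = x ^ 3) (H : Z ^ 2 + Z = X ^ 3)
    (hx : x ≠ X) (hs : s * (x + X) = z + Z) : ∃ h', pt C x z h + pt C X Z H =
      pt C (s ^ 2 + x + X) (s * (s ^ 2 + x + X + x) + z + 1) h' := by
  have h2 := two_eq_zero_of_algebra C (F := F)
  have hxX : x - X ≠ 0 := sub_ne_zero.mpr hx
  have hs' : (z - Z) / (x - X) = s := by
    rw [div_eq_iff hxX]
    linear_combination (s * X - Z) * h2 - hs
  have h1 := WeierstrassCurve.Affine.Point.add_of_X_ne (h₁ := pt_nonsingular C h)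
    (h₂ := pt_nonsingular C H) hx
  have hn := WeierstrassCurve.Affine.nonsingular_add (pt_nonsingular C h) (pt_nonsingular C H)
    (fun hxy => hx hxy.left)
  have e1 : ((curve C).baseChange F).toAffine.addX x X
      (((curve C).baseChange F).toAffine.slope x X z Z) = s ^ 2 + x + X := by
    simp only [WeierstrassCurve.Affine.slope_of_X_ne hx, WeierstrassCurve.Affine.addX,
      curve, WeierstrassCurve.baseChange, WeierstrassCurve.map_a₁, WeierstrassCurve.map_a₂,
      map_zero, zero_mul, add_zero, sub_zero, hs']
    linear_combination (-x - X) * h2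
  have e2 : ((curve C).baseChange F).toAffine.addY x X z
      (((curve C).baseChange F).toAffine.slope x X z Z) = s * (s ^ 2 + x + X + x) + z + 1 := by
    rw [WeierstrassCurve.Affine.addY, WeierstrassCurve.Affine.negAddY, e1]
    simp only [WeierstrassCurve.Affine.slope_of_X_ne hx, WeierstrassCurve.Affine.negY,
      curve, WeierstrassCurve.baseChange, WeierstrassCurve.map_a₁,
      WeierstrassCurve.map_a₃, map_zero, map_one, zero_mul, sub_zero, hs']
    linear_combination (-s * (s ^ 2 + X) - s * x - z - 1) * h2
  have hr := rel_of_nonsingular C hn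
  rw [e1, e2] at hr
  refine ⟨hr, ?_⟩
  rw [pt, pt, h1, pt, WeierstrassCurve.Affine.Point.some.injEq]
  exact ⟨e1, e2⟩

open scoped Classical in
lemma pt_add_pt {x z X Z s x' z' : F} (h : z ^ 2 + z = x ^ 3) (H : Z ^ 2 + Z = X ^ 3)
    (h' : z' ^ 2 + z' = x' ^ 3) (hx : x ≠ X) (hs : s * (x + X) = z + Z) (hx' : x' = s ^ 2 + x + X)
    (hz' : z' = s * (x' + x) + z + 1) : pt C x z h + pt C X Z H = pt C x' z' h' := by
  obtain ⟨_, e⟩ := exists_pt_add_pt (C := C) h H hx hs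
  rw [e, pt_congr, hz', hx']
  exact ⟨rfl, rfl⟩

lemma neg_pt {x z : F} (h : z ^ 2 + z = x ^ 3) {z' : F} (h' : z' ^ 2 + z' = x ^ 3)
    (hz : z' = z + 1) : -pt C x z h = pt C x z' h' := by
  have h2 := two_eq_zero_of_algebra C (F := F)
  rw [pt, WeierstrassCurve.Affine.Point.neg_some, pt, WeierstrassCurve.Affine.Point.some.injEq]
  refine ⟨rfl, ?_⟩
  simp only [WeierstrassCurve.Affine.negY, curve, WeierstrassCurve.baseChange,
    WeierstrassCurve.map_a₁, WeierstrassCurve.map_a₃, map_zero, map_one, zero_mul, sub_zero, hz]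
  linear_combination (-z - 1) * h2

open scoped Classical in
/-- The coordinates of `(x, z) ⊖ (X, Z)`, where `x'`, `z'` are the coordinates of the point
`-((x, z) + (0, 0))`, and `s` is the slope of the line through this point and `(X, Z)`. -/
lemma pt_sub_pt_add_origin {x z X Z x' z' s a b : F} (h : z ^ 2 + z = x ^ 3)
    (H : Z ^ 2 + Z = X ^ 3) (hx : x ≠ 0) (hx' : x' * (1 + z) = x)
    (hz' : z' * (1 + z) = z) (hX : X ≠ x') (hs : s * (X - x') = Z - z')
    (ha : a = X + x' + s ^ 2) (hb : b = s * (a - x') + z') :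
    ∃ h', pt C x z h - pt C X Z H + origin C F = pt C a b h' := by
  have h2 := two_eq_zero_of_algebra C (F := F)
  have hz0 : z * (1 + z) ≠ 0 := by
    have : z * (1 + z) = x ^ 3 := by linear_combination h
    rw [this]; exact pow_ne_zero 3 hx
  have hz1 : 1 + z ≠ 0 := right_ne_zero_of_mul hz0
  have hxe : x' = x / (1 + z) := (eq_div_iff hz1).mpr hx'
  have hze : z' = z / (1 + z) := (eq_div_iff hz1).mpr hz'
  have hn : z' ^ 2 + z' = x' ^ 3 := by
    rw [hxe, hze]
    field_simp
    linear_combination h + (z ^ 2 + z ^ 3) * h2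
  have hn' : (z' + 1) ^ 2 + (z' + 1) = x' ^ 3 := by linear_combination hn + (z' + 1) * h2
  have H' : (Z + 1) ^ 2 + (Z + 1) = X ^ 3 := by linear_combination H + (Z + 1) * h2
  have e1 : pt C x z h + origin C F = pt C x' (z' + 1) hn' := by
    refine pt_add_pt (s := z / x) _ _ _ hx ?_ ?_ ?_
    · field_simp; ring
    · rw [hxe]; field_simp
      linear_combination -z * h - x ^ 3 * z * h2
    · rw [hxe, hze]; field_simp
      linear_combination (-z - z ^ 2) * h2
  have e2 : -pt C X Z H = pt C X (Z + 1) H' := neg_pt _ _ rfl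
  have : pt C x z h - pt C X Z H + origin C F = (pt C x z h + origin C F) + -pt C X Z H := by abel
  obtain ⟨h', e⟩ := exists_pt_add_pt (C := C) (s := s) hn' H' hX.symm
    (by linear_combination hs + (s * x' - z' - 1) * h2)
  have ea : s ^ 2 + x' + X = a := by rw [ha]; ring
  have eb : s * (s ^ 2 + x' + X + x') + (z' + 1) + 1 = b := by
    rw [hb, ha]; linear_combination (s * x' + 1) * h2
  rw [this, e1, e2, e]
  rw [eb, ea] at h'
  exact ⟨h', (pt_congr).mpr ⟨ea, eb⟩⟩

end Formulas

open scoped Classical in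
/-- On the coordinate `x` the endomorphism `ρ` is the addition of an element of `D` and a square,
because the point `η_D - (0, 0)` that is added is defined over `D`. -/
lemma exists_rho_ffX_eq : ∃ (u : K_E C) (s : LD C), rho C ffX = ffX + DtoLD C u + s ^ 2 := by
  have h1 : oplus C etaL etaD = etaL + mapPt (DtoLD C) (pt C ffX ffZ ff_rel - origin C (K_E C)) := by
    rw [oplus, map_sub, mapPt_origin, etaD_eq, add_sub_assoc]
  have h2 : etaL = pt C (ffX : LD C) ffZ ff_rel := by
    rw [etaL_eq, mapPt_pt, pt_congr]
    exact ⟨LtoLD_ffX, LtoLD_ffZ⟩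
  rw [rho_ffX, h1, h2]
  generalize pt C ffX ffZ ff_rel - origin C (K_E C) = Q
  cases Q with
  | zero =>
    refine ⟨0, 0, ?_⟩
    rw [← WeierstrassCurve.Affine.Point.zero_def, map_zero, add_zero]
    change (ffX : LD C) = _
    simp
  | some u v h =>
    have hr := rel_of_nonsingular C h
    have h0 : (.some u v h : Pt C (K_E C)) = pt C u v hr := rfl
    have hne : (ffX : LD C) ≠ DtoLD C u := by
      intro h
      have := ffX_transcendental (k := RatFunc (K_E C))
        (Polynomial.X - Polynomial.C (algebraMap _ _ u)) (by simp [h, DtoLD_eq])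
      exact Polynomial.X_sub_C_ne_zero _ this
    refine ⟨u, (ffZ + DtoLD C v) / (ffX + DtoLD C u), ?_⟩
    have hne' : (ffX : LD C) + DtoLD C u ≠ 0 := by
      rwa [Ne, add_eq_zero_iff_eq_of_charP_two]
    set s := (ffZ + DtoLD C v) / (ffX + DtoLD C u) with hs
    have hs' : s * (ffX + DtoLD C u) = ffZ + DtoLD C v := div_mul_cancel₀ _ hne'
    obtain ⟨h', e⟩ := exists_pt_add_pt (C := C) ff_rel
      (by rw [← map_pow, ← map_pow, ← map_add, hr]) hne hs'
    rw [h0, mapPt_pt, e]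
    change s ^ 2 + ffX + DtoLD C u = _
    ring

variable (C) in
/-- The field of fractions of the power series over `LD`, over which the points `η_L` and
`θ(η_L)` are both defined. -/
def SeriesField : Type u := FractionRing (PowerSeries (LD C))

instance : Field (SeriesField C) := inferInstanceAs (Field (FractionRing (PowerSeries (LD C))))
instance : Algebra (PowerSeries (LD C)) (SeriesField C) :=
  inferInstanceAs (Algebra (PowerSeries (LD C)) (FractionRing (PowerSeries (LD C))))
instance : IsFractionRing (PowerSeries (LD C)) (SeriesField C) :=
  inferInstanceAs (IsFractionRing (PowerSeries (LD C)) (FractionRing (PowerSeries (LD C))))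
instance : Algebra C (SeriesField C) :=
  inferInstanceAs (Algebra C (FractionRing (PowerSeries (LD C))))
instance : IsScalarTower C (PowerSeries (LD C)) (SeriesField C) :=
  inferInstanceAs (IsScalarTower C (PowerSeries (LD C)) (FractionRing (PowerSeries (LD C))))

variable (C) in
/-- The endomorphism `ρ` as a homomorphism over `C`. -/
def rhoC : LD C →ₐ[C] LD C := (rho C).restrictScalars C

lemma rhoC_apply (a : LD C) : rhoC C a = rho C a := rfl

variable (C) in
/-- The embedding of `LD` as the constant series. -/
def constHom : LD C →ₐ[C] SeriesField C :=
  (IsScalarTower.toAlgHom C (PowerSeries (LD C)) (SeriesField C)).comp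
    (IsScalarTower.toAlgHom C (LD C) (PowerSeries (LD C)))

omit [CharP C 2] in
lemma constHom_apply (a : LD C) :
    constHom C a = algebraMap (PowerSeries (LD C)) _ (PowerSeries.C a) := rfl

/-- The homomorphism `θ` on `LD`, with values in the field of fractions of the power series. -/
def thetaHom (θ : HDL C) : LD C →ₐ[C] SeriesField C :=
  { (algebraMap (PowerSeries (LD C)) (SeriesField C)).comp θ.onLDHom with
    commutes' := fun c => by
      change algebraMap (PowerSeries (LD C)) (SeriesField C) (θ.onLDHom (algebraMap C (LD C) c)) = _
      rw [← (DtoLD C).commutes c, θ.onLDHom_D, (DtoLD C).commutes, ← PowerSeries.algebraMap_apply,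
        ← IsScalarTower.algebraMap_apply] }

omit [CharP C 2] in
lemma thetaHom_apply (θ : HDL C) (a : LD C) :
    thetaHom θ a = algebraMap (PowerSeries (LD C)) _ (θ.onLDHom a) := rfl

variable (C) in
/-- The coefficientwise extension of `ρ` to the field of fractions of the power series. -/
def rhoHat : SeriesField C →ₐ[C] SeriesField C :=
  IsFractionRing.liftAlgHom (g := (IsScalarTower.toAlgHom C (PowerSeries (LD C))
    (SeriesField C)).comp (PowerSeries.mapAlgHom (rhoC C)))
    ((IsFractionRing.injective (PowerSeries (LD C)) (SeriesField C)).comp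
      (PowerSeries.map_injective _ (rhoC C).injective))

lemma rhoHat_algebraMap (F : PowerSeries (LD C)) :
    rhoHat C (algebraMap _ _ F) =
      algebraMap _ (SeriesField C) (PowerSeries.map (rho C).toRingHom F) := by
  exact IsFractionRing.lift_algebraMap (K := SeriesField C)
    (g := (algebraMap (PowerSeries (LD C)) (SeriesField C)).comp
      (PowerSeries.map (rho C).toRingHom))
    ((IsFractionRing.injective (PowerSeries (LD C)) (SeriesField C)).comp
      (PowerSeries.map_injective _ (rhoC C).injective)) F

open scoped Classical in
/-- The homomorphism `ρ` sends `η_L` to `η_L ⊕ η_D`, as an identity of points; the point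
`η_L ⊕ η_D` is affine because its coordinate `x` is transcendental. -/
lemma mapPt_rhoC_etaL : mapPt (rhoC C) etaL = oplus C etaL etaD := by
  have hne : oplus C etaL etaD ≠ (0 : Pt C (LD C)) := by
    intro h
    have h0 : Pt.x C (oplus C etaL etaD) = (0 : LD C) := by rw [h]; rfl
    exact Polynomial.X_ne_zero (etaSum_transcendental (C := C) Polynomial.X (by simp [h0]))
  have hx := rho_ffX (C := C)
  have hz := rho_ffZ (C := C)
  revert hne hx hz
  generalize oplus C etaL etaD = S
  intro hne hx hz
  cases S with
  | zero => exact absurd rfl hne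
  | some x z h =>
    have h0 : (.some x z h : Pt C (LD C)) = pt C x z (rel_of_nonsingular C h) := rfl
    rw [h0, etaL_eq, mapPt_pt, mapPt_pt, pt_congr, rhoC_apply, rhoC_apply, LtoLD_ffX, LtoLD_ffZ]
    exact ⟨hx, hz⟩

namespace HDL
open PowerSeries
variable (θ : HDL C)

/-- The series `g(T)`, which is the coordinate `z` of `η_L ⊖ θ(η_L)`. -/
def g : (L C)⟦X⟧ := θ.slope * (θ.f - PowerSeries.C (ffX / (1 + ffZ))) + PowerSeries.C (ffZ / (1 + ffZ))

omit [CharP C 2] in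
lemma slope_mul : θ.slope * (θ.1.toRingHom ffX - PowerSeries.C (ffX / (1 + ffZ))) =
    θ.1.toRingHom ffZ - PowerSeries.C (ffZ / (1 + ffZ)) := by
  rw [slope, mul_assoc, PowerSeries.inv_mul_cancel _ θ.slope_denominator, mul_one]

omit [CharP C 2] in
lemma constantCoeff_slope : constantCoeff θ.slope * ffX = ffZ := by
  obtain ⟨hz, hz1, hx⟩ := ffZ_ne (C := C)
  have h := congrArg constantCoeff θ.slope_mul
  simp only [map_mul, map_sub, θ.1.constantCoeff_apply, constantCoeff_C] at h
  field_simp at h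
  have h2 : (constantCoeff θ.slope * ffX - ffZ) * ffZ = 0 := by linear_combination h
  rcases mul_eq_zero.mp h2 with h | h
  · exact sub_eq_zero.mp h
  · exact absurd h hz

lemma constantCoeff_f : constantCoeff θ.f = 0 := by
  obtain ⟨hz, hz1, hx⟩ := ffZ_ne (C := C)
  have hs : constantCoeff θ.slope = ffZ / ffX := (eq_div_iff hx).mpr θ.constantCoeff_slope
  have h2 := two_eq_zero_of_algebra C (F := L C)
  have hr := ff_rel (k := RatFunc C)
  simp only [f, map_add, map_pow, θ.1.constantCoeff_apply, constantCoeff_C, hs]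
  field_simp
  linear_combination (ffZ + 2 * ffZ ^ 2 + ffZ ^ 3) * h2 - (2 + ffZ) * hr

lemma constantCoeff_g : constantCoeff θ.g = 0 := by
  obtain ⟨hz, hz1, hx⟩ := ffZ_ne (C := C)
  have hs : constantCoeff θ.slope = ffZ / ffX := (eq_div_iff hx).mpr θ.constantCoeff_slope
  simp only [g, map_add, map_mul, map_sub, constantCoeff_C, hs, constantCoeff_f]
  field_simp
  ring

open scoped Classical in
/-- The point `(f, g)` is the point `η_L ⊖ θ(η_L)`, in any field that contains `L⟦T⟧`. -/
lemma exists_pt_sub_pt_theta {K : Type u} [Field K] [Algebra C K] (i : (L C)⟦X⟧ →+* K)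
    (hi : Function.Injective i) {x z X Z : K} (h : z ^ 2 + z = x ^ 3) (H : Z ^ 2 + Z = X ^ 3)
    (hx : x = i (PowerSeries.C ffX)) (hz : z = i (PowerSeries.C ffZ))
    (hX : X = i (θ.1.toRingHom ffX)) (hZ : Z = i (θ.1.toRingHom ffZ)) :
    ∃ h', pt C x z h - pt C X Z H + origin C K = pt C (i θ.f) (i θ.g) h' := by
  obtain ⟨hz0, hz1, hx0⟩ := ffZ_ne (C := C)
  refine pt_sub_pt_add_origin (x' := i (PowerSeries.C (ffX / (1 + ffZ))))
    (z' := i (PowerSeries.C (ffZ / (1 + ffZ)))) (s := i θ.slope) _ _ ?_ ?_ ?_ ?_ ?_ ?_ ?_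
  · rw [hx, Ne, map_eq_zero_iff i hi, map_eq_zero_iff _ PowerSeries.C_injective]
    exact hx0
  · rw [hx, hz, ← map_one i, ← map_one (PowerSeries.C (R := L C)), ← map_add, ← map_add,
      ← map_mul, ← map_mul, div_mul_cancel₀ _ hz1]
  · rw [hz, ← map_one i, ← map_one (PowerSeries.C (R := L C)), ← map_add, ← map_add, ← map_mul,
      ← map_mul, div_mul_cancel₀ _ hz1]
  · intro h
    apply θ.slope_denominator
    rw [hX] at h
    rw [hi h, sub_self, map_zero]
  · rw [hX, hZ, ← map_sub, ← map_mul, ← map_sub, slope_mul]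
  · rw [hX, ← map_add, ← map_pow, ← map_add, f]
  · rw [← map_sub, ← map_mul, ← map_add, g]

variable (C) in
/-- The coefficientwise embedding of `L⟦T⟧` in the field of fractions of `LD⟦T⟧`. -/
def seriesHom : (L C)⟦X⟧ →+* SeriesField C :=
  (algebraMap (LD C)⟦X⟧ (SeriesField C)).comp (PowerSeries.map (LtoLD C).toRingHom)

omit [CharP C 2] in
lemma seriesHom_apply (F : (L C)⟦X⟧) : seriesHom C F =
    algebraMap (LD C)⟦X⟧ (SeriesField C) (PowerSeries.map (LtoLD C).toRingHom F) := rfl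

omit [CharP C 2] in
lemma seriesHom_injective : Function.Injective (seriesHom C) :=
  (injective_iff_map_eq_zero (seriesHom C)).mpr fun F hF => by
    rw [seriesHom_apply, map_eq_zero_iff _ (IsFractionRing.injective (LD C)⟦X⟧ (SeriesField C))]
      at hF
    ext n
    have h := congrArg (coeff n) hF
    rw [PowerSeries.coeff_map, map_zero] at h
    rw [map_zero]
    exact (map_eq_zero_iff _ (LtoLD C).injective).mp h

omit [CharP C 2] in
lemma constHom_LtoLD (a : L C) : constHom C (LtoLD C a) = seriesHom C (PowerSeries.C a) := by
  rw [constHom_apply, seriesHom_apply, PowerSeries.map_C]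
  rfl

omit [CharP C 2] in
lemma thetaHom_LtoLD (a : L C) : thetaHom θ (LtoLD C a) = seriesHom C (θ.1.toRingHom a) := by
  rw [thetaHom_apply, onLDHom_L, seriesHom_apply]

open scoped Classical in
lemma exists_etaL_sub_theta_etaL : ∃ h, mapPt (constHom C) etaL - mapPt (thetaHom θ) etaL +
    origin C (SeriesField C) = pt C (seriesHom C θ.f) (seriesHom C θ.g) h := by
  rw [etaL_eq, mapPt_pt, mapPt_pt, mapPt_pt]
  exact θ.exists_pt_sub_pt_theta (seriesHom C) seriesHom_injective _ _ (constHom_LtoLD _)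
    (constHom_LtoLD _) (θ.thetaHom_LtoLD _) (θ.thetaHom_LtoLD _)

open scoped Classical in
lemma mapPt_thetaHom_etaD : mapPt (thetaHom θ) etaD = mapPt (constHom C) etaD := by
  rw [etaD_eq, mapPt_pt, mapPt_pt, mapPt_pt, pt_congr]
  simp only [thetaHom_apply, onLDHom_D, constHom_apply, and_self]

/-- Commutation with `ρ` can be tested on the generators of `LD` over `D(t)`. -/
lemma commutesWithRho_iff_coordinates : θ.CommutesWithRho ↔
    θ.onLDHom (rho C ffX) = PowerSeries.map (rho C).toRingHom (θ.onLDHom ffX) ∧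
    θ.onLDHom (rho C ffZ) = PowerSeries.map (rho C).toRingHom (θ.onLDHom ffZ) := by
  constructor
  · intro h
    exact ⟨h ffX, h ffZ⟩
  · rintro ⟨hx, hz⟩
    let K := (θ.onLDHom.comp (rho C).toRingHom).eqLocusField
      ((PowerSeries.map (rho C).toRingHom).comp θ.onLDHom)
    have hK : K = ⊤ := by
      apply ff_subfield_eq_top_of_adjoin
      · intro d
        have h : θ.onLDHom (rho C (DtoLD C d)) =
            PowerSeries.map (rho C).toRingHom (θ.onLDHom (DtoLD C d)) := by
          rw [rho_DtoLD, onLDHom_D, PowerSeries.map_C]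
          exact congrArg PowerSeries.C (rho_DtoLD d).symm
        rw [DtoLD_eq] at h
        exact h
      · have h : θ.onLDHom tLD = PowerSeries.C tLD + PowerSeries.X := by
          rw [← LtoLD_t, onLDHom_L, θ.2.2, map_add, PowerSeries.map_C, PowerSeries.map_X]
          rfl
        have h' : θ.onLDHom (rho C tLD) =
            PowerSeries.map (rho C).toRingHom (θ.onLDHom tLD) := by
          rw [rho_tLD, h, map_add, PowerSeries.map_C, PowerSeries.map_X]
          exact congrArg (fun a => PowerSeries.C a + PowerSeries.X) rho_tLD.symm
        exact h'
      · exact hx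
      · exact hz
    intro a
    have ha : a ∈ K := by rw [hK]; exact Subfield.mem_top a
    exact ha

open scoped Classical in
/-- Commutation with `ρ` as an identity of points over the field of fractions of the power
series. -/
lemma commutesWithRho_iff_point : θ.CommutesWithRho ↔
    mapPt (rhoHat C) (mapPt (thetaHom θ) etaL) = mapPt (thetaHom θ) (oplus C etaL etaD) := by
  rw [← mapPt_rhoC_etaL, commutesWithRho_iff_coordinates, etaL_eq, mapPt_pt, mapPt_pt, mapPt_pt,
    mapPt_pt, mapPt_pt, pt_congr, LtoLD_ffX, LtoLD_ffZ]
  simp only [thetaHom_apply, rhoHat_algebraMap, rhoC_apply,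
    (IsFractionRing.injective (LD C)⟦X⟧ (SeriesField C)).eq_iff]
  exact and_congr eq_comm eq_comm

lemma sub_sub_add_eq_iff {A : Type*} [AddCommGroup A] (a b o p r : A) :
    r = p + b - o ↔ a + b - o - r + o = a - p + o := by
  rw [add_left_inj, sub_eq_sub_iff_add_eq_add]
  constructor
  · rintro rfl; abel
  · intro h
    have : r = a + r - a := by abel
    rw [this, ← h]; abel

open scoped Classical in
/-- `θ` commutes with `ρ` if and only if the point `η_L ⊖ θ(η_L)` is fixed by `ρ`. -/
lemma commutesWithRho_iff_map_eq : θ.CommutesWithRho ↔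
    PowerSeries.map (rho C).toRingHom (PowerSeries.map (LtoLD C).toRingHom θ.f) =
      PowerSeries.map (LtoLD C).toRingHom θ.f ∧
    PowerSeries.map (rho C).toRingHom (PowerSeries.map (LtoLD C).toRingHom θ.g) =
      PowerSeries.map (LtoLD C).toRingHom θ.g := by
  obtain ⟨h, hd⟩ := θ.exists_etaL_sub_theta_etaL
  have h1 : mapPt (rhoHat C) (mapPt (constHom C) etaL) = mapPt (constHom C) (oplus C etaL etaD) := by
    rw [← mapPt_rhoC_etaL, etaL_eq, mapPt_pt, mapPt_pt, mapPt_pt, mapPt_pt, mapPt_pt, pt_congr]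
    simp only [constHom_apply, rhoHat_algebraMap, PowerSeries.map_C, rhoC_apply]
    exact ⟨rfl, rfl⟩
  have h2 : θ.CommutesWithRho ↔
      mapPt (rhoHat C) (mapPt (constHom C) etaL - mapPt (thetaHom θ) etaL +
        origin C (SeriesField C)) = mapPt (constHom C) etaL - mapPt (thetaHom θ) etaL +
        origin C (SeriesField C) := by
    rw [commutesWithRho_iff_point, map_add, map_sub, h1, mapPt_origin, mapPt_oplus, mapPt_oplus,
      mapPt_thetaHom_etaD, oplus, oplus]
    exact sub_sub_add_eq_iff _ _ _ _ _
  rw [h2, hd, mapPt_pt, pt_congr]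
  simp only [seriesHom_apply, rhoHat_algebraMap, (IsFractionRing.injective (LD C)⟦X⟧ (SeriesField C)).eq_iff]

lemma g_rel : (PowerSeries.map (LtoLD C).toRingHom θ.g) ^ 2 + PowerSeries.map (LtoLD C).toRingHom θ.g
    = (PowerSeries.map (LtoLD C).toRingHom θ.f) ^ 3 := by
  obtain ⟨h, -⟩ := θ.exists_etaL_sub_theta_etaL
  apply IsFractionRing.injective (LD C)⟦X⟧ (SeriesField C)
  rw [map_add, map_pow, map_pow, ← seriesHom_apply, ← seriesHom_apply, h]

lemma map_f_eq_iff : PowerSeries.map (rho C).toRingHom (PowerSeries.map (LtoLD C).toRingHom θ.f) =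
      PowerSeries.map (LtoLD C).toRingHom θ.f ↔
    ∀ m, PowerSeries.coeff m θ.f ∈ baseField C := by
  rw [PowerSeries.ext_iff]
  refine forall_congr' fun m => ?_
  rw [PowerSeries.coeff_map, PowerSeries.coeff_map]
  exact rho_LtoLD_eq_iff

/-- `θ` commutes with `ρ` if and only if all `f_m` lie in `C(t)`. The coordinate `g` of
`η_L ⊖ θ(η_L)` imposes no condition, as it is the root without constant term of
`g ^ 2 + g = f ^ 3`. -/
lemma commutesWithRho_iff : θ.CommutesWithRho ↔
    ∀ m, PowerSeries.coeff m θ.f ∈ baseField C := by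
  rw [commutesWithRho_iff_map_eq, map_f_eq_iff]
  refine ⟨fun h => h.1, fun h => ⟨h, ?_⟩⟩
  have h1 := θ.g_rel
  have h2 := congrArg (PowerSeries.map (rho C).toRingHom) h1
  rw [map_add, map_pow, map_pow, θ.map_f_eq_iff.mpr h, ← h1] at h2
  set G := PowerSeries.map (LtoLD C).toRingHom θ.g
  have hG : constantCoeff G = 0 := by
    rw [← coeff_zero_eq_constantCoeff_apply, PowerSeries.coeff_map,
      coeff_zero_eq_constantCoeff_apply, constantCoeff_g, map_zero]
  have hu : IsUnit (PowerSeries.map (rho C).toRingHom G + G + 1) := by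
    rw [PowerSeries.isUnit_iff_constantCoeff, map_add, map_add, hG,
      ← coeff_zero_eq_constantCoeff_apply, PowerSeries.coeff_map,
      coeff_zero_eq_constantCoeff_apply, hG]
    simp
  rw [← sub_eq_zero]
  refine hu.mul_left_eq_zero.mp ?_
  linear_combination h2

end HDL
end

/-! ### Iterativity in a range of orders -/

namespace HigherDerivation
section
variable {R : Type u} [CommRing R] [CharP R 2] {θ : HigherDerivation R}

/-- In characteristic two, iterativity in orders at most `2 ^ l` gives it in orders below
`2 ^ (l + 1)`: write `θ^(i + 2 ^ l) = θ^(i) ∘ θ^(2 ^ l)` for `i < 2 ^ l`. -/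
lemma iterativeAt_two_pow_succ {l : ℕ}
    (h : ∀ a, θ.IterativeAt (2 ^ l + 1) (2 ^ l + 1) a) (a : R) :
    θ.IterativeAt (2 ^ (l + 1)) (2 ^ (l + 1)) a := by
  have hq : 0 < 2 ^ l := by positivity
  have h2 : 2 ^ (l + 1) = 2 ^ l + 2 ^ l := by ring
  have hleft : ∀ i < 2 ^ l, ∀ a, θ.coeff i (θ.coeff (2 ^ l) a) = θ.coeff (i + 2 ^ l) a := by
    intro i hi a
    rw [h a i (by omega) _ (by omega), cast_choose_add_two_pow, if_neg (by omega), Nat.choose_self]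
    simp
  have hright : ∀ i < 2 ^ l, ∀ a, θ.coeff (2 ^ l) (θ.coeff i a) = θ.coeff (i + 2 ^ l) a := by
    intro i hi a
    rw [h a _ (by omega) i (by omega), add_comm, cast_choose_add_two_pow, if_pos le_rfl,
      Nat.choose_eq_zero_of_lt hi]
    simp
  have hlow : ∀ i < 2 ^ l, ∀ j < 2 ^ l, ∀ a,
      θ.coeff i (θ.coeff j a) = ((i + j).choose i : R) * θ.coeff (i + j) a :=
    fun i hi j hj a => h a i (by omega) j (by omega)
  have hself : ∀ a, θ.coeff (2 ^ l) (θ.coeff (2 ^ l) a) = 0 := by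
    intro a
    rw [h a _ (by omega) _ (by omega), cast_choose_add_two_pow, if_pos le_rfl, Nat.choose_self,
      Nat.sub_self, Nat.choose_zero_right, Nat.cast_one, CharTwo.add_self_eq_zero, zero_mul]
  intro i hi j hj
  rcases lt_or_ge i (2 ^ l) with hi' | hi' <;> rcases lt_or_ge j (2 ^ l) with hj' | hj'
  · exact hlow i hi' j hj' a
  · obtain ⟨j, rfl⟩ := Nat.exists_eq_add_of_le' hj'
    rw [← hleft j (by omega), hlow i hi' j (by omega), ← add_assoc, cast_choose_add_two_pow,
      if_neg (by omega), add_zero]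
    rcases lt_or_ge (i + j) (2 ^ l) with hij | hij
    · rw [hleft _ hij]
    · rw [cast_choose_of_lt_two_pow hi' (by omega) hij, zero_mul, zero_mul]
  · obtain ⟨i, rfl⟩ := Nat.exists_eq_add_of_le' hi'
    have hi0 : i < 2 ^ l := by omega
    rw [← hright i hi0, hlow i hi0 j hj', coeff_natCast_mul, show i + 2 ^ l + j = i + j + 2 ^ l by ring,
      cast_choose_add_two_pow, if_pos (by omega), Nat.add_sub_cancel,
      Nat.choose_eq_zero_of_lt (by omega : i + j < i + 2 ^ l), Nat.cast_zero, zero_add]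
    rcases lt_or_ge (i + j) (2 ^ l) with hij | hij
    · rw [hright _ hij]
    · rw [cast_choose_of_lt_two_pow hi0 hj' hij, zero_mul, zero_mul]
  · obtain ⟨i, rfl⟩ := Nat.exists_eq_add_of_le' hi'
    obtain ⟨j, rfl⟩ := Nat.exists_eq_add_of_le' hj'
    rw [← hright j (by omega), ← hleft i (by omega), hself, coeff_map_zero,
      cast_choose_of_lt_two_pow (l := l + 1) (by omega) (by omega) (by omega), zero_mul]

end
end HigherDerivation

section
variable {C : Type u} [Field C] [CharP C 2]

namespace HDL
open PowerSeries
variable {θ : HDL C}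

/-- It suffices to test iterativity at the coordinate `x`. -/
lemma iterativeAt_of_iterativeAt_ffX {M N : ℕ} (h : θ.1.IterativeAt M N ffX) (a : L C) :
    θ.1.IterativeAt M N a := by
  have key : (Ideal.Quotient.mk (rectIdeal (L C) M N)).comp θ.1.twice =
      ((Ideal.Quotient.mk (rectIdeal (L C) M N)).comp shift).comp θ.1.toRingHom := by
    apply ff_ringHom_ext
    · intro r
      exact θ.1.iterativeAt_iff.mp
        (θ.iterativeAt_of_mem_baseField M N (algebraMap_mem_baseField r))
    · exact θ.1.iterativeAt_iff.mp h
    · simp only [RingHom.comp_apply]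
      rw [← map_add, ← map_one (Ideal.Quotient.mk _), ← map_add]
      refine IsUnit.map _ ?_
      have hc : ∀ F : (L C)⟦X⟧⟦X⟧, constantCoeff (constantCoeff F) =
          PowerSeries.coeff 0 (PowerSeries.coeff 0 F) := fun F => by
        rw [coeff_zero_eq_constantCoeff_apply, coeff_zero_eq_constantCoeff_apply]
      have h1 : (θ.1.toRingHom ffZ).coeff 0 = ffZ := θ.1.coeff_zero _
      rw [PowerSeries.isUnit_iff_constantCoeff, PowerSeries.isUnit_iff_constantCoeff, hc, map_add,
        map_add, map_add, map_add, HigherDerivation.coeff_coeff_twice, coeff_coeff_shift, h1,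
        HigherDerivation.coeff_zero, HigherDerivation.coeff_zero]
      simp [CharTwo.add_self_eq_zero]
  exact θ.1.iterativeAt_iff.mpr (DFunLike.congr_fun key a)

omit [CharP C 2] in
lemma onLD_coeff_LtoLD (n : ℕ) (a : L C) :
    θ.onLD.coeff n (LtoLD C a) = LtoLD C (θ.1.coeff n a) := by
  change PowerSeries.coeff n (θ.onLDHom (LtoLD C a)) = _
  rw [onLDHom_L, PowerSeries.coeff_map]
  rfl

omit [CharP C 2] in
lemma iterativeAt_onLD {M N : ℕ} (h : ∀ a, θ.1.IterativeAt M N a) (a : LD C) :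
    θ.onLD.IterativeAt M N a := by
  have hL : ∀ b, LtoLD C b ∈ θ.onLD.iterativeSubfield M N := by
    intro b i hi j hj
    rw [onLD_coeff_LtoLD, onLD_coeff_LtoLD, onLD_coeff_LtoLD, h b i hi j hj, map_mul, map_natCast]
  have hD : ∀ d, DtoLD C d ∈ θ.onLD.iterativeSubfield M N := fun d =>
    θ.onLD.iterativeAt_of_eq_C (θ.onLDHom_D d) M N
  have hK : θ.onLD.iterativeSubfield M N = ⊤ := tensorToLD_generates _ fun r => by
    induction r using TensorProduct.induction_on with
    | zero => rw [map_zero]; exact Subfield.zero_mem _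
    | add x y hx hy => rw [map_add]; exact Subfield.add_mem _ hx hy
    | tmul l d => rw [tensorToLD_tmul]; exact Subfield.mul_mem _ (hL l) (hD d)
  have ha : a ∈ θ.onLD.iterativeSubfield M N := by rw [hK]; exact Subfield.mem_top a
  exact ha

/-- For a derivation which commutes with `ρ`, the defect of iterativity at `x` is invariant
under `ρ` in twice the range of orders where `θ` is iterative, because `ρ(x)` and `x` differ by a
constant and a square. -/
lemma CommutesWithRho.defect_mem_baseField (hρ : θ.CommutesWithRho) {M : ℕ}
    (h : ∀ a, θ.1.IterativeAt M M a) {i j : ℕ} (hi : i < 2 * M) (hj : j < 2 * M) :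
    θ.1.coeff i (θ.xi j) + ((i + j).choose i : L C) * θ.xi (i + j) ∈ baseField C := by
  let K : LD C → LD C := fun a =>
    θ.onLD.coeff i (θ.onLD.coeff j a) + ((i + j).choose i : LD C) * θ.onLD.coeff (i + j) a
  have hadd : ∀ a b, K (a + b) = K a + K b := by
    intro a b
    simp only [K, HigherDerivation.coeff_add]
    ring
  have hzero : ∀ a, θ.onLD.IterativeAt (2 * M) (2 * M) a → K a = 0 := fun a ha =>
    add_eq_zero_iff_eq_of_charP_two.mpr (ha i hi j hj)
  have hcomm : ∀ n a, θ.onLD.coeff n (rho C a) = rho C (θ.onLD.coeff n a) := by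
    intro n a
    have := congrArg (PowerSeries.coeff n) (hρ a)
    rw [PowerSeries.coeff_map] at this
    exact this
  have hK : ∀ a, K (rho C a) = rho C (K a) := by
    intro a
    simp only [K, hcomm, map_add, map_mul, map_natCast]
  have hx : rho C (K ffX) = K ffX := by
    obtain ⟨u, s, hs⟩ := exists_rho_ffX_eq (C := C)
    rw [← hK, hs, hadd, hadd, hzero _ (θ.onLD.iterativeAt_of_eq_C (θ.onLDHom_D u) _ _),
      hzero _ (iterativeAt_onLD h s).sq, add_zero, add_zero]
  rw [← rho_LtoLD_eq_iff]
  have hL : LtoLD C (θ.1.coeff i (θ.xi j) + ((i + j).choose i : L C) * θ.xi (i + j)) =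
      K ffX := by
    simp only [K]
    rw [← LtoLD_ffX, onLD_coeff_LtoLD, onLD_coeff_LtoLD, onLD_coeff_LtoLD, map_add, map_mul,
      map_natCast, xi, xi]
  rw [hL, hx]

/-- In even orders the defect at `x` is, modulo `C(t)`, the square of the defect at the coefficients
of the slope. -/
lemma CommutesWithRho.slope_defect_mem_baseField (hρ : θ.CommutesWithRho) {M : ℕ}
    (h : ∀ a, θ.1.IterativeAt M M a) {n k : ℕ} (hn : n < M) (hk : k < M) (hk0 : 0 < k) :
    θ.1.coeff n (PowerSeries.coeff k θ.slope) +
      ((n + k).choose n : L C) * PowerSeries.coeff (n + k) θ.slope ∈ baseField C := by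
  have hf := θ.commutesWithRho_iff.mp hρ
  apply mem_baseField_of_sq_mem
  have h1 := hρ.defect_mem_baseField h (i := 2 * n) (j := 2 * k) (by omega) (by omega)
  rw [← mul_add, cast_choose_two_mul, if_pos (even_two_mul n), Nat.mul_div_cancel_left _ two_pos,
    xi_eq (m := 2 * k) (by omega), xi_eq (m := 2 * (n + k)) (by omega), fTilde_two_mul, fTilde_two_mul,
    HigherDerivation.coeff_add, HigherDerivation.coeff_sq, if_pos (even_two_mul n),
    Nat.mul_div_cancel_left _ two_pos] at h1
  have h2 := (baseField C).add_mem (θ.coeff_mem_baseField (2 * n) (hf (2 * k)))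
    ((baseField C).mul_mem (natCast_mem (baseField C) ((n + k).choose n)) (hf (2 * (n + k))))
  rw [CharTwo.add_sq, mul_pow, cast_choose_sq]
  convert (baseField C).sub_mem h1 h2 using 1
  ring

/-- The conditions on `θ` in orders below `2 ^ l`: it is iterative there, and the `f_m` lie in
`C(t)`. -/
structure GoodBelow (θ : HDL C) (l : ℕ) : Prop where
  iterativeAt : ∀ a, θ.1.IterativeAt (2 ^ l) (2 ^ l) a
  coeff_f_mem : ∀ m < 2 ^ l, PowerSeries.coeff m θ.f ∈ baseField C

/-- A higher derivation that commutes with `ρ` and agrees with `θ` in low orders. -/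
lemma exists_commutesWithRho {N : ℕ} (hN : 0 < N)
    (hf : ∀ m < N, PowerSeries.coeff m θ.f ∈ baseField C) :
    ∃ θ' : HDL C, (∀ m < N, θ'.xi m = θ.xi m) ∧ θ'.CommutesWithRho := by
  -- In higher orders the `ξ_n` are chosen such that `f_n = 0`.
  obtain ⟨θ', h⟩ := exists_recursive (C := C) fun n η => if n < N then θ.xi n else η.fTilde n ^ 2
  have hlow : ∀ m < N, θ'.xi m = θ.xi m := by
    intro m hm
    rcases Nat.eq_zero_or_pos m with rfl | hm0
    · rw [xi_zero, xi_zero]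
    · obtain ⟨η, -, hη⟩ := h m hm0
      rwa [if_pos hm] at hη
  refine ⟨θ', hlow, θ'.commutesWithRho_iff.mpr fun m => ?_⟩
  rcases Nat.eq_zero_or_pos m with rfl | hm0
  · rw [coeff_zero_eq_constantCoeff_apply, constantCoeff_f]
    exact (baseField C).zero_mem
  rw [θ'.coeff_f m hm0]
  rcases lt_or_ge m N with hm | hm
  · rw [hlow m hm, fTilde_eq_of_xi_eq hlow (by omega), ← θ.coeff_f m hm0]
    exact hf m hm
  · obtain ⟨η, hη, he⟩ := h m hm0
    rw [if_neg (by omega)] at he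
    rw [he, fTilde_eq_of_xi_eq hη (by omega), CharTwo.add_self_eq_zero]
    exact (baseField C).zero_mem

/-- In low orders the coefficients of the slope satisfy the iteration rule modulo `C(t)`: this
involves only the `ξ_m` with `m < 2 ^ l`, so that `θ` may be replaced by a higher derivation which
commutes with `ρ`. -/
lemma GoodBelow.slope_defect_mem_baseField {l : ℕ} (h : θ.GoodBelow l) {n k : ℕ} (hn : n < 2 ^ l)
    (hk : k < 2 ^ l) (hk0 : 0 < k) :
    θ.1.coeff n (PowerSeries.coeff k θ.slope) +
      ((n + k).choose n : L C) * PowerSeries.coeff (n + k) θ.slope ∈ baseField C := by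
  obtain ⟨θ', hx, hρ⟩ := exists_commutesWithRho (by positivity) h.coeff_f_mem
  have hit : ∀ a, θ'.1.IterativeAt (2 ^ l) (2 ^ l) a := by
    intro a i hi j hj
    rw [coeff_eq_of_xi_eq hx hi, coeff_eq_of_xi_eq hx hj, h.iterativeAt a i hi j hj]
    rcases lt_or_ge (i + j) (2 ^ l) with hij | hij
    · rw [coeff_eq_of_xi_eq hx hij]
    · rw [cast_choose_of_lt_two_pow hi hj hij, zero_mul, zero_mul]
  have h1 := hρ.slope_defect_mem_baseField hit hn hk hk0
  rw [coeff_eq_of_xi_eq hx hn, coeff_slope_eq_of_xi_eq hx hk] at h1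
  rcases lt_or_ge (n + k) (2 ^ l) with hij | hij
  · rwa [coeff_slope_eq_of_xi_eq hx hij] at h1
  · rw [cast_choose_of_lt_two_pow hn hk hij, zero_mul] at h1 ⊢
    exact h1

lemma goodBelow_zero : θ.GoodBelow 0 := by
  refine ⟨fun a i hi j hj => ?_, fun m hm => ?_⟩
  · rw [pow_zero, Nat.lt_one_iff] at hi hj
    simp [hi, hj, HigherDerivation.coeff_zero]
  · rw [pow_zero, Nat.lt_one_iff] at hm
    rw [hm, coeff_zero_eq_constantCoeff_apply, constantCoeff_f]
    exact (baseField C).zero_mem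

end HDL
end

/-! ### From the orders below `2 ^ ℓ` to the orders below `2 ^ (ℓ + 1)` -/

lemma sum_Ico_two_mul {M : Type*} [AddCommMonoid M] (g : ℕ → M) (hg : ∀ m, ¬ Even m → g m = 0)
    (n : ℕ) : ∑ m ∈ Finset.Ico 1 (2 * n), g m = ∑ k ∈ Finset.Ico 1 n, g (2 * k) := by
  symm
  refine Finset.sum_of_injOn (fun k => 2 * k) (fun a _ b _ h => by simpa using h) ?_ ?_
    (fun _ _ => rfl)
  · intro k hk
    simp only [Finset.coe_Ico, Set.mem_Ico] at hk ⊢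
    omega
  · intro m hm hn
    refine hg m fun he => hn ?_
    rw [Finset.mem_Ico] at hm
    refine ⟨m / 2, ?_, Nat.two_mul_div_two_of_even he⟩
    simp only [Finset.coe_Ico, Set.mem_Ico]
    have := Nat.two_mul_div_two_of_even he
    omega

section
variable {C : Type u} [Field C]

open PowerSeries in
instance [CharP C 2] : CharP (L C)⟦X⟧ 2 := charP_of_injective_ringHom PowerSeries.C_injective 2

namespace HDL
open PowerSeries
variable {θ : HDL C}

/-- The elements of `C(t ^ (2 ^ (l + 1)))` are constants in orders below `2 ^ (l + 1)`. -/
lemma X_pow_dvd_of_mem_constField {l : ℕ} [CharP C 2] {c : L C} (hc : c ∈ constField C l) :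
    (PowerSeries.X : (L C)⟦X⟧) ^ 2 ^ (l + 1) ∣ θ.1.toRingHom c - PowerSeries.C c := by
  induction hc using IntermediateField.adjoin_induction with
  | mem a ha =>
    rw [Set.mem_singleton_iff.mp ha, map_pow, θ.2.2, add_pow_char_pow, map_pow, add_sub_cancel_left]
  | algebraMap a => rw [θ.2.1, sub_self]; exact dvd_zero _
  | add a b _ _ ha hb =>
    rw [map_add, map_add, add_sub_add_comm]
    exact dvd_add ha hb
  | mul a b _ _ ha hb =>
    have : θ.1.toRingHom (a * b) - PowerSeries.C (a * b) =
        (θ.1.toRingHom a - PowerSeries.C a) * θ.1.toRingHom b +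
          PowerSeries.C a * (θ.1.toRingHom b - PowerSeries.C b) := by
      rw [map_mul, map_mul]; ring
    rw [this]
    exact dvd_add (ha.mul_right _) (hb.mul_left _)
  | inv a _ ha =>
    rcases eq_or_ne a 0 with rfl | h0
    · rw [inv_zero, map_zero, map_zero, sub_self]
      exact dvd_zero _
    have h1 : θ.1.toRingHom a * θ.1.toRingHom a⁻¹ = 1 := by
      rw [← map_mul, mul_inv_cancel₀ h0, map_one]
    have h2 : PowerSeries.C a * PowerSeries.C a⁻¹ = 1 := by
      rw [← map_mul, mul_inv_cancel₀ h0, map_one]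
    have : θ.1.toRingHom a⁻¹ - PowerSeries.C a⁻¹ =
        (θ.1.toRingHom a - PowerSeries.C a) * -(θ.1.toRingHom a⁻¹ * PowerSeries.C a⁻¹) := by
      linear_combination PowerSeries.C a⁻¹ * h1 - θ.1.toRingHom a⁻¹ * h2
    rw [this]
    exact ha.mul_right _

lemma coeff_of_mem_constField [CharP C 2] {l : ℕ} {c : L C} (hc : c ∈ constField C l) {j : ℕ}
    (hj : 0 < j) (hj' : j < 2 ^ (l + 1)) : θ.1.coeff j c = 0 := by
  have := PowerSeries.X_pow_dvd_iff.mp (X_pow_dvd_of_mem_constField (θ := θ) hc) j hj'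
  rwa [map_sub, PowerSeries.coeff_C, if_neg hj.ne', sub_zero] at this

/-- If the `y_m` with `m > 0` behave like `θ^(m)(a)` for some `a`, then `θ^(j)` maps the sum of the
`y_m t ^ m` to `y_j`. Indeed `θ(y_m) = ∑_k binom k m y_k T ^ (k - m)`, and in characteristic two
`∑_{m = 0}^k binom k m T ^ (k - m) (t + T) ^ m = (t + T + T) ^ k = t ^ k`; as the term for `m = 0` is
missing, the sum is mapped by `θ` to the sum of the `y_k (t ^ k + T ^ k)`. -/
lemma coeff_sum_mul_tL_pow [CharP C 2] {y : ℕ → L C} {q j : ℕ} (hj : 0 < j)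
    (h0 : ∀ m, q ≤ m → y m = 0)
    (h : ∀ m, 0 < m → m < q → ∀ n ≤ j, θ.1.coeff n (y m) = ((n + m).choose n : L C) * y (n + m)) :
    θ.1.coeff j (∑ m ∈ Finset.Ico 1 q, y m * tL ^ m) = y j := by
  let Y : ℕ → (L C)⟦X⟧ := fun m => ∑ k ∈ Finset.Ico m q,
    PowerSeries.C (y k * (k.choose m : L C)) * PowerSeries.X ^ (k - m)
  have hY : ∀ m, 0 < m → m < q → ∀ n ≤ j,
      PowerSeries.coeff n (θ.1.toRingHom (y m)) = PowerSeries.coeff n (Y m) := by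
    intro m hm hmq n hn
    have h1 := h m hm hmq n hn
    rw [HigherDerivation.coeff] at h1
    simp only [Y, map_sum, PowerSeries.coeff_C_mul, PowerSeries.coeff_X_pow, mul_ite, mul_one,
      mul_zero]
    rw [h1, ← Finset.sum_filter]
    rcases lt_or_ge (n + m) q with hnm | hnm
    · have : Finset.filter (fun k => n = k - m) (Finset.Ico m q) = {n + m} := by
        ext k
        simp only [Finset.mem_filter, Finset.mem_Ico, Finset.mem_singleton]
        omega
      rw [this, Finset.sum_singleton, mul_comm, Nat.choose_symm_add]
    · have : Finset.filter (fun k => n = k - m) (Finset.Ico m q) = ∅ := by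
        refine Finset.filter_eq_empty_iff.mpr fun k hk => ?_
        rw [Finset.mem_Ico] at hk
        omega
      rw [this, Finset.sum_empty, h0 _ hnm, mul_zero]
  have hsum : ∑ m ∈ Finset.Ico 1 q, Y m * (PowerSeries.C tL + PowerSeries.X) ^ m =
      ∑ k ∈ Finset.Ico 1 q, PowerSeries.C (y k) *
        (PowerSeries.C (tL ^ k) + PowerSeries.X ^ k) := by
    simp only [Y, Finset.sum_mul]
    rw [Finset.sum_Ico_Ico_comm]
    refine Finset.sum_congr rfl fun k hk => ?_
    have hb := add_pow (PowerSeries.C (tL : L C) + PowerSeries.X) PowerSeries.X k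
    rw [Finset.range_eq_Ico, Finset.sum_eq_sum_Ico_succ_bot (by omega), add_assoc,
      CharTwo.add_self_eq_zero, add_zero] at hb
    simp only [pow_zero, one_mul, Nat.sub_zero, Nat.choose_zero_right, Nat.cast_one, mul_one,
      zero_add] at hb
    rw [map_pow, hb, add_right_comm, CharTwo.add_self_eq_zero, zero_add, Finset.mul_sum]
    refine Finset.sum_congr rfl fun m _ => ?_
    rw [map_mul, map_natCast]
    ring
  have h1 : θ.1.coeff j (∑ m ∈ Finset.Ico 1 q, y m * tL ^ m) = PowerSeries.coeff j
      (∑ m ∈ Finset.Ico 1 q, Y m * (PowerSeries.C tL + PowerSeries.X) ^ m) := by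
    rw [HigherDerivation.coeff_sum, map_sum]
    refine Finset.sum_congr rfl fun m hm => ?_
    rw [Finset.mem_Ico] at hm
    rw [HigherDerivation.coeff, map_mul, map_pow, θ.2.2, PowerSeries.coeff_mul,
      PowerSeries.coeff_mul]
    refine Finset.sum_congr rfl fun p hp => ?_
    rw [Finset.HasAntidiagonal.mem_antidiagonal] at hp
    rw [hY m (by omega) hm.2 p.1 (by omega)]
  rw [h1, hsum, map_sum]
  simp only [PowerSeries.coeff_C_mul, map_add, PowerSeries.coeff_C, if_neg hj.ne', zero_add,
    PowerSeries.coeff_X_pow, mul_ite, mul_one, mul_zero]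
  rw [Finset.sum_ite_eq]
  split_ifs with hjq
  · rfl
  · rw [Finset.mem_Ico] at hjq
    rw [h0 j (by omega)]

variable [CharP C 2]

namespace GoodBelow
variable {l : ℕ}

/-- The sum `∑_{m < 2^l} θ^(m)(a) t ^ m` is killed by `θ^(j)` for `0 < j < 2 ^ l`. -/
lemma coeff_sum_coeff_mul_tL_pow (h : θ.GoodBelow l) (a : L C) {j : ℕ} (hj : 0 < j)
    (hj' : j < 2 ^ l) : θ.1.coeff j (∑ m ∈ Finset.range (2 ^ l), θ.1.coeff m a * tL ^ m) = 0 := by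
  let y : ℕ → L C := fun m => if m < 2 ^ l then θ.1.coeff m a else 0
  have hs : ∑ m ∈ Finset.range (2 ^ l), θ.1.coeff m a * tL ^ m =
      a + ∑ m ∈ Finset.Ico 1 (2 ^ l), y m * tL ^ m := by
    rw [Finset.range_eq_Ico, Finset.sum_eq_sum_Ico_succ_bot (by positivity), pow_zero, mul_one,
      HigherDerivation.coeff_zero]
    refine congrArg _ (Finset.sum_congr rfl fun m hm => ?_)
    simp only [y]
    rw [if_pos (Finset.mem_Ico.mp hm).2]
  rw [hs, HigherDerivation.coeff_add, coeff_sum_mul_tL_pow hj]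
  · simp only [y]
    rw [if_pos hj', CharTwo.add_self_eq_zero]
  · intro m hm
    exact if_neg (by omega)
  · intro m hm hm' n hn
    simp only [y]
    rw [if_pos hm', h.iterativeAt a n (by omega) m hm']
    split_ifs with hnm
    · rfl
    · rw [cast_choose_of_lt_two_pow (by omega) hm' (by omega), zero_mul, zero_mul]

/-- In positive order, `ξ_m` is the sum of an element of `C(t)` and a square, so that it inherits
iterativity in twice the range. -/
lemma iterativeAt_xi (h : θ.GoodBelow l) {m : ℕ} (hm : 0 < m) (hm' : m < 2 ^ l) :
    θ.1.IterativeAt (2 ^ (l + 1)) (2 ^ (l + 1)) (θ.xi m) := by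
  rw [xi_eq hm, pow_succ']
  exact (θ.iterativeAt_of_mem_baseField _ _ (h.coeff_f_mem m hm')).add (h.iterativeAt _).sq

omit [CharP C 2] in
lemma coeff_xi (h : θ.GoodBelow l) {n m : ℕ} (hn : n < 2 ^ l) (hm : m < 2 ^ l) :
    θ.1.coeff n (θ.xi m) = ((n + m).choose n : L C) * θ.xi (n + m) :=
  h.iterativeAt ffX n hn m hm

/-- The sum behaves as in `coeff_sum_mul_tL_pow`, because `θ^(2^l)` commutes with the lower
`θ^(n)` at `ξ_m`. -/
lemma coeff_sum_coeff_xi (h : θ.GoodBelow l) {j : ℕ} (hj : 0 < j) (hj' : j ≤ 2 ^ l) :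
    θ.1.coeff j (∑ m ∈ Finset.Ico 1 (2 ^ l), θ.1.coeff (2 ^ l) (θ.xi m) * tL ^ m) =
      if j < 2 ^ l then θ.1.coeff (2 ^ l) (θ.xi j) else 0 := by
  have h2 : 2 ^ (l + 1) = 2 ^ l + 2 ^ l := by ring
  have hq : 0 < 2 ^ l := by positivity
  let y : ℕ → L C := fun m => if m < 2 ^ l then θ.1.coeff (2 ^ l) (θ.xi m) else 0
  have hs : ∑ m ∈ Finset.Ico 1 (2 ^ l), θ.1.coeff (2 ^ l) (θ.xi m) * tL ^ m =
      ∑ m ∈ Finset.Ico 1 (2 ^ l), y m * tL ^ m := by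
    refine Finset.sum_congr rfl fun m hm => ?_
    simp only [y]
    rw [if_pos (Finset.mem_Ico.mp hm).2]
  rw [hs]
  refine coeff_sum_mul_tL_pow hj (fun m hm => if_neg (by omega)) fun m hm hm' n hn => ?_
  simp only [y]
  rw [if_pos hm']
  rcases (hn.trans hj').eq_or_lt with rfl | hn'
  · rw [h.iterativeAt_xi hm hm' _ (by omega) _ (by omega),
      cast_choose_of_lt_two_pow (l := l + 1) (by omega) (by omega) (by omega), if_neg (by omega),
      zero_mul, mul_zero]
  have hcomm : θ.1.coeff n (θ.1.coeff (2 ^ l) (θ.xi m)) =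
      θ.1.coeff (2 ^ l) (θ.1.coeff n (θ.xi m)) := by
    rw [h.iterativeAt_xi hm hm' _ (by omega) _ (by omega),
      h.iterativeAt_xi hm hm' _ (by omega) _ (by omega), add_comm, Nat.choose_symm_add]
  rw [hcomm, h.coeff_xi hn' hm', HigherDerivation.coeff_natCast_mul]
  split_ifs with hnm
  · rfl
  · rw [cast_choose_of_lt_two_pow hn' hm' (by omega), zero_mul, zero_mul]

/-- The derivatives of `ξ_{2^l}` that are determined by the condition at the stage `l`. -/
lemma coeff_xi_two_pow (h : θ.GoodBelow l) {c : L C} (hc : c ∈ constField C l)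
    (hx : θ.xi (2 ^ l) = θ.mainTerm l + c) {j : ℕ} (hj : 0 < j) (hj' : j ≤ 2 ^ l) :
    θ.1.coeff j (θ.xi (2 ^ l)) = if j < 2 ^ l then θ.1.coeff (2 ^ l) (θ.xi j) else 0 := by
  have h2 : 2 ^ (l + 1) = 2 ^ l + 2 ^ l := by ring
  rw [hx, mainTerm, HigherDerivation.coeff_add, HigherDerivation.coeff_add,
    h.coeff_sum_coeff_xi hj hj', coeff_of_mem_constField hc hj (by omega),
    HigherDerivation.coeff_sq]
  have : ∀ a : L C, (if Even j then θ.1.coeff (j / 2)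
      (∑ m ∈ Finset.range (2 ^ l), θ.1.coeff m a * tL ^ m) ^ 2 else 0) = 0 := by
    intro a
    split_ifs with he
    · have : j / 2 * 2 = j := Nat.div_two_mul_two_of_even he
      rw [h.coeff_sum_coeff_mul_tL_pow a (by omega) (by omega), zero_pow two_ne_zero]
    · rfl
  rw [this, add_zero, add_zero]

/-- The stage `l` makes `θ` iterative at `x` in orders at most `2 ^ l`. -/
lemma iterativeAt_succ (h : θ.GoodBelow l) (hS : θ.Stage l) (a : L C) :
    θ.1.IterativeAt (2 ^ (l + 1)) (2 ^ (l + 1)) a := by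
  obtain ⟨h1, c, hc, hx⟩ := hS
  refine HigherDerivation.iterativeAt_two_pow_succ (fun a => ?_) a
  refine iterativeAt_of_iterativeAt_ffX (fun i hi j hj => ?_) a
  change θ.1.coeff i (θ.xi j) = ((i + j).choose i : L C) * θ.xi (i + j)
  rcases Nat.eq_zero_or_pos i with rfl | hi0
  · rw [HigherDerivation.coeff_zero, zero_add, Nat.choose_zero_right, Nat.cast_one, one_mul]
  rcases Nat.eq_zero_or_pos j with rfl | hj0
  · rw [xi_zero, add_zero, Nat.choose_self, Nat.cast_one, one_mul, xi]
  rcases (Nat.lt_succ_iff.mp hi).lt_or_eq with hi' | rfl <;>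
    rcases (Nat.lt_succ_iff.mp hj).lt_or_eq with hj' | rfl
  · exact h.coeff_xi hi' hj'
  · rw [h.coeff_xi_two_pow hc hx hi0 hi'.le, if_pos hi', h1 i hi0 hi', cast_choose_add_two_pow,
      if_neg (by omega), Nat.choose_self, add_zero, Nat.cast_one, one_mul]
  · rw [add_comm, h1 j hj0 hj', cast_choose_add_two_pow, if_pos le_rfl,
      Nat.choose_eq_zero_of_lt hj', Nat.sub_self, Nat.choose_zero_right, Nat.cast_zero,
      Nat.cast_one, zero_add, one_mul]
  · rw [h.coeff_xi_two_pow hc hx hi0 le_rfl, if_neg (lt_irrefl _), cast_choose_add_two_pow,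
      if_pos le_rfl, Nat.choose_self, Nat.sub_self, Nat.choose_zero_right, Nat.cast_one,
      CharTwo.add_self_eq_zero, zero_mul]

/-- Here `f_{m + 2^l}` is, modulo `C(t)`, the square of a defect of the slope. -/
lemma coeff_f_add_two_pow_mem (h : θ.GoodBelow l) (hS : θ.Stage l) {m : ℕ} (hm : 0 < m)
    (hm' : m < 2 ^ l) : PowerSeries.coeff (m + 2 ^ l) θ.f ∈ baseField C := by
  obtain ⟨l, rfl⟩ : ∃ k, l = k + 1 := ⟨l - 1, by
    have : l ≠ 0 := by rintro rfl; omega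
    omega⟩
  have hq : 2 ^ (l + 1) = 2 * 2 ^ l := by ring
  have hq0 : 0 < 2 ^ l := by positivity
  rw [θ.coeff_f _ (by omega), hS.1 m hm hm', xi_eq hm, HigherDerivation.coeff_add, add_assoc]
  refine (baseField C).add_mem (θ.coeff_mem_baseField _ (h.coeff_f_mem m hm')) ?_
  rcases Nat.even_or_odd' m with ⟨k, rfl | rfl⟩
  · have h1 := h.slope_defect_mem_baseField (n := 2 ^ l) (k := k) (by omega) (by omega) (by omega)
    rw [add_comm (2 ^ l) k, cast_choose_add_two_pow, if_pos le_rfl,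
      Nat.choose_eq_zero_of_lt (by omega), Nat.sub_self, Nat.choose_zero_right, Nat.cast_zero,
      Nat.cast_one, zero_add, one_mul] at h1
    have h2 := (baseField C).pow_mem h1 2
    rw [CharTwo.add_sq] at h2
    rw [hq, ← mul_add, fTilde_two_mul, fTilde_two_mul, HigherDerivation.coeff_sq,
      if_pos (even_two_mul _), Nat.mul_div_cancel_left _ two_pos]
    exact h2
  · have hodd : ¬ Even (2 * k + 1) := by simp
    have hodd' : ¬ Even (2 * k + 1 + 2 ^ (l + 1)) := by
      rw [hq, Nat.not_even_iff_odd]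
      exact ⟨k + 2 ^ l, by ring⟩
    rw [fTilde, if_neg hodd, fTilde, if_neg hodd', zero_pow two_ne_zero,
      HigherDerivation.coeff_map_zero, zero_add]
    exact (baseField C).zero_mem

/-- Modulo `C(t)`, the element `f_{2^l}` is the square of
`∑_{0 < k < 2^(l-1)} θ^(2^(l-1))(s_k) t ^ k + ∑_{0 < m < 2^l} θ^(m)(s_{2^(l-1)}) t ^ m`, where the
`s_k` are the coefficients of the slope. By the iteration rule modulo `C(t)`, the terms of the first
sum cancel those of the second with `m < 2 ^ (l - 1)`, and the others lie in `C(t)`. -/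
lemma coeff_f_two_pow_mem (h : θ.GoodBelow l) (hS : θ.Stage l) :
    PowerSeries.coeff (2 ^ l) θ.f ∈ baseField C := by
  obtain ⟨-, c, hc, hx⟩ := hS
  have hcF := constField_le_baseField l hc
  rw [θ.coeff_f _ (by positivity), hx, mainTerm]
  rcases Nat.eq_zero_or_pos l with rfl | hl
  · have hodd : θ.fTilde (2 ^ 0) = 0 := if_neg (by simp)
    rw [hodd]
    simpa [HigherDerivation.coeff_map_zero] using hcF
  obtain ⟨l, rfl⟩ : ∃ k, l = k + 1 := ⟨l - 1, by omega⟩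
  have hq : 2 ^ (l + 1) = 2 * 2 ^ l := by ring
  have hq0 : 0 < 2 ^ l := by positivity
  let s : ℕ → L C := fun k => PowerSeries.coeff k θ.slope
  have ht : ∀ (m : ℕ), (tL : L C) ^ m ∈ baseField C := fun m =>
    (baseField C).pow_mem tL_mem_baseField m
  have hA : ∑ m ∈ Finset.Ico 1 (2 ^ (l + 1)), θ.1.coeff (2 ^ (l + 1)) (θ.fTilde m ^ 2) * tL ^ m =
      (∑ k ∈ Finset.Ico 1 (2 ^ l), θ.1.coeff (2 ^ l) (s k) * tL ^ k) ^ 2 := by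
    rw [hq, sum_Ico_two_mul, CharTwo.sum_sq]
    · refine Finset.sum_congr rfl fun k _ => ?_
      rw [fTilde_two_mul, HigherDerivation.coeff_sq, if_pos (even_two_mul _),
        Nat.mul_div_cancel_left _ two_pos, mul_pow, ← pow_mul, mul_comm k 2]
    · intro m hm
      rw [fTilde, if_neg hm, zero_pow two_ne_zero, HigherDerivation.coeff_map_zero, zero_mul]
  have hB : ∑ k ∈ Finset.Ico 1 (2 ^ l), θ.1.coeff (2 ^ l) (s k) * tL ^ k +
      ∑ m ∈ Finset.Ico 1 (2 ^ (l + 1)), θ.1.coeff m (s (2 ^ l)) * tL ^ m ∈ baseField C := by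
    rw [← Finset.sum_Ico_consecutive _ hq0 (by omega : 2 ^ l ≤ 2 ^ (l + 1)), ← add_assoc,
      ← Finset.sum_add_distrib]
    refine (baseField C).add_mem (sum_mem fun k hk => ?_) (sum_mem fun m hm => ?_)
    · rw [Finset.mem_Ico] at hk
      have h1 := h.slope_defect_mem_baseField (n := 2 ^ l) (k := k) (by omega) (by omega) (by omega)
      have h2 := h.slope_defect_mem_baseField (n := k) (k := 2 ^ l) (by omega) (by omega) (by omega)
      rw [add_comm (2 ^ l) k, ← Nat.choose_symm_add] at h1
      rw [← add_mul]
      refine (baseField C).mul_mem ?_ (ht k)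
      convert (baseField C).sub_mem h1 h2 using 1
      rw [add_sub_add_right_eq_sub, CharTwo.sub_eq_add]
    · rw [Finset.mem_Ico] at hm
      have h2 := h.slope_defect_mem_baseField (n := m) (k := 2 ^ l) (by omega) (by omega) (by omega)
      rw [cast_choose_of_lt_two_pow (l := l + 1) (by omega) (by omega) (by omega), zero_mul,
        add_zero] at h2
      exact (baseField C).mul_mem h2 (ht m)
  have hC : ∑ m ∈ Finset.Ico 1 (2 ^ (l + 1)), θ.1.coeff (2 ^ (l + 1)) (θ.xi m) * tL ^ m =
      ∑ m ∈ Finset.Ico 1 (2 ^ (l + 1)),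
        θ.1.coeff (2 ^ (l + 1)) (PowerSeries.coeff m θ.f) * tL ^ m +
      ∑ m ∈ Finset.Ico 1 (2 ^ (l + 1)), θ.1.coeff (2 ^ (l + 1)) (θ.fTilde m ^ 2) * tL ^ m := by
    rw [← Finset.sum_add_distrib]
    refine Finset.sum_congr rfl fun m hm => ?_
    rw [xi_eq (Finset.mem_Ico.mp hm).1, HigherDerivation.coeff_add, add_mul]
  have hD : ∑ m ∈ Finset.range (2 ^ (l + 1)), θ.1.coeff m (s (2 ^ l)) * tL ^ m =
      s (2 ^ l) + ∑ m ∈ Finset.Ico 1 (2 ^ (l + 1)), θ.1.coeff m (s (2 ^ l)) * tL ^ m := by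
    rw [Finset.range_eq_Ico, Finset.sum_eq_sum_Ico_succ_bot (by positivity), pow_zero, mul_one,
      HigherDerivation.coeff_zero]
  have hs : θ.fTilde (2 ^ (l + 1)) = s (2 ^ l) := by rw [hq, fTilde_two_mul]
  rw [hC, hA, hs, hD]
  have hE := sum_mem (t := Finset.Ico 1 (2 ^ (l + 1))) (S := baseField C)
    (f := fun m => θ.1.coeff (2 ^ (l + 1)) (PowerSeries.coeff m θ.f) * tL ^ m) fun m hm =>
      (baseField C).mul_mem (θ.coeff_mem_baseField _ (h.coeff_f_mem m (Finset.mem_Ico.mp hm).2))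
        (ht m)
  convert (baseField C).add_mem ((baseField C).add_mem hE ((baseField C).pow_mem hB 2)) hcF using 1
  rw [CharTwo.add_sq, CharTwo.add_sq]
  linear_combination s (2 ^ l) ^ 2 * CharTwo.two_eq_zero (R := L C)

/-- The conditions at the stage `l` extend the good range from `2 ^ l` to `2 ^ (l + 1)`. -/
lemma succ (h : θ.GoodBelow l) (hS : θ.Stage l) : θ.GoodBelow (l + 1) := by
  refine ⟨h.iterativeAt_succ hS, fun m hm => ?_⟩
  rcases lt_trichotomy m (2 ^ l) with hm' | rfl | hm'
  · exact h.coeff_f_mem m hm'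
  · exact h.coeff_f_two_pow_mem hS
  · obtain ⟨m, rfl⟩ := Nat.exists_eq_add_of_le' hm'.le
    have : 2 ^ (l + 1) = 2 ^ l + 2 ^ l := by ring
    exact h.coeff_f_add_two_pow_mem hS (by omega) (by omega)

end GoodBelow

lemma goodBelow_of_stage {l : ℕ} (h : ∀ j < l, θ.Stage j) : θ.GoodBelow l := by
  induction l with
  | zero => exact goodBelow_zero
  | succ l ih => exact (ih fun j hj => h j (by omega)).succ (h l (by omega))

end HDL
end

/-! ### The conditions on an iterative derivation that commutes with `ρ` -/

section
variable {C : Type u} [Field C] [CharP C 2]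

namespace HDL
open PowerSeries
variable {θ θ' : HDL C}

lemma coeff_mul_of_mem_constField {l : ℕ} (a : L C) {b : L C} (hb : b ∈ constField C l) {m : ℕ}
    (hm : m < 2 ^ (l + 1)) : θ.1.coeff m (a * b) = θ.1.coeff m a * b := by
  rw [HigherDerivation.coeff, map_mul, PowerSeries.coeff_mul, Finset.sum_eq_single (m, 0)]
  · rw [← HigherDerivation.coeff, ← HigherDerivation.coeff, HigherDerivation.coeff_zero]
  · intro p hp hne
    rw [Finset.HasAntidiagonal.mem_antidiagonal] at hp
    have h0 : 0 < p.2 := Nat.pos_of_ne_zero fun h0 => hne (Prod.ext (by simp; omega) h0)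
    have := coeff_of_mem_constField (θ := θ) hb h0 (by omega)
    rw [HigherDerivation.coeff] at this
    rw [this, mul_zero]
  · intro h
    exact absurd (Finset.HasAntidiagonal.mem_antidiagonal.mpr (by simp)) h

/-- On `C(t)`, the operator `∑_{m < 2^(l+1)} t ^ m θ^(m)` has values in `C(t ^ (2 ^ (l + 1)))`:
it is linear over this field, and sends `t ^ v` to `(t + t) ^ v` for `v < 2 ^ (l + 1)`. -/
lemma sum_coeff_mul_tL_pow_mem_constField (l : ℕ) {a : L C} (ha : a ∈ baseField C) :
    ∑ m ∈ Finset.range (2 ^ (l + 1)), θ.1.coeff m a * tL ^ m ∈ constField C l := by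
  have hN : 0 < 2 ^ (l + 1) := by positivity
  let Ψ : L C → L C := fun a => ∑ m ∈ Finset.range (2 ^ (l + 1)), θ.1.coeff m a * tL ^ m
  have hadd : ∀ a b, Ψ (a + b) = Ψ a + Ψ b := by
    intro a b
    simp only [Ψ, HigherDerivation.coeff_add, add_mul, Finset.sum_add_distrib]
  have hmul : ∀ a b, b ∈ constField C l → Ψ (a * b) = Ψ a * b := by
    intro a b hb
    simp only [Ψ]
    rw [Finset.sum_mul]
    refine Finset.sum_congr rfl fun m hm => ?_
    rw [coeff_mul_of_mem_constField a hb (Finset.mem_range.mp hm), mul_right_comm]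
  have hpow : ∀ v < 2 ^ (l + 1), Ψ (tL ^ v) = 0 ^ v := by
    intro v hv
    have hc : ∀ m, θ.1.coeff m (tL ^ v) = tL ^ (v - m) * (v.choose m : L C) := by
      intro m
      rw [HigherDerivation.coeff, map_pow, θ.2.2, add_comm, add_pow, map_sum]
      have : ∀ k, PowerSeries.coeff m ((PowerSeries.X : (L C)⟦X⟧) ^ k *
          PowerSeries.C tL ^ (v - k) * (v.choose k : (L C)⟦X⟧)) =
          if k = m then tL ^ (v - m) * (v.choose m : L C) else 0 := by
        intro k
        rw [← map_natCast (PowerSeries.C (R := L C)), ← map_pow, mul_assoc, ← map_mul, mul_comm,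
          PowerSeries.coeff_C_mul, PowerSeries.coeff_X_pow]
        split_ifs with h1 h2 h2
        · rw [h1, mul_one]
        · exact absurd h1.symm h2
        · exact absurd h2.symm h1
        · rw [mul_zero]
      rw [Finset.sum_congr rfl fun k _ => this k, Finset.sum_ite_eq']
      split_ifs with hm
      · rfl
      · rw [Nat.choose_eq_zero_of_lt (by simpa using hm), Nat.cast_zero, mul_zero]
    have hsub : Finset.range (v + 1) ⊆ Finset.range (2 ^ (l + 1)) :=
      Finset.range_subset_range.mpr hv
    simp only [Ψ, hc]
    rw [← Finset.sum_subset hsub, ← CharTwo.add_self_eq_zero (tL : L C), add_pow]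
    · exact Finset.sum_congr rfl fun m _ => by ring
    · intro m _ hm
      rw [Nat.choose_eq_zero_of_lt (by simpa using hm), Nat.cast_zero, mul_zero, zero_mul]
  have hgen : (tL : L C) ^ 2 ^ (l + 1) ∈ constField C l :=
    IntermediateField.subset_adjoin C _ rfl
  -- Polynomials in `t`.
  have hpoly : ∀ p : Polynomial C, Ψ (Polynomial.aeval tL p) ∈ constField C l := by
    intro p
    induction p using Polynomial.induction_on' with
    | add p q hp hq => rw [map_add, hadd]; exact add_mem hp hq
    | monomial n c =>
      have hc : algebraMap C (L C) c * (tL ^ 2 ^ (l + 1)) ^ (n / 2 ^ (l + 1)) ∈ constField C l :=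
        mul_mem (IntermediateField.algebraMap_mem _ c) (pow_mem hgen _)
      have hn : (tL : L C) ^ n =
          tL ^ (n % 2 ^ (l + 1)) * (tL ^ 2 ^ (l + 1)) ^ (n / 2 ^ (l + 1)) := by
        rw [← pow_mul, ← pow_add, Nat.mod_add_div]
      rw [Polynomial.aeval_monomial, hn, mul_left_comm, hmul _ _ hc, hpow _ (Nat.mod_lt _ hN)]
      exact mul_mem (pow_mem (zero_mem _) _) hc
  have hfrob : ∀ p : Polynomial C, (Polynomial.aeval (tL : L C) p) ^ 2 ^ (l + 1) ∈
      constField C l := by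
    intro p
    induction p using Polynomial.induction_on' with
    | add p q hp hq => rw [map_add, add_pow_char_pow]; exact add_mem hp hq
    | monomial n c =>
      rw [Polynomial.aeval_monomial, mul_pow, ← map_pow, ← pow_mul, mul_comm n, pow_mul]
      exact mul_mem (IntermediateField.algebraMap_mem _ _) (pow_mem hgen _)
  obtain ⟨r, rfl⟩ := ha
  have halg : ∀ p : Polynomial C, algebraMap (RatFunc C) (L C) (algebraMap _ _ p) =
      Polynomial.aeval tL p := by
    intro p
    rw [tL, Polynomial.aeval_algebraMap_apply, ← RatFunc.algebraMap_X,
      Polynomial.aeval_algebraMap_apply, Polynomial.aeval_X_left_apply]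
  induction r using RatFunc.induction_on with
  | f p q hq =>
    have hq0 : Polynomial.aeval (tL : L C) q ≠ 0 := by
      rw [← halg]
      simpa using hq
    -- The denominator is replaced by its power of exponent `2 ^ (l + 1)`.
    have he : algebraMap (RatFunc C) (L C) (algebraMap _ _ p / algebraMap _ _ q) =
        Polynomial.aeval tL (p * q ^ (2 ^ (l + 1) - 1)) *
          ((Polynomial.aeval tL q) ^ 2 ^ (l + 1))⁻¹ := by
      rw [map_div₀, halg, halg, map_mul, map_pow, ← div_eq_mul_inv,
        div_eq_div_iff hq0 (pow_ne_zero _ hq0), mul_assoc, ← pow_succ, Nat.sub_add_cancel hN]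
    have := hmul (Polynomial.aeval tL (p * q ^ (2 ^ (l + 1) - 1))) _ (inv_mem (hfrob q))
    rw [← he] at this
    change Ψ _ ∈ _
    rw [this]
    exact mul_mem (hpoly _) (inv_mem (hfrob q))

/-- For an iterative `θ` that commutes with `ρ`, the element of `C(t ^ (2 ^ (l + 1)))` at the
stage `l` is `∑_{m < 2^(l+1)} θ^(m)(f_{2^l}) t ^ m`. -/
lemma stage_of_isIterative (hi : θ.1.IsIterative) (hρ : θ.CommutesWithRho) (l : ℕ) :
    θ.Stage l := by
  have hq : 0 < 2 ^ l := by positivity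
  have h2 : 2 ^ (l + 1) = 2 ^ l + 2 ^ l := by ring
  have hxi : ∀ m, m < 2 ^ l → θ.xi (m + 2 ^ l) = θ.1.coeff (2 ^ l) (θ.xi m) := by
    intro m hm
    rw [xi, xi, hi, add_comm (2 ^ l), cast_choose_add_two_pow, if_pos le_rfl,
      Nat.choose_eq_zero_of_lt hm, Nat.sub_self, Nat.choose_zero_right, Nat.cast_zero,
      Nat.cast_one, zero_add, one_mul]
  refine ⟨fun m _ hm => hxi m hm, _, sum_coeff_mul_tL_pow_mem_constField (θ := θ) l
    (θ.commutesWithRho_iff.mp hρ (2 ^ l)), ?_⟩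
  have hS : ∑ m ∈ Finset.range (2 ^ (l + 1)), θ.1.coeff m (θ.xi (2 ^ l)) * tL ^ m =
      θ.xi (2 ^ l) + ∑ m ∈ Finset.Ico 1 (2 ^ l), θ.1.coeff (2 ^ l) (θ.xi m) * tL ^ m := by
    rw [Finset.range_eq_Ico, Finset.sum_eq_sum_Ico_succ_bot (by positivity), pow_zero, mul_one,
      HigherDerivation.coeff_zero,
      ← Finset.sum_Ico_consecutive _ (by omega : 0 + 1 ≤ 2 ^ l) (by omega : 2 ^ l ≤ 2 ^ (l + 1))]
    have hz : ∑ m ∈ Finset.Ico (2 ^ l) (2 ^ (l + 1)),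
        θ.1.coeff m (θ.xi (2 ^ l)) * tL ^ m = 0 := by
      refine Finset.sum_eq_zero fun m hm => ?_
      rw [Finset.mem_Ico] at hm
      rw [xi, hi, cast_choose_of_lt_two_pow (l := l + 1) (by omega) (by omega) (by omega),
        zero_mul, zero_mul]
    rw [hz, add_zero]
    refine congrArg _ (Finset.sum_congr rfl fun m hm => ?_)
    rw [Finset.mem_Ico] at hm
    rw [← hxi m hm.2]
    have : θ.1.coeff m (θ.xi (2 ^ l)) = θ.xi (m + 2 ^ l) := by
      rw [xi, xi, hi, cast_choose_add_two_pow, if_neg (by omega), Nat.choose_self, add_zero,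
        Nat.cast_one, one_mul]
    rw [this]
  have hT : ∑ m ∈ Finset.range (2 ^ (l + 1)), θ.1.coeff m (θ.fTilde (2 ^ l) ^ 2) * tL ^ m =
      (∑ m ∈ Finset.range (2 ^ l), θ.1.coeff m (θ.fTilde (2 ^ l)) * tL ^ m) ^ 2 := by
    have h0 : 2 ^ (l + 1) = 2 * 2 ^ l := by ring
    rw [CharTwo.sum_sq, Finset.range_eq_Ico, Finset.range_eq_Ico,
      Finset.sum_eq_sum_Ico_succ_bot (by positivity), Finset.sum_eq_sum_Ico_succ_bot hq, zero_add,
      h0, sum_Ico_two_mul]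
    · rw [HigherDerivation.coeff_zero, HigherDerivation.coeff_zero, pow_zero, mul_one, mul_one]
      refine congrArg _ (Finset.sum_congr rfl fun m _ => ?_)
      rw [HigherDerivation.coeff_sq, if_pos (even_two_mul m), Nat.mul_div_cancel_left _ two_pos,
        mul_pow, ← pow_mul, mul_comm m 2]
    · intro m hm
      rw [HigherDerivation.coeff_sq, if_neg hm, zero_mul]
  simp only [θ.coeff_f _ hq, HigherDerivation.coeff_add, add_mul, Finset.sum_add_distrib]
  rw [hS, hT, mainTerm]
  linear_combination -(∑ m ∈ Finset.Ico 1 (2 ^ l), θ.1.coeff (2 ^ l) (θ.xi m) * tL ^ m +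
    (∑ m ∈ Finset.range (2 ^ l), θ.1.coeff m (θ.fTilde (2 ^ l)) * tL ^ m) ^ 2) *
      CharTwo.two_eq_zero (R := L C)

/-- The criterion: the stages together are equivalent to iterativity and commutation with `ρ`. -/
lemma isIterative_and_commutesWithRho_iff :
    (θ.1.IsIterative ∧ θ.CommutesWithRho) ↔ ∀ l, θ.Stage l := by
  constructor
  · rintro ⟨hi, hρ⟩ l
    exact stage_of_isIterative hi hρ l
  · intro h
    have hg : ∀ l, θ.GoodBelow l := fun l => goodBelow_of_stage fun j _ => h j
    refine ⟨fun i j a => ?_, θ.commutesWithRho_iff.mpr fun m => ?_⟩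
    · have hij : i + j < 2 ^ (i + j) := Nat.lt_two_pow_self
      exact (hg (i + j)).iterativeAt a i (by omega) j (by omega)
    · exact (hg m).coeff_f_mem m Nat.lt_two_pow_self

/-! ### Recursive construction -/

/-- In a good range, `θ^(2^l)(ξ_m)` depends only on the `ξ_k` with `k < 2 ^ l`, since `ξ_m` is
the sum of an element of `C(t)` and a square. -/
lemma GoodBelow.coeff_xi_eq {l : ℕ} (h : θ.GoodBelow l) (hx : ∀ m < 2 ^ l, θ.xi m = θ'.xi m)
    {m : ℕ} (hm : 0 < m) (hm' : m < 2 ^ l) :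
    θ.1.coeff (2 ^ l) (θ.xi m) = θ'.1.coeff (2 ^ l) (θ'.xi m) := by
  have hq : 0 < 2 ^ l := by positivity
  rw [← hx m hm', xi_eq hm, HigherDerivation.coeff_add, HigherDerivation.coeff_add,
    θ.coeff_eq_of_mem_baseField θ' _ (h.coeff_f_mem m hm'), HigherDerivation.coeff_sq,
    HigherDerivation.coeff_sq, coeff_eq_of_xi_eq hx (by omega)]

lemma GoodBelow.mainTerm_eq {l : ℕ} (h : θ.GoodBelow l) (hx : ∀ m < 2 ^ l, θ.xi m = θ'.xi m) :
    θ.mainTerm l = θ'.mainTerm l := by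
  have hq : 0 < 2 ^ l := by positivity
  rw [mainTerm, mainTerm]
  refine congrArg₂ (· + ·) (Finset.sum_congr rfl fun m hm => ?_)
    (congrArg (· ^ 2) (Finset.sum_congr rfl fun m hm => ?_))
  · rw [Finset.mem_Ico] at hm
    rw [h.coeff_xi_eq hx hm.1 hm.2]
  · rw [Finset.mem_range] at hm
    rw [coeff_eq_of_xi_eq hx hm, fTilde_eq_of_xi_eq hx (by omega)]

lemma Stage.of_xi_eq {N l : ℕ} (h : θ.Stage l) (hx : ∀ m < N, θ.xi m = θ'.xi m)
    (hl : 2 ^ (l + 1) ≤ N) : θ'.Stage l := by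
  have h2 : 2 ^ (l + 1) = 2 ^ l + 2 ^ l := by ring
  have hq : 0 < 2 ^ l := by positivity
  obtain ⟨h1, c, hc, he⟩ := h
  have hm : θ.mainTerm l = θ'.mainTerm l := by
    rw [mainTerm, mainTerm]
    refine congrArg₂ (· + ·) (Finset.sum_congr rfl fun m hm => ?_)
      (congrArg (· ^ 2) (Finset.sum_congr rfl fun m hm => ?_))
    · rw [Finset.mem_Ico] at hm
      rw [hx m (by omega), coeff_eq_of_xi_eq hx (by omega)]
    · rw [Finset.mem_range] at hm
      rw [coeff_eq_of_xi_eq hx (by omega), fTilde_eq_of_xi_eq hx (by omega)]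
  refine ⟨fun m hm0 hmq => ?_, c, hc, ?_⟩
  · rw [← hx _ (by omega), ← hx _ (by omega), h1 m hm0 hmq, coeff_eq_of_xi_eq hx (by omega)]
  · rw [← hx _ (by omega), he, hm]

/-- Arbitrary elements of the cosets can be prescribed: by `GoodBelow.mainTerm_eq` and
`GoodBelow.coeff_xi_eq`, the right-hand sides at each stage may be computed from any higher
derivation with the same `ξ_k` in lower order. -/
lemma exists_stage (c : ℕ → L C) (hc : ∀ l, c l ∈ constField C l) :
    ∃ θ : HDL C, ∀ l, θ.Stage l ∧ θ.xi (2 ^ l) = θ.mainTerm l + c l := by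
  obtain ⟨θ, hθ⟩ := exists_recursive (C := C) fun n η =>
    if n = 2 ^ Nat.log 2 n then η.mainTerm (Nat.log 2 n) + c (Nat.log 2 n)
    else η.1.coeff (2 ^ Nat.log 2 n) (η.xi (n - 2 ^ Nat.log 2 n))
  refine ⟨θ, fun l => ?_⟩
  induction l using Nat.strong_induction_on with
  | _ l ih =>
    have hq : 0 < 2 ^ l := by positivity
    have hgood : ∀ (N : ℕ) (η : HDL C), 2 ^ l ≤ N → (∀ m < N, η.xi m = θ.xi m) →
        η.GoodBelow l := by
      intro N η hN hη
      refine goodBelow_of_stage fun j hj => (ih j hj).1.of_xi_eq (N := N)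
        (fun m hm => (hη m hm).symm) ?_
      exact (Nat.pow_le_pow_right two_pos hj).trans hN
    have hx : θ.xi (2 ^ l) = θ.mainTerm l + c l := by
      obtain ⟨η, hη, he⟩ := hθ (2 ^ l) hq
      rw [Nat.log_pow one_lt_two, if_pos rfl] at he
      rw [he, (hgood _ η le_rfl hη).mainTerm_eq hη]
    refine ⟨⟨fun m hm hm' => ?_, c l, hc l, hx⟩, hx⟩
    obtain ⟨η, hη, he⟩ := hθ (m + 2 ^ l) (by omega)
    have hlog : Nat.log 2 (m + 2 ^ l) = l := by
      refine (Nat.log_eq_iff (Or.inr ⟨one_lt_two, by omega⟩)).mpr ⟨by omega, ?_⟩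
      rw [pow_succ]
      omega
    rw [hlog, if_neg (by omega), Nat.add_sub_cancel] at he
    rw [he]
    exact (hgood _ η (by omega) hη).coeff_xi_eq (fun k hk => hη k (by omega)) hm hm'

lemma eq_of_stage {c : ℕ → L C} (h : ∀ l, θ.Stage l) (h' : ∀ l, θ'.Stage l)
    (hc : ∀ l, θ.xi (2 ^ l) = θ.mainTerm l + c l)
    (hc' : ∀ l, θ'.xi (2 ^ l) = θ'.mainTerm l + c l) : θ = θ' := by
  have key : ∀ l, ∀ m < 2 ^ l, θ.xi m = θ'.xi m := by
    intro l
    induction l with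
    | zero =>
      intro m hm
      rw [pow_zero, Nat.lt_one_iff] at hm
      rw [hm, xi_zero, xi_zero]
    | succ l ih =>
      intro m hm
      have hg : θ.GoodBelow l := goodBelow_of_stage fun j _ => h j
      rcases lt_trichotomy m (2 ^ l) with hm' | rfl | hm'
      · exact ih m hm'
      · rw [hc, hc', hg.mainTerm_eq ih]
      · obtain ⟨m, rfl⟩ := Nat.exists_eq_add_of_le' hm'.le
        have h2 : 2 ^ (l + 1) = 2 ^ l + 2 ^ l := by ring
        rw [(h l).1 m (by omega) (by omega), (h' l).1 m (by omega) (by omega),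
          hg.coeff_xi_eq ih (by omega) (by omega)]
  exact eq_of_xi_eq fun m => key m m Nat.lt_two_pow_self

end HDL
end

end StrongFormula
end

theorem mainTheorem4 (C : Type*) [Field C] [CharP C 2] :
    -- the criterion
    (∀ θ : StrongFormula.HDL C,
      (θ.1.IsIterative ∧ θ.CommutesWithRho) ↔ ∀ l : ℕ, θ.Stage l) ∧
    -- at each stage, the right-hand sides are determined by the elements chosen before
    (∀ (l : ℕ) (θ θ' : StrongFormula.HDL C),
      (∀ j < l, θ.Stage j) → (∀ j < l, θ'.Stage j) → (∀ m < 2 ^ l, θ.xi m = θ'.xi m) →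
        θ.mainTerm l = θ'.mainTerm l ∧
        ∀ m, 0 < m → m < 2 ^ l →
          θ.1.coeff (2 ^ l) (θ.xi m) = θ'.1.coeff (2 ^ l) (θ'.xi m)) ∧
    -- all choices in the successive cosets are possible, and they determine the derivation
    (∀ c : ℕ → StrongFormula.L C, (∀ l, c l ∈ StrongFormula.HDL.constField C l) →
      ∃! θ : StrongFormula.HDL C, θ.1.IsIterative ∧ θ.CommutesWithRho ∧
        ∀ l, θ.xi (2 ^ l) = θ.mainTerm l + c l) := by
  refine ⟨fun θ => StrongFormula.HDL.isIterative_and_commutesWithRho_iff,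
    fun l θ θ' h _ hx => ?_, fun c hc => ?_⟩
  · have hg := StrongFormula.HDL.goodBelow_of_stage h
    exact ⟨hg.mainTerm_eq hx, fun m hm hm' => hg.coeff_xi_eq hx hm hm'⟩
  · obtain ⟨θ, hθ⟩ := StrongFormula.HDL.exists_stage c hc
    obtain ⟨hi, hρ⟩ := StrongFormula.HDL.isIterative_and_commutesWithRho_iff.mpr fun l => (hθ l).1
    refine ⟨θ, ⟨hi, hρ, fun l => (hθ l).2⟩, fun θ' h => ?_⟩
    exact StrongFormula.HDL.eq_of_stage (StrongFormula.HDL.stage_of_isIterative h.1 h.2.1)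
      (fun l => (hθ l).1) h.2.2 fun l => (hθ l).2
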